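/- Let $\mathfrak g$ be a simple finite-dimensional complex Lie algebra with Cartan subalgebra $\mathfrak h$ and Killing form $(-,-)$; roots are functionals on $\mathfrak h$ and are identified with elements of $\mathfrak h$ by means of $(-,-)$. Let $\sigma$ be an element of the Weyl group, acting on $\mathfrak h$, such that (i) $1$ is not an eigenvalue of $\sigma$ on $\mathfrak h$; (ii) there is an inner automorphism $\tilde\sigma$ of $\mathfrak g$ with $\tilde\sigma|_{\mathfrak h}=\sigma$ and $\operatorname{ord}\tilde\sigma=\operatorname{ord}\sigma$. Fix such a $\tilde\sigma$ and let $\mathfrak g_0=\{x\in\mathfrak g:\tilde\sigma x=x\}$. For generators $e_\alpha$ of the root spaces normalized by $[e_\alpha,e_{-\alpha}]=\alpha$, let $\mathfrak a$ be the real span of all $\alpha$, $e_\alpha+e_{-\alpha}$ and $i(e_\alpha-e_{-\alpha})$. Then $\mathfrak g=\mathfrak a\oplus i\mathfrak a$; let $*:\mathfrak g\to\mathfrak g$, $x+iy\mapsto x-iy$ for $x,y\in\mathfrak a$, so that $\mathfrak g^{*=1}=\mathfrak a$. The generators can be chosen such that $*$ commutes with $\tilde\sigma$ and such that, moreover, $i\mathfrak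 a$ is a real Lie subalgebra of $\mathfrak g$ (a compact real form; $*$ is then Kostant's involution). For every choice of generators such that $*$ commutes with $\tilde\sigma$ the following holds. Let $\Lambda_+\in\mathfrak h$ be an eigenvector of $\sigma$, let $\Lambda_-=*(\Lambda_+)$, and let $\gamma_1,\dots,\gamma_s$ be representatives of the orbits of the cyclic group $\langle\sigma\rangle$ on the set of roots. Then the classical masses of the Toda--Weyl Lagrangian $$L=\tfrac12(\partial_\mu\phi,\partial^\mu\phi)-(\exp(\operatorname{ad}\phi)\Lambda_+,\Lambda_-),\qquad \phi:\mathbb R^2\to\mathfrak g_0\cap\mathfrak g^{*=1},$$ are, with multiplicity, exactly $$m_i=|\gamma_i(\Lambda_+)|,\qquad 1\le i\le s.$$ Here $m_1,\dots,m_s\ge 0$ are called the classical masses of a Lagrangian density in $\phi$ and $\partial_\mu\phi$, with $\phi$ valued in a finite-dimensional real vector space $V$, if there is a real-linear isomorphism $X:\mathbb R^s\to V$ such that after the field redefinition $\phi=X(\phi_1,\dots,\phi_s)$ $$L=\text{const}+\tfrac12\sum_{i=1}^s\partial_\mu\phi_i\,\partial^\mu\phi_i-\tfrac12\sum_{i=1}^s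 m_i^2\phi_i^2+(\text{terms of order at least }3),$$ where $\partial_\mu f\,\partial^\mu f=(\partial_0f)^2-(\partial_1f)^2$. -/

import Mathlib

open LieAlgebra LieModule Filter
open scoped Topology

noncomputable section

namespace TodaWeyl

/-! ### Exponentials and inner automorphisms -/

section Inner

variable {L : Type*} [LieRing L] [LieAlgebra ℂ L] [FiniteDimensional ℂ L]

/-- The exponential `∑ fⁿ / n!` of an endomorphism of a finite-dimensional complex vector space,
computed in a basis (the result does not depend on the basis). -/
def expEnd (f : Module.End ℂ L) : Module.End ℂ L :=
  Matrix.toLin (Module.finBasis ℂ L) (Module.finBasis ℂ L)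
    (NormedSpace.exp (LinearMap.toMatrix (Module.finBasis ℂ L) (Module.finBasis ℂ L) f))

variable (L) in
/-- The group of inner automorphisms of `L`, generated by the `exp (ad x)`, `x ∈ L`. -/
def innerAut : Subgroup (L ≃ₗ[ℂ] L) :=
  Subgroup.closure {τ | ∃ x : L, (τ : Module.End ℂ L) = expEnd (ad ℂ L x)}

end Inner

variable {L : Type*} [LieRing L] [LieAlgebra ℂ L] [FiniteDimensional ℂ L] [IsKilling ℂ L]

/-! ### Weyl group, root vectors, Hermitian operators -/

section Roots

variable (H : LieSubalgebra ℂ L) [H.IsCartanSubalgebra]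

/-- The Weyl group acting on the Cartan subalgebra `H`: it is generated by the reflections
`x ↦ x - α x • coroot α`, where `α x • coroot α = (2 (α, x) / (α, α)) • α` when `α` is viewed as
an element of `H` by means of the Killing form. -/
def weylGroup : Subgroup (H ≃ₗ[ℂ] H) :=
  Subgroup.closure (Set.range (IsKilling.rootSystem H).coreflection)

variable {H}

/-- The root `α` viewed as an element of `L`: the `t ∈ H` for which the Killing form
satisfies `(t, x) = α x` for all `x ∈ H`. -/
def rootElt (α : H.root) : L :=
  (((IsKilling.cartanEquivDual H).symm (Weight.toLinear ℂ H L α) : H) : L)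

variable (H) in
/-- Generators `e α` of the root spaces, normalized by `⁅e α, e (-α)⁆ = α`. -/
structure RootVectors where
  e : H.root → L
  e_mem : ∀ α : H.root, e α ∈ rootSpace H (α : Weight ℂ H L)
  lie_e : ∀ α β : H.root, (β : Weight ℂ H L) = -(α : Weight ℂ H L) → ⁅e α, e β⁆ = rootElt α

/-- The real span `𝔞` of the `α`, the `e α + e (-α)` and the `i (e α - e (-α))`. -/
def RootVectors.hermitian (E : RootVectors H) : Submodule ℝ L :=
  Submodule.span ℝ
    ({z | ∃ α : H.root, z = rootElt α} ∪
     {z | ∃ α β : H.root, (β : Weight ℂ H L) = -(α : Weight ℂ H L) ∧ z = E.e α + E.e β} ∪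
     {z | ∃ α β : H.root, (β : Weight ℂ H L) = -(α : Weight ℂ H L) ∧
        z = Complex.I • (E.e α - E.e β)})

/-- The root vectors are of compact type if `i𝔞` is a real Lie subalgebra of `L`, i.e. if
`⁅i x, i y⁆ = -⁅x, y⁆` lies in `i𝔞` for all `x, y ∈ 𝔞`. Then `i𝔞` is a compact real form. -/
def RootVectors.IsCompactType (E : RootVectors H) : Prop :=
  ∀ x ∈ E.hermitian, ∀ y ∈ E.hermitian, Complex.I • ⁅x, y⁆ ∈ E.hermitian

/-- `star` is the conjugate-linear involution `x + i y ↦ x - i y`, for `x, y ∈ 𝔞`. As `L` is the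
direct sum of `𝔞` and `i𝔞`, there is exactly one such map for given root vectors. -/
def RootVectors.IsInvolution (E : RootVectors H) (star : L →ₛₗ[starRingEnd ℂ] L) : Prop :=
  ∀ x ∈ E.hermitian, ∀ y ∈ E.hermitian, star (x + Complex.I • y) = x - Complex.I • y

/-- The roots `α` and `β` lie in the same orbit of the cyclic group generated by `σ`. -/
def SameOrbit (σ : H ≃ₗ[ℂ] H) (α β : H.root) : Prop :=
  ∃ k : ℤ, ∀ x : H, (β : Weight ℂ H L) ((σ ^ k) x) = (α : Weight ℂ H L) x

end Roots

/-! ### Lagrangian densities and their classical masses -/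

section Lagrangian

/-- A first-order Lagrangian density for fields `φ : ℝ² → V`; on the field `φ` it takes, at the
point `x`, the value `𝓛 (φ x) ![∂₀ φ x, ∂₁ φ x]`. -/
abbrev LagrangianDensity (V : Type*) := V → (Fin 2 → V) → ℂ

/-- The multiset `M` is the mass spectrum of `𝓛`: after an invertible linear field redefinition `X`
the density is, for real scalar fields `φ₁, …, φₛ`,
`½ ∑ᵢ ∂_μ φᵢ ∂^μ φᵢ + c - ½ ∑ᵢ mᵢ² φᵢ² + (terms of order at least three)`
with a constant `c`, with `mᵢ ≥ 0` and `M = {m₁, …, mₛ}`; here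
`∂_μ f ∂^μ f = (∂₀ f)² - (∂₁ f)²`. -/
def IsMassSpectrum {V : Type*} [AddCommGroup V] [Module ℝ V]
    (𝓛 : LagrangianDensity V) (M : Multiset ℝ) : Prop :=
  ∃ (s : ℕ) (X : (Fin s → ℝ) ≃ₗ[ℝ] V) (m : Fin s → ℝ) (c : ℂ),
    (∀ i, 0 ≤ m i) ∧ M = Finset.univ.val.map m ∧
    (fun j : (Fin s → ℝ) × (Fin 2 → Fin s → ℝ) =>
        𝓛 (X j.1) (fun μ => X (j.2 μ)) -
          (((1 / 2 * ∑ i, (j.2 0 i ^ 2 - j.2 1 i ^ 2) : ℝ) : ℂ) + c -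
            ((1 / 2 * ∑ i, m i ^ 2 * j.1 i ^ 2 : ℝ) : ℂ)))
      =O[𝓝 0] (fun j => ‖j‖ ^ 3)

/-- The target space `𝔤₀ ∩ 𝔤^{* = 1}` of the field, where `𝔤₀` is the fixed space of `τ`. -/
def fieldSpace (τ : L ≃ₗ⁅ℂ⁆ L) (star : L →ₛₗ[starRingEnd ℂ] L) : Submodule ℝ L where
  carrier := {x | τ x = x ∧ star x = x}
  add_mem' := by
    rintro x y ⟨hx, hx'⟩ ⟨hy, hy'⟩
    exact ⟨by rw [map_add, hx, hy], by rw [map_add, hx', hy']⟩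
  zero_mem' := ⟨map_zero _, map_zero _⟩
  smul_mem' := by
    rintro r x ⟨hx, hx'⟩
    refine ⟨?_, ?_⟩
    · rw [← Complex.coe_smul r x, map_smul, hx]
    · rw [← Complex.coe_smul r x, LinearMap.map_smulₛₗ, hx', Complex.conj_ofReal]

/-- The Toda–Weyl Lagrangian `½ (∂_μ φ, ∂^μ φ) - (exp (ad φ) Λ₊, Λ₋)` with values of `φ` in the real
subspace `V` of `L`, where `(-,-)` is the Killing form. -/
def todaWeyl (V : Submodule ℝ L) (Λp Λm : L) : LagrangianDensity V := fun φ p =>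
  1 / 2 * (killingForm ℂ L (p 0 : L) (p 0 : L) - killingForm ℂ L (p 1 : L) (p 1 : L))
    - killingForm ℂ L (expEnd (ad ℂ L (φ : L)) Λp) Λm

end Lagrangian

end TodaWeyl

end

/-! Expand `exp (ad φ)` to second order. The linear term vanishes because Λ₊ and Λ₋ commute, and the
quadratic term is ½ (φ, ad Λ₋ ad Λ₊ φ). The operator `massOp`, ad Λ₋ ∘ ad Λ₊, kills 𝔥 and is the
scalar |α(Λ₊)|² on the root space of α, since α(*Λ) is the conjugate of α(Λ). It is self-adjoint for
the Killing form, commutes with *, and commutes with the lift of σ because the eigenvalue of Λ₊ is a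
root of unity. The Killing form is positive definite on 𝔞, so both quadratic forms can be
diagonalized together on the field space. Conversely, every admissible field redefinition
diagonalizes `massOp` on 𝔤₀, the complexification of the field space, so the squared masses are the
roots of a characteristic polynomial.

It remains to find a basis of 𝔤₀. Since σ has no eigenvalue 1, averaging over the lift kills 𝔥. The
averages of root vectors, one per orbit, form a basis once none of them vanishes, that is, once
every power of the lift that fixes a root also fixes its root space pointwise. This is the crux,
`IsLift.prod_liftCoeff_eq_one`. Let the lift send e_α to u(α) e_{πα}, with root vectors adapted to
the Chevalley involution; the claim is that u has product 1 over an orbit. Orbit sums of roots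
vanish, and u² is multiplicative on sums of roots, so by `prod_eq_one_of_sum_eq_zero` the product is
±1.

On an additively closed set of roots of equal length the structure constants are, up to a constant
and a coboundary, signs (-1)^β with β a bilinear form on the root lattice. Then u is multiplicative
up to a correction whose product over an orbit is 1 by a parity argument
(`IsLift.prod_liftCoeff_eq_one_of_len_eq`). This settles long roots and orbits whose span contains
only roots of one length. Otherwise a product -1 forces the order n of σ to be even, and the
(n/2)-th power s of π is nontrivial (here equality of the orders enters) but fixes the span of the
orbit. Type G₂ is excluded by dimension. For length ratio two, s negates some long root
(`IsLift.exists_long_map_eq_neg`); half its sum with a fixed long root δ is a root e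
(`exists_half_add`) with δ = e + s e. On such a root space the involution acts by -1, against the
result for long roots.

For the existence of a commuting involution of compact type, |u| is multiplicative, so a positive
rescaling of root vectors makes |u| = 1 without changing structure constants
(`IsLift.exists_commute`). -/

noncomputable section

namespace TodaWeyl

open LieAlgebra.IsKilling

set_option linter.unusedSectionVars false

section Killing

variable {L : Type*} [LieRing L] [LieAlgebra ℂ L] [FiniteDimensional ℂ L] [IsKilling ℂ L]
  {H : LieSubalgebra ℂ L} [H.IsCartanSubalgebra]

/-! ### Roots and root spaces -/

section RootSpaces

/-- The negative of a root. -/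
def negRoot (α : H.root) : H.root :=
  ⟨-(α : Weight ℂ H L), by simpa using H.isNonZero_coe_root α⟩

@[simp] lemma coe_negRoot (α : H.root) : (negRoot α : Weight ℂ H L) = -(α : Weight ℂ H L) := rfl

lemma root_negRoot (α : H.root) :
    (rootSystem H).root (negRoot α) = -(rootSystem H).root α := by
  ext x; simp

lemma negRoot_negRoot (α : H.root) : negRoot (negRoot α) = α := by
  apply Subtype.ext; simp

lemma root_injective : Function.Injective (rootSystem H).root := (rootSystem H).root.injective

lemma eq_negRoot {α β : H.root} (h : (rootSystem H).root β = -(rootSystem H).root α) :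
    β = negRoot α :=
  root_injective (h.trans (root_negRoot α).symm)

lemma coe_eq_neg_iff {α β : H.root} :
    (β : Weight ℂ H L) = -(α : Weight ℂ H L) ↔ β = negRoot α :=
  ⟨fun h => Subtype.ext h, fun h => h ▸ rfl⟩

lemma negRoot_ne (α : H.root) : negRoot α ≠ α := by
  intro h
  have h1 := root_negRoot α
  rw [h] at h1
  refine (rootSystem H).ne_zero α ?_
  have h2 : (2 : ℂ) • (rootSystem H).root α = 0 := by
    rw [two_smul]; nth_rewrite 1 [h1]; exact neg_add_cancel _
  exact (smul_eq_zero.mp h2).resolve_left two_ne_zero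

/-- The root space of a root, as a subspace. -/
abbrev rsp (α : H.root) : LieSubmodule ℂ H L := rootSpace H (α : Weight ℂ H L)

lemma lie_mem_rsp {α β γ : H.root}
    (h : (rootSystem H).root γ = (rootSystem H).root α + (rootSystem H).root β)
    {x y : L} (hx : x ∈ rsp α) (hy : y ∈ rsp β) : ⁅x, y⁆ ∈ rsp γ := by
  have := lie_mem_genWeightSpace_of_mem_genWeightSpace hx hy
  convert this using 2
  funext z
  exact congrArg (fun f => f z) h

lemma lie_eq_zero_of_add_notMem {α β : H.root}
    (h : (rootSystem H).root α + (rootSystem H).root β ∉ Set.range (rootSystem H).root)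
    (h0 : (rootSystem H).root α + (rootSystem H).root β ≠ 0)
    {x y : L} (hx : x ∈ rsp α) (hy : y ∈ rsp β) : ⁅x, y⁆ = 0 := by
  by_contra hne
  have hm := lie_mem_genWeightSpace_of_mem_genWeightSpace hx hy
  have hb : genWeightSpace L ((α : Weight ℂ H L) + (β : Weight ℂ H L) : H → ℂ) ≠ ⊥ := by
    intro hb
    rw [hb] at hm
    exact hne (by simpa using hm)
  let w : Weight ℂ H L := ⟨_, hb⟩
  have hw : (w : H → ℂ) = (α : Weight ℂ H L) + (β : Weight ℂ H L) := rfl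
  have hnz : w.IsNonZero := by
    intro hz
    apply h0
    ext z
    have := congrFun (hw.symm.trans hz) z
    simpa using this
  refine h ⟨⟨w, by simpa using hnz⟩, ?_⟩
  ext z
  exact congrFun hw z

lemma lie_coe_rsp {α : H.root} {x : L} (hx : x ∈ rsp α) (z : H) :
    ⁅(z : L), x⁆ = (rootSystem H).root α z • x :=
  lie_eq_smul_of_mem_rootSpace hx z

lemma exists_mem_rsp_ne_zero (α : H.root) : ∃ x ∈ rsp α, x ≠ 0 :=
  (α : Weight ℂ H L).exists_ne_zero

lemma exists_eq_smul {α : H.root} {x y : L} (hx : x ∈ rsp α) (hx0 : x ≠ 0) (hy : y ∈ rsp α) :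
    ∃ c : ℂ, y = c • x := by
  have h1 := finrank_rootSpace_eq_one (α : Weight ℂ H L) (H.isNonZero_coe_root α)
  have hx0' : (⟨x, hx⟩ : rsp α) ≠ 0 := by
    intro h; exact hx0 (congrArg Subtype.val h)
  obtain ⟨c, hc⟩ := (finrank_eq_one_iff_of_nonzero' _ hx0').mp h1 ⟨y, hy⟩
  exact ⟨c, (congrArg Subtype.val hc).symm⟩

lemma killingForm_comm (x y : L) : killingForm ℂ L x y = killingForm ℂ L y x :=
  traceForm_comm ℂ L L x y

lemma killingForm_lie (x y z : L) : killingForm ℂ L ⁅x, y⁆ z = killingForm ℂ L x ⁅y, z⁆ :=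
  traceForm_apply_lie_apply ℂ L L x y z

lemma killingForm_rsp_eq_zero {α β : H.root} (h : β ≠ negRoot α) {x y : L}
    (hx : x ∈ rsp α) (hy : y ∈ rsp β) : killingForm ℂ L x y = 0 := by
  refine killingForm_apply_eq_zero_of_mem_rootSpace_of_add_ne_zero ℂ L H hx hy fun h0 => h ?_
  apply eq_negRoot
  rw [eq_neg_iff_add_eq_zero, add_comm]
  ext z
  exact congrFun h0 z

lemma killingForm_coe_rsp (z : H) {α : H.root} {x : L} (hx : x ∈ rsp α) :
    killingForm ℂ L (z : L) x = 0 := by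
  have hz : (z : L) ∈ rootSpace H (0 : H → ℂ) := by
    have := z.2
    rw [← LieSubalgebra.mem_toLieSubmodule, ← rootSpace_zero_eq ℂ L H] at this
    exact this
  refine killingForm_apply_eq_zero_of_mem_rootSpace_of_add_ne_zero ℂ L H hz hx fun h0 => ?_
  rw [zero_add] at h0
  exact H.isNonZero_coe_root α h0

/-- The element of `H` that represents the root `α` under the Killing form. -/
def rootH (α : H.root) : H := (cartanEquivDual H).symm (Weight.toLinear ℂ H L α)

lemma killingForm_rootH (α : H.root) (z : H) :
    killingForm ℂ L (rootH α : L) (z : L) = (rootSystem H).root α z := by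
  have : cartanEquivDual H (rootH α) z = (rootSystem H).root α z := by
    rw [rootH, LinearEquiv.apply_symm_apply]; rfl
  rw [← this]; rfl

lemma rootH_negRoot (α : H.root) : rootH (negRoot α) = -rootH α := by
  rw [rootH, rootH, ← map_neg]
  congr 1

lemma lie_eq_killingForm_smul {α : H.root} {x y : L} (hx : x ∈ rsp α) (hy : y ∈ rsp (negRoot α)) :
    ⁅x, y⁆ = killingForm ℂ L x y • (rootH α : L) :=
  lie_eq_killingForm_smul_of_mem_rootSpace_of_mem_rootSpace_neg hx hy

/-- The squared length of a root with respect to the Killing form. -/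
def len (α : H.root) : ℂ := (rootSystem H).root α (rootH α)

lemma len_ne_zero (α : H.root) : len α ≠ 0 :=
  root_apply_cartanEquivDual_symm_ne_zero (H.isNonZero_coe_root α)

lemma coroot_eq (α : H.root) : (rootSystem H).coroot α = (2 / len α) • rootH α := by
  rw [rootSystem_coroot_apply, coroot, div_eq_mul_inv, ← smul_smul]
  rw [← Nat.cast_smul_eq_nsmul ℂ]
  rfl

lemma rootH_eq (α : H.root) : rootH α = (len α / 2) • (rootSystem H).coroot α := by
  rw [coroot_eq, smul_smul]
  have := len_ne_zero α
  rw [show len α / 2 * (2 / len α) = 1 by field_simp, one_smul]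

lemma root_rootH (α β : H.root) :
    (rootSystem H).root α (rootH β) = ((rootSystem H).pairingIn ℤ α β : ℂ) * (len β / 2) := by
  rw [rootH_eq, map_smul, smul_eq_mul, mul_comm]
  congr 1
  have := (rootSystem H).algebraMap_pairingIn ℤ α β
  simp only [algebraMap_int_eq, eq_intCast] at this
  rw [this]; rfl

lemma root_rootH_comm (α β : H.root) :
    (rootSystem H).root α (rootH β) = (rootSystem H).root β (rootH α) := by
  rw [← killingForm_rootH, ← killingForm_rootH, killingForm_comm]

lemma pairing_mul_len (α β : H.root) :
    ((rootSystem H).pairingIn ℤ α β : ℂ) * len β = (rootSystem H).pairingIn ℤ β α * len α := by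
  have := root_rootH_comm α β
  rw [root_rootH, root_rootH] at this
  linear_combination 2 * this

lemma killingForm_coe_coe (y z : H) : killingForm ℂ L (y : L) (z : L) =
    ∑ α : H.root, (rootSystem H).root α y * (rootSystem H).root α z := by
  have h := congrArg (fun B => B y z) (restrict_killingForm_eq_sum (K := ℂ) (L := L) (H := H))
  simp only [LinearMap.sum_apply] at h
  have h2 := Finset.sum_attach H.root
    (fun α => (Weight.toLinear ℂ H L α) y * (Weight.toLinear ℂ H L α) z)
  exact h.trans h2.symm

/-- Squared lengths of roots are positive real numbers. -/
lemma exists_len_eq (α : H.root) : ∃ r : ℝ, 0 < r ∧ len α = r := by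
  have h1 : killingForm ℂ L (rootH α : L) (rootH α : L) = len α := killingForm_rootH α _
  rw [killingForm_coe_coe] at h1
  -- Evaluating the Killing form as Σ β ⊗ β at t_α, with β(t_α) = p · len α / 2 for integers p,
  -- gives len α = (Σ p²) (len α)² / 4. Hence the witness `4 / S`.
  have h2 : (∑ β : H.root, (((rootSystem H).pairingIn ℤ β α : ℂ)) ^ 2) * (len α / 4) = 1 := by
    have hl := len_ne_zero α
    have : len α * ((∑ β : H.root, (((rootSystem H).pairingIn ℤ β α : ℂ)) ^ 2) * (len α / 4))
        = len α * 1 := by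
      rw [mul_one]
      conv_rhs => rw [← h1]
      rw [Finset.sum_mul, Finset.mul_sum]
      refine Finset.sum_congr rfl fun β _ => ?_
      rw [root_rootH]; ring
    exact mul_left_cancel₀ hl this
  set S : ℤ := ∑ β : H.root, ((rootSystem H).pairingIn ℤ β α) ^ 2 with hS
  have hS' : (∑ β : H.root, (((rootSystem H).pairingIn ℤ β α : ℂ)) ^ 2) = S := by
    rw [hS]; push_cast; rfl
  rw [hS'] at h2
  have hS0 : 0 ≤ S := Finset.sum_nonneg fun _ _ => sq_nonneg _
  have hSne : (S : ℂ) ≠ 0 := by rintro h; rw [h] at h2; simp at h2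
  have hSpos : 0 < S := lt_of_le_of_ne hS0 (by rintro h; exact hSne (by rw [← h]; simp))
  refine ⟨4 / S, by positivity, ?_⟩
  push_cast
  field_simp
  linear_combination 4 * h2

lemma eq_sum_rootH (z : H) : z = ∑ α : H.root, (rootSystem H).root α z • rootH α := by
  apply (cartanEquivDual H).injective
  ext y
  change killingForm ℂ L (z : L) (y : L) =
    killingForm ℂ L ((∑ α : H.root, (rootSystem H).root α z • rootH α : H) : L) (y : L)
  rw [killingForm_coe_coe, killingForm_coe_coe]
  have h : ∀ w : H, killingForm ℂ L (w : L) (y : L) = cartanEquivDual H w y := fun _ => rfl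
  rw [← killingForm_coe_coe, ← killingForm_coe_coe, h (∑ α : H.root, _), map_sum,
    LinearMap.sum_apply, killingForm_coe_coe]
  refine Finset.sum_congr rfl fun α _ => ?_
  rw [map_smul, LinearMap.smul_apply, ← h, killingForm_rootH, smul_eq_mul]

/-- A linear subspace that contains `H` and all root spaces is everything. -/
lemma eq_top_of_le {S : Submodule ℂ L} (h0 : ∀ z : H, (z : L) ∈ S)
    (h1 : ∀ (α : H.root) (x : L), x ∈ rsp α → x ∈ S) : S = ⊤ := by
  have h := iSup_genWeightSpace_eq_top' ℂ H L
  rw [eq_top_iff]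
  rw [← LieSubmodule.toSubmodule_inj, LieSubmodule.iSup_toSubmodule,
    LieSubmodule.top_toSubmodule] at h
  rw [← h, iSup_le_iff]
  intro χ x hx
  by_cases hχ : χ.IsZero
  · have hx' : x ∈ rootSpace H (0 : H → ℂ) := by
      have : (χ : H → ℂ) = 0 := hχ
      rw [← this]; exact hx
    rw [rootSpace_zero_eq ℂ L H, LieSubalgebra.mem_toLieSubmodule] at hx'
    exact h0 ⟨x, hx'⟩
  · exact h1 ⟨χ, by simpa using hχ⟩ x hx

end RootSpaces

/-! ### Root vectors -/

section RootVectors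

namespace RootVectors

variable (E : RootVectors H)

lemma lie_e_neg (α : H.root) : ⁅E.e α, E.e (negRoot α)⁆ = (rootH α : L) := E.lie_e α _ rfl

lemma rootH_ne_zero (α : H.root) : rootH α ≠ 0 := by
  intro h
  exact len_ne_zero α (by rw [len, h, map_zero])

lemma killingForm_e_neg (α : H.root) : killingForm ℂ L (E.e α) (E.e (negRoot α)) = 1 := by
  have h := lie_eq_killingForm_smul (E.e_mem α) (E.e_mem (negRoot α))
  rw [E.lie_e_neg] at h
  have h2 : (1 - killingForm ℂ L (E.e α) (E.e (negRoot α))) • (rootH α : L) = 0 := by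
    rw [sub_smul, one_smul, ← h, sub_self]
  rcases smul_eq_zero.mp h2 with h3 | h3
  · exact (sub_eq_zero.mp h3).symm
  · exact absurd (Subtype.ext h3) (rootH_ne_zero α)

lemma e_ne_zero (α : H.root) : E.e α ≠ 0 := by
  intro h
  have := E.killingForm_e_neg α
  rw [h] at this; simp at this

lemma eq_smul {α : H.root} {x : L} (hx : x ∈ rsp α) :
    x = killingForm ℂ L x (E.e (negRoot α)) • E.e α := by
  obtain ⟨c, rfl⟩ := exists_eq_smul (E.e_mem α) (E.e_ne_zero α) hx
  rw [map_smul, LinearMap.smul_apply, E.killingForm_e_neg, smul_eq_mul, mul_one]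

/-- Expansion of an element in root vectors. -/
lemma eq_sum (x : L) : x = ∑ α : H.root, killingForm ℂ L x (rootH α) • (rootH α : L) +
    ∑ α : H.root, killingForm ℂ L x (E.e (negRoot α)) • E.e α := by
  -- The t_α are overcomplete in `H`, but by `eq_sum_rootH` the first sum is still the projection to
  -- `H`. Both sides are linear, so `H` and the root spaces can be checked separately.
  let T : L →ₗ[ℂ] L := ∑ α : H.root, ((killingForm ℂ L).flip (rootH α : L)).smulRight (rootH α : L) +
    ∑ α : H.root, ((killingForm ℂ L).flip (E.e (negRoot α))).smulRight (E.e α)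
  have hT : ∀ y, T y = ∑ α : H.root, killingForm ℂ L y (rootH α) • (rootH α : L) +
    ∑ α : H.root, killingForm ℂ L y (E.e (negRoot α)) • E.e α := by
    intro y; simp [T, LinearMap.sum_apply]
  have key : LinearMap.eqLocus LinearMap.id T = ⊤ := by
    apply eq_top_of_le (H := H)
    · intro z
      rw [LinearMap.mem_eqLocus, hT, LinearMap.id_apply]
      have h2 : ∀ α : H.root, killingForm ℂ L (z : L) (E.e (negRoot α)) = 0 := fun α =>
        killingForm_coe_rsp z (E.e_mem _)
      have h1 : ∀ α : H.root, killingForm ℂ L (z : L) (rootH α) = (rootSystem H).root α z :=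
        fun α => by rw [killingForm_comm, killingForm_rootH]
      simp only [h1, h2, zero_smul, Finset.sum_const_zero, add_zero]
      conv_lhs => rw [eq_sum_rootH z]
      simp
    · intro β x hx
      rw [LinearMap.mem_eqLocus, hT, LinearMap.id_apply]
      have h1 : ∀ α : H.root, killingForm ℂ L x (rootH α) = 0 := fun α => by
        rw [killingForm_comm]; exact killingForm_coe_rsp _ hx
      have h2 : ∀ α : H.root, α ≠ β → killingForm ℂ L x (E.e (negRoot α)) = 0 := fun α hα =>
        killingForm_rsp_eq_zero (fun h => hα (by
          rw [← negRoot_negRoot α, h, negRoot_negRoot])) hx (E.e_mem _)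
      simp only [h1, zero_smul, Finset.sum_const_zero, zero_add]
      rw [Finset.sum_eq_single β (fun α _ hα => by rw [h2 α hα, zero_smul]) (by simp)]
      exact E.eq_smul hx
  have : x ∈ LinearMap.eqLocus LinearMap.id T := by rw [key]; trivial
  rw [LinearMap.mem_eqLocus, hT] at this
  exact this

end RootVectors

end RootVectors

/-! ### Brackets of root vectors -/

section Brackets

/-- `ad y ∘ ad x` acts on the root space of `β` as a positive scalar, if `α + β` is a root and
`x`, `y` are dual root vectors for `α`, `-α`. -/
lemma exists_lie_lie_eq_smul {α β γ : H.root}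
    (h : (rootSystem H).root γ = (rootSystem H).root α + (rootSystem H).root β) {x y : L}
    (hx : x ∈ rsp α) (hy : y ∈ rsp (negRoot α)) (hxy : killingForm ℂ L x y = 1) :
    ∃ c : ℝ, 0 < c ∧ ∀ v ∈ rsp β, ⁅y, ⁅x, v⁆⁆ = (c : ℂ) • v := by
  have hα := H.isNonZero_coe_root α
  obtain ⟨t, e, f, isSl2, he, hf⟩ := exists_isSl2Triple_of_weight_isNonZero (K := ℂ) hα
  obtain rfl := isSl2.h_eq_coroot hα he hf
  have hx0 : x ≠ 0 := by rintro rfl; simp at hxy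
  have hy0 : y ≠ 0 := by rintro rfl; simp at hxy
  obtain ⟨a, rfl⟩ := exists_eq_smul hx hx0 he
  have hf' : f ∈ rsp (negRoot α) := hf
  obtain ⟨b, rfl⟩ := exists_eq_smul hy hy0 hf'
  obtain ⟨r, hr, hlen⟩ := exists_len_eq α
  -- The bracket of `x` and `y` is t_α, whereas the triple is normalized to the coroot, which is (2
  -- / r) t_α.
  have hab : a * b * r = 2 := by
    have h1 := isSl2.lie_e_f
    rw [lie_eq_killingForm_smul he hf'] at h1
    simp only [map_smul, LinearMap.smul_apply, hxy, smul_eq_mul, mul_one] at h1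
    have h2 : ((coroot (α : Weight ℂ H L) : H) : L) = (2 / len α) • (rootH α : L) := by
      have := coroot_eq α
      rw [rootSystem_coroot_apply] at this
      rw [this]; rfl
    rw [h2, ← sub_eq_zero, ← sub_smul] at h1
    rcases smul_eq_zero.mp h1 with h3 | h3
    · have : (r : ℂ) ≠ 0 := by exact_mod_cast hr.ne'
      rw [hlen] at h3
      field_simp at h3
      linear_combination h3
    · exact absurd (Subtype.ext h3 : rootH α = 0) fun h0 => len_ne_zero α (by rw [len, h0, map_zero])
  obtain ⟨m, hm, m_ne0⟩ := (chainTop (α : Weight ℂ H L) (β : Weight ℂ H L)).exists_ne_zero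
  have prim : isSl2.HasPrimitiveVectorWith m (chainLength (α : Weight ℂ H L) β : ℂ) :=
    have := lie_mem_genWeightSpace_of_mem_genWeightSpace he hm
    ⟨m_ne0, (chainLength_smul _ _ hm).symm, by rwa [genWeightSpace_add_chainTop _ _ hα] at this⟩
  set q := chainTopCoeff (α : Weight ℂ H L) (β : Weight ℂ H L) with hq
  have hql : q ≤ chainLength (α : Weight ℂ H L) β := chainTopCoeff_le_chainLength _ _
  -- As α + β is a root, β is not the top of its α-string.
  have hq1 : 1 ≤ q := by
    by_contra hlt
    have h0 : q = 0 := by omega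
    have := genWeightSpace_chainTopCoeff_add_one_nsmul_add (α : Weight ℂ H L) (β : Weight ℂ H L) hα
    rw [← hq, h0, zero_add, one_smul] at this
    obtain ⟨w, hw, hw0⟩ := exists_mem_rsp_ne_zero γ
    refine hw0 ?_
    have h3 : ((γ : Weight ℂ H L) : H → ℂ) = (α : Weight ℂ H L) + (β : Weight ℂ H L) := by
      funext z; exact congrArg (fun f => f z) h
    rw [rsp, rootSpace, h3, this] at hw
    simpa using hw
  obtain ⟨n, hn⟩ : ∃ n, q = n + 1 := ⟨q - 1, by omega⟩
  have hv0 := prim.pow_toEnd_f_ne_zero_of_eq_nat rfl hql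
  have hvm : ((toEnd ℂ L L) (b • y) ^ q) m ∈ rsp β := by
    have h4 := toEnd_pow_apply_mem hf hm q
    rw [coe_chainTop] at h4
    have hF : q • (-((α : Weight ℂ H L) : H → ℂ)) +
        ((chainTopCoeff (α : Weight ℂ H L) (β : Weight ℂ H L) : ℤ) •
          ((α : Weight ℂ H L) : H → ℂ) + (β : Weight ℂ H L)) = (β : Weight ℂ H L) := by
      rw [← hq, natCast_zsmul, smul_neg, neg_add_cancel_left]
    rw [hF] at h4
    exact h4
  set l := chainLength (α : Weight ℂ H L) (β : Weight ℂ H L) with hl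
  -- For a primitive vector m of weight l one has e f^(n+1) m = (n+1)(l-n) f^n m; the root space of
  -- β is spanned by f^q m with q = n + 1. The factor r / 2 undoes the rescaling by a and b, and q ≤
  -- l gives positivity.
  refine ⟨(q * (l - n)) * (r / 2), ?_, fun v hv => ?_⟩
  · have : (n : ℝ) + 1 ≤ l := by exact_mod_cast hn ▸ hql
    have h5 : (1 : ℝ) ≤ q := by exact_mod_cast hq1
    have h6 : (0 : ℝ) < l - n := by linarith
    positivity
  · obtain ⟨k, rfl⟩ := exists_eq_smul hvm hv0 hv
    have h6 := prim.lie_e_pow_succ_toEnd_f n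
    have h7 : ⁅b • y, ⁅a • x, ((toEnd ℂ L L) (b • y) ^ (n + 1)) m⁆⁆ =
        (((n : ℂ) + 1) * (l - n)) • ((toEnd ℂ L L) (b • y) ^ (n + 1)) m := by
      rw [h6, lie_smul, pow_succ', Module.End.mul_apply, toEnd_apply_apply]
    rw [← hn] at h7
    simp only [smul_lie, lie_smul, smul_smul] at h7 ⊢
    have h8 : (a * b) ≠ 0 := by
      rintro h0; rw [h0] at hab; simp at hab
    have h9 : ⁅y, ⁅x, ((toEnd ℂ L L) (b • y) ^ q) m⁆⁆ =
        (r / 2 * (((n : ℂ) + 1) * (l - n))) • ((toEnd ℂ L L) (b • y) ^ q) m := by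
      rw [mul_smul, ← h7, smul_smul, show (r / 2 : ℂ) * (a * b) = 1 by linear_combination hab / 2,
        one_smul]
    rw [h9, smul_smul, hn]
    congr 1
    push_cast
    ring

lemma exists_killingForm_eq_one {α : H.root} {x : L} (hx : x ∈ rsp α) (hx0 : x ≠ 0) :
    ∃ y ∈ rsp (negRoot α), killingForm ℂ L x y = 1 := by
  obtain ⟨y, hy, hxy⟩ : ∃ y ∈ rsp (negRoot α), killingForm ℂ L x y ≠ 0 := by
    by_contra! hall
    refine hx0 ?_
    rw [← Submodule.mem_bot ℂ, ← ker_killingForm_eq_bot ℂ L, LinearMap.mem_ker,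
      ← LinearMap.ker_eq_top]
    apply eq_top_of_le (H := H)
    · intro z
      rw [LinearMap.mem_ker, killingForm_comm]
      exact killingForm_coe_rsp z hx
    · intro β y hy
      by_cases h : β = negRoot α
      · subst h; exact hall y hy
      · exact killingForm_rsp_eq_zero h hx hy
  exact ⟨(killingForm ℂ L x y)⁻¹ • y, Submodule.smul_mem _ _ hy, by
    rw [map_smul, smul_eq_mul, inv_mul_cancel₀ hxy]⟩

/-- Bracketing with a dual vector of `x` brings back a nonzero multiple of `v`. -/
lemma lie_ne_zero_of_add {α β γ : H.root}
    (h : (rootSystem H).root γ = (rootSystem H).root α + (rootSystem H).root β) {x v : L}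
    (hx : x ∈ rsp α) (hx0 : x ≠ 0) (hv : v ∈ rsp β) (hv0 : v ≠ 0) : ⁅x, v⁆ ≠ 0 := by
  intro h0
  obtain ⟨y, hy, hxy⟩ := exists_killingForm_eq_one hx hx0
  obtain ⟨c, hc, hcv⟩ := exists_lie_lie_eq_smul h hx hy hxy
  have := hcv v hv
  rw [h0, lie_zero] at this
  rcases smul_eq_zero.mp this.symm with h3 | h3
  · exact hc.ne' (by exact_mod_cast h3)
  · exact hv0 h3

end Brackets

/-! ### The Chevalley involution -/

section Chevalley

variable (H) in
lemma reflectionPerm_self_eq (α : H.root) : (rootSystem H).reflectionPerm α α = negRoot α := by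
  apply root_injective
  rw [root_negRoot, RootPairing.root_reflectionPerm, RootPairing.reflection_apply_self]

/-- A choice of `sl₂`-triples for the simple roots. -/
lemma exists_sl2_triple (α : H.root) : ∃ e f : L, e ∈ rsp α ∧ f ∈ rsp (negRoot α) ∧
    IsSl2Triple (((rootSystem H).coroot α : H) : L) e f := by
  have hα := H.isNonZero_coe_root α
  obtain ⟨t, e, f, isSl2, he, hf⟩ := exists_isSl2Triple_of_weight_isNonZero (K := ℂ) hα
  obtain rfl := isSl2.h_eq_coroot hα he hf
  exact ⟨e, f, he, hf, isSl2⟩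

/-- A nonzero root vector for `α`. -/
def slE (α : H.root) : L := (exists_sl2_triple α).choose

/-- The root vector for `-α` that forms an `sl₂`-triple with `slE α`. -/
def slF (α : H.root) : L := (exists_sl2_triple α).choose_spec.choose

lemma slE_mem (α : H.root) : slE α ∈ rsp α := (exists_sl2_triple α).choose_spec.choose_spec.1

lemma slF_mem (α : H.root) : slF α ∈ rsp (negRoot α) :=
  (exists_sl2_triple α).choose_spec.choose_spec.2.1

lemma isSl2Triple_slE_slF (α : H.root) :
    IsSl2Triple (((rootSystem H).coroot α : H) : L) (slE α) (slF α) :=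
  (exists_sl2_triple α).choose_spec.choose_spec.2.2

/-- A base of the root system gives a basis of the Lie algebra in the sense of Chevalley. -/
def chevalleyBasis (b : (rootSystem H).Base) : LieAlgebra.Basis b.support H where
  A := b.cartanMatrix
  h i := (((rootSystem H).coroot (i : H.root) : H) : L)
  e i := slE (i : H.root)
  f i := slF (i : H.root)
  cartan_eq_lieSpan := by
    apply le_antisymm
    · intro z hz
      have h1 : Submodule.span ℂ ((rootSystem H).coroot '' b.support) = ⊤ := by
        rw [b.span_coroot_support]; exact RootPairing.IsRootSystem.span_coroot_eq_top
      have h2 : (⟨z, hz⟩ : H) ∈ Submodule.span ℂ ((rootSystem H).coroot '' b.support) := by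
        rw [h1]; trivial
      have h3 : Submodule.span ℂ ((rootSystem H).coroot '' b.support) ≤
          (LieSubalgebra.lieSpan ℂ L (Set.range fun i : b.support =>
            (((rootSystem H).coroot (i : H.root) : H) : L))).toSubmodule.comap
              H.toSubmodule.subtype := by
        rw [Submodule.span_le]
        rintro - ⟨i, hi, rfl⟩
        exact LieSubalgebra.subset_lieSpan ⟨⟨i, hi⟩, rfl⟩
      exact h3 h2
    · rw [LieSubalgebra.lieSpan_le]
      rintro - ⟨i, rfl⟩
      exact ((rootSystem H).coroot (i : H.root)).2
  span_ef := by
    set S := LieSubalgebra.lieSpan ℂ L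
      (Set.range (fun i : b.support => slE (i : H.root)) ∪
        Set.range (fun i : b.support => slF (i : H.root))) with hS
    have he : ∀ i : b.support, slE (i : H.root) ∈ S := fun i =>
      LieSubalgebra.subset_lieSpan (Or.inl ⟨i, rfl⟩)
    have hf : ∀ i : b.support, slF (i : H.root) ∈ S := fun i =>
      LieSubalgebra.subset_lieSpan (Or.inr ⟨i, rfl⟩)
    have one : ∀ {α : H.root} {x : L}, x ∈ rsp α → x ≠ 0 → x ∈ S → ∀ y ∈ rsp α, y ∈ S := by
      intro α x hx hx0 hxS y hy
      obtain ⟨c, rfl⟩ := exists_eq_smul hx hx0 hy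
      exact S.smul_mem _ hxS
    have key : ∀ α : H.root, (∀ x ∈ rsp α, x ∈ S) ∧ (∀ x ∈ rsp (negRoot α), x ∈ S) := by
      intro α
      -- Every root arises from simple roots by negation and by adding simple roots. Carrying a root
      -- and its negative together makes negation a mere swap.
      refine b.induction_add α (p := fun α => (∀ x ∈ rsp α, x ∈ S) ∧
        (∀ x ∈ rsp (negRoot α), x ∈ S)) ?_ ?_ ?_
      · rintro i ⟨h1, h2⟩
        rw [reflectionPerm_self_eq, negRoot_negRoot]
        exact ⟨h2, h1⟩
      · intro i hi
        have h3 := isSl2Triple_slE_slF i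
        exact ⟨one (slE_mem i) h3.e_ne_zero (he ⟨i, hi⟩), one (slF_mem i) h3.f_ne_zero (hf ⟨i, hi⟩)⟩
      · rintro i j k hk ⟨h1, h2⟩ hj
        have g1 := slE_mem j
        have g2 := slF_mem j
        have g3 := isSl2Triple_slE_slF j
        constructor
        · obtain ⟨x, hx, hx0⟩ := exists_mem_rsp_ne_zero i
          exact one (lie_mem_rsp hk hx g1) (lie_ne_zero_of_add hk hx hx0 g1 g3.e_ne_zero)
            (S.lie_mem (h1 x hx) (he ⟨j, hj⟩))
        · have hk' : (rootSystem H).root (negRoot k) =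
              (rootSystem H).root (negRoot i) + (rootSystem H).root (negRoot j) := by
            rw [root_negRoot, root_negRoot, root_negRoot, hk, neg_add]
          obtain ⟨x, hx, hx0⟩ := exists_mem_rsp_ne_zero (negRoot i)
          exact one (lie_mem_rsp hk' hx g2) (lie_ne_zero_of_add hk' hx hx0 g2 g3.f_ne_zero)
            (S.lie_mem (h2 x hx) (hf ⟨j, hj⟩))
    rw [← LieSubalgebra.toSubmodule_inj]
    apply eq_top_of_le (H := H)
    · intro z
      rw [eq_sum_rootH z]
      have : ∀ α : H.root, (rootH α : L) ∈ S := by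
        intro α
        obtain ⟨x, hx, hx0⟩ := exists_mem_rsp_ne_zero α
        obtain ⟨y, hy, hxy⟩ := exists_killingForm_eq_one hx hx0
        rw [← one_smul ℂ (rootH α : L), ← hxy, ← lie_eq_killingForm_smul hx hy]
        exact S.lie_mem ((key α).1 x hx) ((key α).2 y hy)
      have h2 : ((∑ α : H.root, (rootSystem H).root α z • rootH α : H) : L) =
          ∑ α : H.root, (rootSystem H).root α z • (rootH α : L) := by simp
      rw [h2]
      exact Submodule.sum_mem _ fun α _ => S.smul_mem _ (this α)
    · intro α x hx
      exact (key α).1 x hx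
  linInd := by
    have := b.linearIndepOn_coroot
    exact LinearIndependent.map' this H.toSubmodule.subtype
      (LinearMap.ker_eq_bot.mpr Subtype.val_injective)
  nondegen := b.cartanMatrix_nondegenerate
  sl2 i := isSl2Triple_slE_slF (i : H.root)
  lie_h_h i j := by
    have : ⁅(rootSystem H).coroot (i : H.root), (rootSystem H).coroot (j : H.root)⁆ = 0 :=
      trivial_lie_zero _ _ _ _
    exact congrArg Subtype.val this
  lie_h_e i j := by
    rw [lie_coe_rsp (slE_mem (i : H.root)),
      ← Int.cast_smul_eq_zsmul ℂ]
    congr 1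
    exact ((rootSystem H).algebraMap_pairingIn ℤ (i : H.root) j).symm
  lie_h_f i j := by
    rw [lie_coe_rsp (slF_mem (i : H.root)),
      ← Int.cast_smul_eq_zsmul ℂ, root_negRoot]
    congr 1
    push_cast
    exact congrArg (fun x => -x) ((rootSystem H).algebraMap_pairingIn ℤ (i : H.root) j).symm
  lie_e_f_ne i j hij := by
    have h1 := b.sub_notMem_range_root i.2 j.2
    refine lie_eq_zero_of_add_notMem ?_ ?_ (slE_mem (i : H.root)) (slF_mem (j : H.root))
    · rwa [root_negRoot, ← sub_eq_add_neg]
    · rw [root_negRoot, ← sub_eq_add_neg, sub_ne_zero]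
      intro h
      exact hij (Subtype.ext (root_injective h))

end Chevalley

end Killing

section Simple

variable {L : Type*} [LieRing L] [LieAlgebra ℂ L] [FiniteDimensional ℂ L] [IsSimple ℂ L]
  {H : LieSubalgebra ℂ L} [H.IsCartanSubalgebra]

section ChevalleyInvolution

/-- The isomorphism attached to two bases goes through the subalgebra of `L × L` generated by pairs
of corresponding generators, which is its graph. Its value on a generator is read off from such a
pair. -/
lemma symm_trans_apply_of_mem {S : LieSubalgebra ℂ (L × L)} (φ ψ : S ≃ₗ⁅ℂ⁆ L) {x y : L}
    (hm : (x, y) ∈ S) (h1 : φ ⟨(x, y), hm⟩ = x) (h2 : ψ ⟨(x, y), hm⟩ = y) :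
    (φ.symm.trans ψ) x = y := by
  rw [LieEquiv.trans_apply, (LieEquiv.symm_apply_eq φ).mpr h1.symm, h2]

lemma equivOfReindex_e {ι : Type*} [Finite ι] (b₁ b₂ : LieAlgebra.Basis ι H)
    (hA : b₁.A.reindex (Equiv.refl ι) (Equiv.refl ι) = b₂.A) (i : ι) :
    LieAlgebra.Basis.equivOfReindex (Equiv.refl ι) b₁ b₂ hA (b₁.e i) = b₂.e i := by
  unfold LieAlgebra.Basis.equivOfReindex
  exact symm_trans_apply_of_mem _ _ (LieSubalgebra.subset_lieSpan (Or.inl (Or.inr ⟨i, rfl⟩)))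
    rfl rfl

lemma equivOfReindex_f {ι : Type*} [Finite ι] (b₁ b₂ : LieAlgebra.Basis ι H)
    (hA : b₁.A.reindex (Equiv.refl ι) (Equiv.refl ι) = b₂.A) (i : ι) :
    LieAlgebra.Basis.equivOfReindex (Equiv.refl ι) b₁ b₂ hA (b₁.f i) = b₂.f i := by
  unfold LieAlgebra.Basis.equivOfReindex
  exact symm_trans_apply_of_mem _ _ (LieSubalgebra.subset_lieSpan (Or.inr ⟨i, rfl⟩)) rfl rfl

lemma lieEquiv_ext_of_span {ι : Type*} [Finite ι] (b : LieAlgebra.Basis ι H) (f g : L ≃ₗ⁅ℂ⁆ L)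
    (he : ∀ i, f (b.e i) = g (b.e i)) (hf : ∀ i, f (b.f i) = g (b.f i)) (x : L) : f x = g x := by
  have hx : x ∈ LieSubalgebra.lieSpan ℂ L (Set.range b.e ∪ Set.range b.f) := by
    rw [b.span_ef]; trivial
  induction hx using LieSubalgebra.lieSpan_induction with
  | mem x h => rcases h with ⟨i, rfl⟩ | ⟨i, rfl⟩; exacts [he i, hf i]
  | zero => rw [map_zero, map_zero]
  | add x y _ _ hx hy => rw [map_add, map_add, hx, hy]
  | smul a x _ hx => rw [map_smul, map_smul, hx]
  | lie x y _ _ hx hy => rw [LieEquiv.map_lie, LieEquiv.map_lie, hx, hy]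

variable (H) in
/-- The Chevalley involution: an involutive automorphism that is `-1` on the Cartan subalgebra. -/
lemma exists_chevalleyInvolution :
    ∃ ω : L ≃ₗ⁅ℂ⁆ L, (∀ z : H, ω (z : L) = -(z : L)) ∧ ∀ x, ω (ω x) = x := by
  obtain ⟨b⟩ := RootPairing.nonempty_base (rootSystem H)
  let B := chevalleyBasis b
  -- `B.symm` exchanges the e's and the f's and has the same Cartan matrix, so the isomorphism
  -- theorem yields ω.
  have hA : B.A.reindex (Equiv.refl _) (Equiv.refl _) = B.symm.A := by simp
  let ω := LieAlgebra.Basis.equivOfReindex (Equiv.refl _) B B.symm hA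
  have he : ∀ i, ω (B.e i) = B.f i := equivOfReindex_e B B.symm hA
  have hf : ∀ i, ω (B.f i) = B.e i := equivOfReindex_f B B.symm hA
  refine ⟨ω, fun z => ?_, fun x => ?_⟩
  · obtain ⟨z, hz⟩ := z
    change ω z = -z
    rw [← LieSubalgebra.mem_toSubmodule, B.coe_cartan_eq_span] at hz
    induction hz using Submodule.span_induction with
    | mem x h =>
      obtain ⟨i, rfl⟩ := h
      rw [← (B.sl2 i).lie_e_f, LieEquiv.map_lie, he, hf, lie_skew]
    | zero => simp
    | add x y _ _ hx hy => rw [map_add, hx, hy, neg_add]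
    | smul a x _ hx => rw [map_smul, hx, smul_neg]
  · have := lieEquiv_ext_of_span B (ω.trans ω) LieEquiv.refl
      (fun i => by rw [LieEquiv.trans_apply, he, hf]; rfl)
      (fun i => by rw [LieEquiv.trans_apply, hf, he]; rfl) x
    rwa [LieEquiv.trans_apply] at this

end ChevalleyInvolution

/-! ### Root vectors adapted to the Chevalley involution -/

section AdaptedRootVectors

lemma mem_rsp_of_lie {α : H.root} {x : L}
    (h : ∀ z : H, ⁅(z : L), x⁆ = (rootSystem H).root α z • x) : x ∈ rsp α := by
  refine (mem_genWeightSpace _ _ _).mpr fun z => ⟨1, ?_⟩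
  have h1 : ⁅z, x⁆ = (rootSystem H).root α z • x := h z
  rw [pow_one, LinearMap.sub_apply, toEnd_apply_apply, h1]
  simp

/-- The structure constants of a choice of root vectors: `⁅e α, e β⁆ = N α β • e (α + β)`. -/
def RootVectors.structConst (E : RootVectors H) (α β : H.root) : ℂ :=
  letI := Classical.propDecidable
  if h : ∃ γ : H.root, (rootSystem H).root γ = (rootSystem H).root α + (rootSystem H).root β then
    killingForm ℂ L ⁅E.e α, E.e β⁆ (E.e (negRoot h.choose)) else 0

lemma RootVectors.lie_e_e (E : RootVectors H) {α β γ : H.root}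
    (h : (rootSystem H).root γ = (rootSystem H).root α + (rootSystem H).root β) :
    ⁅E.e α, E.e β⁆ = E.structConst α β • E.e γ := by
  have hex : ∃ γ : H.root,
      (rootSystem H).root γ = (rootSystem H).root α + (rootSystem H).root β := ⟨γ, h⟩
  have hc : hex.choose = γ := root_injective (hex.choose_spec.trans h.symm)
  rw [RootVectors.structConst, dif_pos hex, hc]
  exact E.eq_smul (lie_mem_rsp h (E.e_mem α) (E.e_mem β))

/-- The Chevalley involution `ω` exchanges `e α` and `-e (-α)`. -/
def RootVectors.IsAdapted (E : RootVectors H) (ω : L ≃ₗ⁅ℂ⁆ L) : Prop :=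
  (∀ z : H, ω (z : L) = -(z : L)) ∧ ∀ α, ω (E.e α) = -E.e (negRoot α)

lemma map_mem_rsp_negRoot {ω : L ≃ₗ⁅ℂ⁆ L} (h : ∀ z : H, ω (z : L) = -(z : L)) {α : H.root} {x : L}
    (hx : x ∈ rsp α) : ω x ∈ rsp (negRoot α) := by
  apply mem_rsp_of_lie
  intro z
  have h1 : (z : L) = ω (-z : L) := by rw [map_neg, h, neg_neg]
  rw [h1, ← LieEquiv.map_lie, neg_lie, lie_coe_rsp hx, root_negRoot, ← neg_smul, map_smul]
  rfl

lemma neg_lie_mem {α : H.root} {x : L} (hx : x ∈ rsp α) : -x ∈ rsp α := Submodule.neg_mem _ hx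

variable (H) in
/-- There are root vectors that are adapted to the Chevalley involution. -/
lemma exists_isAdapted : ∃ (E : RootVectors H) (ω : L ≃ₗ⁅ℂ⁆ L), E.IsAdapted ω := by
  classical
  obtain ⟨ω, h1, h2⟩ := exists_chevalleyInvolution H
  obtain ⟨b⟩ := RootPairing.nonempty_base (rootSystem H)
  have key : ∀ α : H.root, ∃ x ∈ rsp α, killingForm ℂ L x (-ω x) = 1 := by
    intro α
    obtain ⟨x, hx, hx0⟩ := exists_mem_rsp_ne_zero α
    obtain ⟨y, hy, hxy⟩ := exists_killingForm_eq_one hx hx0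
    have hω0 : ω x ≠ 0 := by
      intro h; rw [← h2 x, h, map_zero] at hx0; exact hx0 rfl
    obtain ⟨c, rfl⟩ := exists_eq_smul (map_mem_rsp_negRoot h1 hx) hω0 hy
    rw [map_smul, smul_eq_mul] at hxy
    -- Replacing `x` by `s • x` multiplies the pairing of `x` with `-ω x` by s². As `c • ω x` is
    -- dual to `x`, the value needed is s² = -c.
    obtain ⟨s, hs⟩ := IsAlgClosed.exists_pow_nat_eq (-c) (n := 2) (by norm_num)
    refine ⟨s • x, Submodule.smul_mem _ _ hx, ?_⟩
    rw [map_smul ω, map_smul, LinearMap.smul_apply, map_neg, map_smul, smul_eq_mul, smul_eq_mul]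
    linear_combination hxy - killingForm ℂ L x (ω x) * hs
  choose x hx hx1 using key
  have hpos : ∀ α, b.IsPos (negRoot α) ↔ ¬ b.IsPos α := fun α => by
    have := RootPairing.Base.IsPos.neg_iff_not b α
    rw [← reflectionPerm_self_eq]
    exact this
  -- The choice is free on positive roots; on negative ones it is then forced by the requirement
  -- that ω send e α to -e (-α).
  let e : H.root → L := fun α => if b.IsPos α then x α else -ω (x (negRoot α))
  have he1 : ∀ α, b.IsPos α → e α = x α := fun α h => if_pos h
  have he2 : ∀ α, ¬ b.IsPos α → e α = -ω (x (negRoot α)) := fun α h => if_neg h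
  have hem : ∀ α, e α ∈ rsp α := by
    intro α
    by_cases h : b.IsPos α
    · rw [he1 α h]; exact hx α
    · rw [he2 α h]
      have := map_mem_rsp_negRoot h1 (hx (negRoot α))
      rw [negRoot_negRoot] at this
      exact neg_lie_mem this
  have hω : ∀ α, ω (e α) = -e (negRoot α) := by
    intro α
    by_cases h : b.IsPos α
    · rw [he1 α h, he2 (negRoot α) (by rw [hpos]; simpa using h), negRoot_negRoot, neg_neg]
    · rw [he2 α h, he1 (negRoot α) ((hpos α).mpr h), map_neg, h2]
  refine ⟨⟨e, hem, fun α β hβ => ?_⟩, ω, h1, hω⟩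
  rw [coe_eq_neg_iff] at hβ
  subst hβ
  rw [lie_eq_killingForm_smul (hem α) (hem (negRoot α))]
  have : killingForm ℂ L (e α) (e (negRoot α)) = 1 := by
    by_cases h : b.IsPos α
    · rw [he1 α h, he2 (negRoot α) (by rw [hpos]; simpa using h), negRoot_negRoot, hx1]
    · rw [he2 α h, he1 (negRoot α) ((hpos α).mpr h), killingForm_comm, hx1]
  rw [this, one_smul]
  rfl

end AdaptedRootVectors

/-! ### Structure constants -/

section StructConst

namespace RootVectors

variable (E : RootVectors H)

lemma root_neg_add {α β γ : H.root}
    (h : (rootSystem H).root γ = (rootSystem H).root α + (rootSystem H).root β) :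
    (rootSystem H).root (negRoot γ) =
      (rootSystem H).root (negRoot α) + (rootSystem H).root (negRoot β) := by
  rw [root_negRoot, root_negRoot, root_negRoot, h, neg_add]

lemma structConst_eq {α β γ : H.root}
    (h : (rootSystem H).root γ = (rootSystem H).root α + (rootSystem H).root β) :
    E.structConst α β = killingForm ℂ L ⁅E.e α, E.e β⁆ (E.e (negRoot γ)) := by
  rw [E.lie_e_e h, map_smul, LinearMap.smul_apply, E.killingForm_e_neg, smul_eq_mul, mul_one]

lemma structConst_ne_zero {α β γ : H.root}
    (h : (rootSystem H).root γ = (rootSystem H).root α + (rootSystem H).root β) :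
    E.structConst α β ≠ 0 := by
  intro h0
  refine lie_ne_zero_of_add h (E.e_mem α) (E.e_ne_zero α) (E.e_mem β) (E.e_ne_zero β) ?_
  rw [E.lie_e_e h, h0, zero_smul]

lemma structConst_swap {α β γ : H.root}
    (h : (rootSystem H).root γ = (rootSystem H).root α + (rootSystem H).root β) :
    E.structConst β α = -E.structConst α β := by
  rw [E.structConst_eq h, E.structConst_eq (h.trans (add_comm _ _)), ← lie_skew, map_neg,
    LinearMap.neg_apply]

/-- Cyclic invariance of the structure constants. -/
lemma structConst_cyclic {α β γ : H.root}
    (h : (rootSystem H).root α + (rootSystem H).root β + (rootSystem H).root γ = 0) :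
    E.structConst β γ = E.structConst α β := by
  have h1 : (rootSystem H).root (negRoot γ) =
      (rootSystem H).root α + (rootSystem H).root β := by
    rw [root_negRoot, neg_eq_iff_add_eq_zero]
    rw [← h]; abel
  have h2 : (rootSystem H).root (negRoot α) =
      (rootSystem H).root β + (rootSystem H).root γ := by
    rw [root_negRoot, neg_eq_iff_add_eq_zero]
    rw [← h]; abel
  rw [E.structConst_eq h1, E.structConst_eq h2, negRoot_negRoot, negRoot_negRoot,
    killingForm_lie (E.e α), killingForm_comm (E.e α)]

/-- The scalar by which `ad (e (-α)) ∘ ad (e α)` acts on the root space of `β`. -/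
lemma lie_lie_e {α β γ : H.root}
    (h : (rootSystem H).root γ = (rootSystem H).root α + (rootSystem H).root β) :
    ⁅E.e (negRoot α), ⁅E.e α, E.e β⁆⁆ =
      (-(E.structConst α β * E.structConst (negRoot α) (negRoot β))) • E.e β := by
  have h1 : (rootSystem H).root β =
      (rootSystem H).root (negRoot α) + (rootSystem H).root γ := by
    rw [root_negRoot, h, neg_add_cancel_left]
  have h2 : (rootSystem H).root (negRoot β) + (rootSystem H).root (negRoot α) +
      (rootSystem H).root γ = 0 := by
    rw [root_negRoot, root_negRoot, h]; abel
  rw [E.lie_e_e h, lie_smul, E.lie_e_e h1, smul_smul, E.structConst_cyclic h2,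
    E.structConst_swap (root_neg_add h), mul_neg]

/-- Two computations of ad e_{-α} ad e_α on e_β are compared: by `sl₂` theory it is a positive
scalar, and in structure constants it is -N(α,β) N(-α,-β). -/
lemma exists_structConst_mul_neg {α β γ : H.root}
    (h : (rootSystem H).root γ = (rootSystem H).root α + (rootSystem H).root β) :
    ∃ c : ℝ, 0 < c ∧ E.structConst α β * E.structConst (negRoot α) (negRoot β) = -(c : ℂ) := by
  obtain ⟨c, hc, h1⟩ := exists_lie_lie_eq_smul h (E.e_mem α) (E.e_mem (negRoot α))
    (E.killingForm_e_neg α)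
  have h2 := h1 _ (E.e_mem β)
  rw [E.lie_lie_e h] at h2
  refine ⟨c, hc, ?_⟩
  have := smul_left_injective ℂ (E.e_ne_zero β) h2
  linear_combination -this

variable {E}

/-- The structure constants satisfy `N (-α) (-β) = -conj (N α β)`. -/
def IsUnitary (E : RootVectors H) : Prop :=
  ∀ α β γ : H.root, (rootSystem H).root γ = (rootSystem H).root α + (rootSystem H).root β →
    E.structConst (negRoot α) (negRoot β) = -(starRingEnd ℂ) (E.structConst α β)

lemma IsAdapted.structConst_neg {ω : L ≃ₗ⁅ℂ⁆ L} (hE : E.IsAdapted ω) {α β γ : H.root}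
    (h : (rootSystem H).root γ = (rootSystem H).root α + (rootSystem H).root β) :
    E.structConst (negRoot α) (negRoot β) = -E.structConst α β := by
  have h1 := congrArg ω (E.lie_e_e h)
  rw [LieEquiv.map_lie, hE.2, hE.2, map_smul, hE.2, neg_lie, lie_neg, neg_neg,
    E.lie_e_e (root_neg_add h), smul_neg, ← neg_smul] at h1
  exact smul_left_injective ℂ (E.e_ne_zero _) h1

lemma IsAdapted.exists_sq_eq {ω : L ≃ₗ⁅ℂ⁆ L} (hE : E.IsAdapted ω) {α β γ : H.root}
    (h : (rootSystem H).root γ = (rootSystem H).root α + (rootSystem H).root β) :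
    ∃ c : ℝ, 0 < c ∧ E.structConst α β ^ 2 = c := by
  obtain ⟨c, hc, h1⟩ := E.exists_structConst_mul_neg h
  rw [hE.structConst_neg h] at h1
  exact ⟨c, hc, by linear_combination -h1⟩

/-- The square is a positive real number, so the constant is one of its two real roots. -/
lemma IsAdapted.conj_structConst {ω : L ≃ₗ⁅ℂ⁆ L} (hE : E.IsAdapted ω) {α β γ : H.root}
    (h : (rootSystem H).root γ = (rootSystem H).root α + (rootSystem H).root β) :
    (starRingEnd ℂ) (E.structConst α β) = E.structConst α β := by
  obtain ⟨c, hc, h1⟩ := hE.exists_sq_eq h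
  have h2 : (E.structConst α β - (Real.sqrt c : ℂ)) * (E.structConst α β + (Real.sqrt c : ℂ)) = 0 := by
    have : ((Real.sqrt c : ℂ)) ^ 2 = c := by
      rw [← Complex.ofReal_pow, Real.sq_sqrt hc.le]
    linear_combination h1 - this
  rcases mul_eq_zero.mp h2 with h3 | h3
  · rw [sub_eq_zero.mp h3, Complex.conj_ofReal]
  · rw [eq_neg_of_add_eq_zero_left h3, map_neg, Complex.conj_ofReal]

lemma IsAdapted.isUnitary {ω : L ≃ₗ⁅ℂ⁆ L} (hE : E.IsAdapted ω) : E.IsUnitary :=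
  fun _ _ _ h => by rw [hE.structConst_neg h, hE.conj_structConst h]

end RootVectors

end StructConst

/-! ### The conjugate-linear involution -/

section Star

lemma conj_root_rootH (α β : H.root) : (starRingEnd ℂ) ((rootSystem H).root α (rootH β)) =
    (rootSystem H).root α (rootH β) := by
  obtain ⟨r, hr, h⟩ := exists_len_eq β
  have h1 : (rootSystem H).root α (rootH β) =
      (((rootSystem H).pairingIn ℤ α β * (r / 2) : ℝ) : ℂ) := by
    rw [root_rootH, h]; push_cast; rfl
  rw [h1, Complex.conj_ofReal]

namespace RootVectors

variable (E : RootVectors H)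

/-- The conjugate-linear involution that fixes the `t_α` and exchanges `e α` and `e (-α)`. -/
def conjStar : L →ₛₗ[starRingEnd ℂ] L where
  toFun x := ∑ α : H.root, (starRingEnd ℂ) (killingForm ℂ L x (rootH α)) • (rootH α : L) +
    ∑ α : H.root, (starRingEnd ℂ) (killingForm ℂ L x (E.e (negRoot α))) • E.e (negRoot α)
  map_add' x y := by
    simp only [map_add, LinearMap.add_apply, add_smul, Finset.sum_add_distrib]
    abel
  map_smul' c x := by
    simp only [map_smul, LinearMap.smul_apply, smul_eq_mul, map_mul, smul_add, Finset.smul_sum,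
      smul_smul]

lemma conjStar_apply (x : L) : E.conjStar x =
    ∑ α : H.root, (starRingEnd ℂ) (killingForm ℂ L x (rootH α)) • (rootH α : L) +
    ∑ α : H.root, (starRingEnd ℂ) (killingForm ℂ L x (E.e (negRoot α))) • E.e (negRoot α) := rfl

lemma rootElt_mem (α : H.root) : (rootH α : L) ∈ E.hermitian :=
  Submodule.subset_span (Or.inl (Or.inl ⟨α, rfl⟩))

lemma e_add_mem (α : H.root) : E.e α + E.e (negRoot α) ∈ E.hermitian :=
  Submodule.subset_span (Or.inl (Or.inr ⟨α, negRoot α, rfl, rfl⟩))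

lemma e_sub_mem (α : H.root) : Complex.I • (E.e α - E.e (negRoot α)) ∈ E.hermitian :=
  Submodule.subset_span (Or.inr ⟨α, negRoot α, rfl, rfl⟩)

variable {E}

lemma IsInvolution.apply_of_mem {star : L →ₛₗ[starRingEnd ℂ] L} (h : E.IsInvolution star) {x : L}
    (hx : x ∈ E.hermitian) : star x = x := by
  simpa using h x hx 0 (Submodule.zero_mem _)

lemma IsInvolution.rootH {star : L →ₛₗ[starRingEnd ℂ] L} (h : E.IsInvolution star) (α : H.root) :
    star (TodaWeyl.rootH α : L) = (TodaWeyl.rootH α : L) := h.apply_of_mem (E.rootElt_mem α)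

/-- e α is ½ (e α + e (-α)) + i · (-½) · i (e α - e (-α)), with both components in 𝔞; the sign
change of the second turns it into e (-α). -/
lemma IsInvolution.e {star : L →ₛₗ[starRingEnd ℂ] L} (h : E.IsInvolution star) (α : H.root) :
    star (E.e α) = E.e (negRoot α) := by
  have h1 := h _ (E.hermitian.smul_mem (1 / 2) (E.e_add_mem α)) _
    (E.hermitian.smul_mem (-1 / 2) (E.e_sub_mem α))
  have h2 : ∀ r : ℝ, ∀ x : L, r • x = (r : ℂ) • x := fun _ _ => rfl
  simp only [h2, smul_smul, smul_add, smul_sub] at h1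
  have h3 : Complex.I * (((-1 / 2 : ℝ) : ℂ) * Complex.I) = 1 / 2 := by
    push_cast
    linear_combination (-1 / 2 : ℂ) * Complex.I_mul_I
  rw [h3] at h1
  push_cast at h1
  convert h1 using 1
  · congr 1
    module
  · module

end RootVectors

lemma semilinear_ext {f g : L →ₛₗ[starRingEnd ℂ] L} (E : RootVectors H)
    (h1 : ∀ α : H.root, f (rootH α : L) = g (rootH α : L)) (h2 : ∀ α, f (E.e α) = g (E.e α))
    (x : L) : f x = g x := by
  rw [E.eq_sum x]
  simp only [map_add, map_sum, LinearMap.map_smulₛₗ, h1, h2]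

namespace RootVectors

variable (E : RootVectors H)

lemma conjStar_e (α : H.root) : E.conjStar (E.e α) = E.e (negRoot α) := by
  have h1 : ∀ β : H.root, killingForm ℂ L (E.e α) (rootH β) = 0 := fun β => by
    rw [killingForm_comm]; exact killingForm_coe_rsp _ (E.e_mem α)
  rw [conjStar_apply, Finset.sum_eq_single_of_mem (f := fun β : H.root =>
    (starRingEnd ℂ) (killingForm ℂ L (E.e α) (E.e (negRoot β))) • E.e (negRoot β)) α
    (Finset.mem_univ α)]
  · simp [h1, E.killingForm_e_neg]
  · intro β _ hβ
    rw [killingForm_rsp_eq_zero (fun h => hβ (by rw [← negRoot_negRoot β, h, negRoot_negRoot]))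
      (E.e_mem α) (E.e_mem _), map_zero, zero_smul]

lemma conjStar_rootH (α : H.root) : E.conjStar (rootH α : L) = (rootH α : L) := by
  have h2 : ∀ β : H.root, killingForm ℂ L (rootH α : L) (E.e (negRoot β)) = 0 := fun β =>
    killingForm_coe_rsp _ (E.e_mem _)
  have h1 : ∀ β : H.root, (starRingEnd ℂ) (killingForm ℂ L (rootH α : L) (rootH β : L)) =
      killingForm ℂ L (rootH α : L) (rootH β : L) := fun β => by
    rw [killingForm_rootH, conj_root_rootH]
  conv_rhs => rw [E.eq_sum (rootH α : L)]
  rw [conjStar_apply]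
  simp only [h1, h2, map_zero, zero_smul, Finset.sum_const_zero]

lemma conjStar_conjStar (x : L) : E.conjStar (E.conjStar x) = x := by
  conv_rhs => rw [E.eq_sum x]
  rw [E.conjStar_apply x]
  simp only [map_add, map_sum, LinearMap.map_smulₛₗ, conjStar_e, conjStar_rootH, negRoot_negRoot,
    Complex.conj_conj]

lemma conjStar_eq_of_mem {x : L} (hx : x ∈ E.hermitian) : E.conjStar x = x := by
  induction hx using Submodule.span_induction with
  | mem x h =>
    rcases h with (⟨α, rfl⟩ | ⟨α, β, h, rfl⟩) | ⟨α, β, h, rfl⟩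
    · exact E.conjStar_rootH α
    · rw [coe_eq_neg_iff] at h
      subst h
      rw [map_add, conjStar_e, conjStar_e, negRoot_negRoot, add_comm]
    · rw [coe_eq_neg_iff] at h
      subst h
      rw [LinearMap.map_smulₛₗ, map_sub, conjStar_e, conjStar_e, negRoot_negRoot, Complex.conj_I,
        neg_smul, ← smul_neg, neg_sub]
  | zero => simp
  | add x y _ _ hx hy => rw [map_add, hx, hy]
  | smul a x _ hx =>
    rw [← Complex.coe_smul a x, LinearMap.map_smulₛₗ, hx, Complex.conj_ofReal]

lemma add_conj_smul_mem (c : ℂ) (α : H.root) :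
    c • E.e α + (starRingEnd ℂ) c • E.e (negRoot α) ∈ E.hermitian := by
  have h := E.hermitian.add_mem (E.hermitian.smul_mem c.re (E.e_add_mem α))
    (E.hermitian.smul_mem c.im (E.e_sub_mem α))
  have h2 : ∀ r : ℝ, ∀ x : L, r • x = (r : ℂ) • x := fun _ _ => rfl
  rw [h2, h2, smul_smul] at h
  convert h using 1
  have h3 : c = c.re + c.im * Complex.I := (Complex.re_add_im c).symm
  have h4 : (starRingEnd ℂ) c = c.re - c.im * Complex.I := by
    apply Complex.ext <;> simp
  rw [h4]
  nth_rewrite 1 [h3]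
  module

lemma mem_hermitian_iff {x : L} : x ∈ E.hermitian ↔ E.conjStar x = x := by
  refine ⟨E.conjStar_eq_of_mem, fun h => ?_⟩
  have h2 : ∀ r : ℝ, ∀ x : L, r • x = (r : ℂ) • x := fun _ _ => rfl
  have h1 : x = (1 / 2 : ℝ) • (x + E.conjStar x) := by
    rw [h, h2, ← two_smul ℂ x, smul_smul]
    norm_num
  rw [h1]
  refine E.hermitian.smul_mem _ ?_
  nth_rewrite 1 [E.eq_sum x]
  rw [conjStar_apply, add_add_add_comm, ← Finset.sum_add_distrib, ← Finset.sum_add_distrib]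
  refine E.hermitian.add_mem (Submodule.sum_mem _ fun α _ => ?_)
    (Submodule.sum_mem _ fun α _ => E.add_conj_smul_mem _ α)
  rw [← add_smul, Complex.add_conj, ← h2]
  exact E.hermitian.smul_mem _ (E.rootElt_mem α)

lemma isInvolution_conjStar : E.IsInvolution E.conjStar := by
  intro x hx y hy
  rw [map_add, LinearMap.map_smulₛₗ, E.conjStar_eq_of_mem hx, E.conjStar_eq_of_mem hy,
    Complex.conj_I, neg_smul, sub_eq_add_neg]

variable {E}

/-- A conjugate-linear map is determined on the t_α and e α, so every statement about `star` may be
proved for the explicit `conjStar`. -/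
lemma IsInvolution.eq_conjStar {star : L →ₛₗ[starRingEnd ℂ] L} (h : E.IsInvolution star) :
    star = E.conjStar :=
  LinearMap.ext (semilinear_ext E (fun α => by rw [h.rootH, conjStar_rootH])
    fun α => by rw [h.e, conjStar_e])

lemma conjStar_coe (z : H) : E.conjStar (z : L) ∈ H := by
  have h2 : ∀ β : H.root, killingForm ℂ L (z : L) (E.e (negRoot β)) = 0 := fun β =>
    killingForm_coe_rsp _ (E.e_mem _)
  rw [conjStar_apply]
  simp only [h2, map_zero, zero_smul, Finset.sum_const_zero, add_zero]
  exact sum_mem fun α _ => H.smul_mem _ (rootH α).2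

/-- On pairs of root vectors this is the condition on structure constants; brackets with t_α are
covered because roots take real values on the t_α. Thus -* is a conjugate-linear automorphism whose
fixed space is i𝔞. -/
lemma IsUnitary.conjStar_lie (hE : E.IsUnitary) (x y : L) :
    E.conjStar ⁅x, y⁆ = -⁅E.conjStar x, E.conjStar y⁆ := by
  have hn : ∀ α : H.root, ((rootH (negRoot α) : H) : L) = -(rootH α : L) := fun α => by
    rw [rootH_negRoot]; rfl
  have hte : ∀ α β : H.root, E.conjStar ⁅(rootH α : L), E.e β⁆ =
      -⁅E.conjStar (rootH α : L), E.conjStar (E.e β)⁆ := fun α β => by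
    rw [lie_coe_rsp (E.e_mem β), LinearMap.map_smulₛₗ, conjStar_e, conjStar_rootH,
      lie_coe_rsp (E.e_mem (negRoot β)), conj_root_rootH, root_negRoot, LinearMap.neg_apply, neg_smul, neg_neg]
  have hee : ∀ α β : H.root, E.conjStar ⁅E.e α, E.e β⁆ =
      -⁅E.conjStar (E.e α), E.conjStar (E.e β)⁆ := fun α β => by
    rw [conjStar_e, conjStar_e]
    by_cases h0 : (rootSystem H).root α + (rootSystem H).root β = 0
    · have hβ : β = negRoot α := eq_negRoot (eq_neg_of_add_eq_zero_right h0)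
      subst hβ
      rw [E.lie_e_neg, E.lie_e_neg, conjStar_rootH, hn, neg_neg]
    · by_cases h : (rootSystem H).root α + (rootSystem H).root β ∈ Set.range (rootSystem H).root
      · obtain ⟨γ, hγ⟩ := h
        rw [E.lie_e_e hγ, E.lie_e_e (root_neg_add hγ), LinearMap.map_smulₛₗ, conjStar_e,
          hE α β γ hγ, neg_smul, neg_neg]
      · rw [lie_eq_zero_of_add_notMem h h0 (E.e_mem α) (E.e_mem β), map_zero,
          lie_eq_zero_of_add_notMem _ _ (E.e_mem (negRoot α)) (E.e_mem (negRoot β)), neg_zero]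
        · rw [root_negRoot, root_negRoot, ← neg_add]
          rintro ⟨γ, hγ⟩
          exact h ⟨negRoot γ, by rw [root_negRoot, hγ, neg_neg]⟩
        · rw [root_negRoot, root_negRoot, ← neg_add]
          exact neg_ne_zero.mpr h0
  have htt : ∀ α β : H.root, E.conjStar ⁅(rootH α : L), (rootH β : L)⁆ =
      -⁅E.conjStar (rootH α : L), E.conjStar (rootH β : L)⁆ := fun α β => by
    have : ⁅rootH α, rootH β⁆ = 0 := trivial_lie_zero _ _ _ _
    have h0 : ⁅(rootH α : L), (rootH β : L)⁆ = 0 := congrArg Subtype.val this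
    rw [conjStar_rootH, conjStar_rootH, h0, map_zero, neg_zero]
  have het : ∀ α β : H.root, E.conjStar ⁅E.e β, (rootH α : L)⁆ =
      -⁅E.conjStar (E.e β), E.conjStar (rootH α : L)⁆ := fun α β => by
    rw [← lie_skew, map_neg, hte, ← lie_skew (E.conjStar (E.e β))]
  rw [E.eq_sum x, E.eq_sum y]
  simp only [add_lie, lie_add, sum_lie, lie_sum, smul_lie, lie_smul, map_add, map_sum,
    LinearMap.map_smulₛₗ, hte, htt, het, hee, smul_neg, Finset.sum_neg_distrib, ← neg_add]

lemma IsUnitary.isCompactType (hE : E.IsUnitary) : E.IsCompactType := by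
  intro x hx y hy
  rw [mem_hermitian_iff] at *
  rw [LinearMap.map_smulₛₗ, hE.conjStar_lie, hx, hy, Complex.conj_I, smul_neg, neg_smul, neg_neg]

end RootVectors

end Star

/-! ### Automorphisms that preserve the Cartan subalgebra -/

section Lift

/-- The automorphism `τ` preserves `H` and acts on the roots through the permutation `π`. -/
structure IsLift (τ : L ≃ₗ⁅ℂ⁆ L) (π : Equiv.Perm H.root) : Prop where
  map_rootH : ∀ α, τ (rootH α : L) = (rootH (π α) : L)
  map_rsp : ∀ α, ∀ x ∈ rsp α, τ x ∈ rsp (π α)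

lemma coe_add_sub (y z : H) : ((y + z : H) : L) = y + z := rfl

lemma coe_neg_sub (z : H) : ((-z : H) : L) = -z := rfl

lemma rootH_injective : Function.Injective (rootH : H.root → H) := by
  intro α β h
  apply root_injective
  ext z
  rw [← killingForm_rootH, h, killingForm_rootH]

/-- Additive relations between roots become relations in `H`, to which an automorphism can be
applied. -/
lemma rootH_eq_add_iff {α β γ : H.root} :
    rootH γ = rootH α + rootH β ↔
      (rootSystem H).root γ = (rootSystem H).root α + (rootSystem H).root β := by
  constructor
  · intro h
    ext z
    rw [LinearMap.add_apply, ← killingForm_rootH, h, ← killingForm_rootH, ← killingForm_rootH,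
      coe_add_sub, map_add, LinearMap.add_apply]
  · intro h
    apply (cartanEquivDual H).injective
    rw [map_add]
    ext z
    have h1 : ∀ δ : H.root, cartanEquivDual H (rootH δ) z = (rootSystem H).root δ z := fun δ =>
      killingForm_rootH δ z
    rw [LinearMap.add_apply, h1, h1, h1, h, LinearMap.add_apply]

lemma exists_root_eq {x : L} (hx : x ∉ H) (f : Module.Dual ℂ H)
    (h : ∀ z : H, ⁅(z : L), x⁆ = f z • x) : ∃ β : H.root, (rootSystem H).root β = f ∧ x ∈ rsp β := by
  have hx0 : x ≠ 0 := by rintro rfl; exact hx H.zero_mem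
  have hm : x ∈ genWeightSpace L (f : H → ℂ) := by
    refine (mem_genWeightSpace _ _ _).mpr fun z => ⟨1, ?_⟩
    have h1 : ⁅z, x⁆ = f z • x := h z
    rw [pow_one, LinearMap.sub_apply, toEnd_apply_apply, h1]
    simp
  have hb : genWeightSpace L (f : H → ℂ) ≠ ⊥ := by
    intro hb
    rw [hb] at hm
    exact hx0 (by simpa using hm)
  let w : Weight ℂ H L := ⟨_, hb⟩
  have hnz : w.IsNonZero := by
    intro hz
    have : (f : H → ℂ) = 0 := hz
    rw [this] at hm
    change x ∈ rootSpace H (0 : H → ℂ) at hm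
    rw [rootSpace_zero_eq ℂ L H, LieSubalgebra.mem_toLieSubmodule] at hm
    exact hx hm
  exact ⟨⟨w, by simpa using hnz⟩, by ext z; rfl, hm⟩

lemma notMem_of_mem_rsp {α : H.root} {x : L} (hx : x ∈ rsp α) (hx0 : x ≠ 0) : x ∉ H := by
  intro h
  obtain ⟨y, hy, hxy⟩ := exists_killingForm_eq_one hx hx0
  rw [killingForm_coe_rsp ⟨x, h⟩ hy] at hxy
  exact zero_ne_one hxy

/-- The image of the root space of α has weight α ∘ σ⁻¹, which is a root because the image does not
meet `H` outside 0. Invariance of the Killing form gives the action on the t_α. -/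
lemma exists_isLift (τ : L ≃ₗ⁅ℂ⁆ L) (σ : H ≃ₗ[ℂ] H) (hlift : ∀ x : H, τ (x : L) = (σ x : L)) :
    ∃ π : Equiv.Perm H.root, IsLift τ π := by
  have h1 : ∀ α : H.root, ∃ β : H.root,
      (rootSystem H).root β = (rootSystem H).root α ∘ₗ σ.symm.toLinearMap := by
    intro α
    obtain ⟨x, hx, hx0⟩ := exists_mem_rsp_ne_zero α
    have hτx : τ x ∉ H := by
      intro h
      have h2 : τ x = τ (σ.symm ⟨τ x, h⟩ : H) := by rw [hlift, LinearEquiv.apply_symm_apply]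
      exact notMem_of_mem_rsp hx hx0 (τ.injective h2 ▸ (σ.symm ⟨τ x, h⟩).2)
    obtain ⟨β, hβ, -⟩ := exists_root_eq hτx ((rootSystem H).root α ∘ₗ σ.symm.toLinearMap) (by
      intro z
      have h2 : (z : L) = τ (σ.symm z : H) := by rw [hlift, LinearEquiv.apply_symm_apply]
      rw [h2, ← LieEquiv.map_lie, lie_coe_rsp hx, map_smul]
      rfl)
    exact ⟨β, hβ⟩
  choose p hp using h1
  have hinj : Function.Injective p := by
    intro α β h
    apply root_injective
    ext z
    have h2 := (hp α).symm.trans ((congrArg _ h).trans (hp β))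
    have h3 := LinearMap.congr_fun h2 (σ z)
    simpa using h3
  refine ⟨Equiv.ofBijective p (Finite.injective_iff_bijective.mp hinj), fun α => ?_,
    fun α x hx => ?_⟩
  · rw [hlift]
    congr 1
    apply (cartanEquivDual H).injective
    ext z
    change killingForm ℂ L (σ (rootH α) : L) (z : L) = killingForm ℂ L (rootH (p α) : L) (z : L)
    have h2 : (z : L) = τ (σ.symm z : H) := by rw [hlift, LinearEquiv.apply_symm_apply]
    rw [killingForm_rootH, hp, ← hlift, h2, killingForm_of_equiv_apply, killingForm_rootH]
    rfl
  · apply mem_rsp_of_lie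
    intro z
    have h2 : (z : L) = τ (σ.symm z : H) := by rw [hlift, LinearEquiv.apply_symm_apply]
    rw [h2, ← LieEquiv.map_lie, lie_coe_rsp hx, map_smul]
    congr 1
    exact (LinearMap.congr_fun (hp α) z).symm

/-- The iterates of an automorphism. -/
def lieIter (τ : L ≃ₗ⁅ℂ⁆ L) : ℕ → (L ≃ₗ⁅ℂ⁆ L)
  | 0 => LieEquiv.refl
  | k + 1 => (lieIter τ k).trans τ

lemma lieIter_apply (τ : L ≃ₗ⁅ℂ⁆ L) (k : ℕ) (x : L) : lieIter τ k x = τ^[k] x := by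
  induction k with
  | zero => rfl
  | succ k ih => rw [Function.iterate_succ_apply', ← ih]; rfl

namespace IsLift

variable {τ : L ≃ₗ⁅ℂ⁆ L} {π : Equiv.Perm H.root}

lemma iterate (h : IsLift τ π) (k : ℕ) : IsLift (lieIter τ k) (π ^ k) := by
  induction k with
  | zero => exact ⟨fun α => rfl, fun α x hx => hx⟩
  | succ k ih =>
    rw [pow_succ']
    exact ⟨fun α => by
      change τ (lieIter τ k _) = _
      rw [ih.map_rootH, h.map_rootH]; rfl, fun α x hx => h.map_rsp _ _ (ih.map_rsp α x hx)⟩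

lemma root_add (h : IsLift τ π) {α β γ : H.root}
    (hγ : (rootSystem H).root γ = (rootSystem H).root α + (rootSystem H).root β) :
    (rootSystem H).root (π γ) = (rootSystem H).root (π α) + (rootSystem H).root (π β) := by
  rw [← rootH_eq_add_iff] at hγ ⊢
  apply Subtype.ext
  rw [coe_add_sub, ← h.map_rootH, ← h.map_rootH, ← h.map_rootH, ← map_add, hγ,
    coe_add_sub]

lemma map_negRoot (h : IsLift τ π) (α : H.root) : π (negRoot α) = negRoot (π α) := by
  apply rootH_injective
  apply Subtype.ext
  rw [rootH_negRoot, coe_neg_sub, ← h.map_rootH, ← h.map_rootH, rootH_negRoot,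
    coe_neg_sub, map_neg]

lemma root_rootH_map (h : IsLift τ π) (α β : H.root) :
    (rootSystem H).root (π α) (rootH (π β)) = (rootSystem H).root α (rootH β) := by
  rw [← killingForm_rootH, ← killingForm_rootH, ← h.map_rootH, ← h.map_rootH,
    killingForm_of_equiv_apply]

lemma len_map (h : IsLift τ π) (α : H.root) : len (π α) = len α := h.root_rootH_map α α

lemma pairingIn_map (h : IsLift τ π) (α β : H.root) :
    (rootSystem H).pairingIn ℤ (π α) (π β) = (rootSystem H).pairingIn ℤ α β := by
  have h1 := h.root_rootH_map α β
  rw [root_rootH, root_rootH, h.len_map] at h1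
  have h2 : len β / 2 ≠ 0 := div_ne_zero (len_ne_zero β) two_ne_zero
  exact_mod_cast mul_right_cancel₀ h2 h1

end IsLift

/-- The coefficient `u` in `τ (e α) = u α • e (π α)`. -/
def RootVectors.liftCoeff (E : RootVectors H) (τ : L ≃ₗ⁅ℂ⁆ L) (π : Equiv.Perm H.root)
    (α : H.root) : ℂ :=
  killingForm ℂ L (τ (E.e α)) (E.e (negRoot (π α)))

namespace IsLift

variable {τ : L ≃ₗ⁅ℂ⁆ L} {π : Equiv.Perm H.root} (h : IsLift τ π) (E : RootVectors H)

include h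

lemma map_e (α : H.root) : τ (E.e α) = E.liftCoeff τ π α • E.e (π α) :=
  E.eq_smul (h.map_rsp α _ (E.e_mem α))

lemma liftCoeff_mul_neg (α : H.root) :
    E.liftCoeff τ π α * E.liftCoeff τ π (negRoot α) = 1 := by
  have h1 := killingForm_of_equiv_apply τ (E.e α) (E.e (negRoot α))
  rw [h.map_e, h.map_e, h.map_negRoot, map_smul, map_smul, LinearMap.smul_apply,
    E.killingForm_e_neg] at h1
  rw [E.killingForm_e_neg] at h1
  simpa [mul_comm] using h1

lemma liftCoeff_ne_zero (α : H.root) : E.liftCoeff τ π α ≠ 0 :=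
  left_ne_zero_of_mul_eq_one (h.liftCoeff_mul_neg E α)

lemma liftCoeff_neg (α : H.root) : E.liftCoeff τ π (negRoot α) = (E.liftCoeff τ π α)⁻¹ :=
  eq_inv_of_mul_eq_one_right (h.liftCoeff_mul_neg E α)

lemma structConst_mul_liftCoeff {α β γ : H.root}
    (hγ : (rootSystem H).root γ = (rootSystem H).root α + (rootSystem H).root β) :
    E.structConst α β * E.liftCoeff τ π γ =
      E.liftCoeff τ π α * E.liftCoeff τ π β * E.structConst (π α) (π β) := by
  have h1 := congrArg τ (E.lie_e_e hγ)
  rw [LieEquiv.map_lie, map_smul, h.map_e, h.map_e, h.map_e, smul_lie, lie_smul,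
    E.lie_e_e (h.root_add hγ), smul_smul, smul_smul, smul_smul] at h1
  exact (smul_left_injective ℂ (E.e_ne_zero _) h1).symm

/-- Write N, N' for the constants before and after π. The relation N u(γ) = u(α) u(β) N', read for
the negative roots where u is inverted, gives N u(α) u(β) = u(γ) N'. Multiplying crosswise yields N²
= N'². -/
lemma structConst_map_sq {ω : L ≃ₗ⁅ℂ⁆ L} (hE : E.IsAdapted ω) {α β γ : H.root}
    (hγ : (rootSystem H).root γ = (rootSystem H).root α + (rootSystem H).root β) :
    E.structConst (π α) (π β) ^ 2 = E.structConst α β ^ 2 := by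
  have h1 := h.structConst_mul_liftCoeff E hγ
  have h2 := h.structConst_mul_liftCoeff E (RootVectors.root_neg_add hγ)
  rw [h.liftCoeff_neg, h.liftCoeff_neg, h.liftCoeff_neg, h.map_negRoot, h.map_negRoot,
    hE.structConst_neg hγ, hE.structConst_neg (h.root_add hγ)] at h2
  have ha := h.liftCoeff_ne_zero E α
  have hb := h.liftCoeff_ne_zero E β
  have hc := h.liftCoeff_ne_zero E γ
  field_simp at h2
  have h3 : E.structConst α β * E.liftCoeff τ π α * E.liftCoeff τ π β =
      E.structConst (π α) (π β) * E.liftCoeff τ π γ := by linear_combination -h2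
  have h4 : (E.structConst (π α) (π β) ^ 2 - E.structConst α β ^ 2) *
      (E.liftCoeff τ π γ * (E.liftCoeff τ π α * E.liftCoeff τ π β)) = 0 := by
    linear_combination (-E.structConst α β * E.liftCoeff τ π α * E.liftCoeff τ π β) * h1 -
       E.liftCoeff τ π α * E.liftCoeff τ π β * E.structConst (π α) (π β) * h3
  have h5 := (mul_eq_zero.mp h4).resolve_right (by positivity)
  exact sub_eq_zero.mp h5

/-- Squaring removes the sign by which N(πα,πβ) may differ from N(α,β). -/
lemma liftCoeff_sq_add {ω : L ≃ₗ⁅ℂ⁆ L} (hE : E.IsAdapted ω) {α β γ : H.root}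
    (hγ : (rootSystem H).root γ = (rootSystem H).root α + (rootSystem H).root β) :
    E.liftCoeff τ π γ ^ 2 = E.liftCoeff τ π α ^ 2 * E.liftCoeff τ π β ^ 2 := by
  have h1 := h.structConst_mul_liftCoeff E hγ
  have h2 := h.structConst_map_sq E hE hγ
  have h3 := E.structConst_ne_zero hγ
  refine mul_left_cancel₀ (pow_ne_zero 2 h3) ?_
  rw [← mul_pow, h1, mul_pow, h2]
  ring

lemma norm_liftCoeff_add {ω : L ≃ₗ⁅ℂ⁆ L} (hE : E.IsAdapted ω) {α β γ : H.root}
    (hγ : (rootSystem H).root γ = (rootSystem H).root α + (rootSystem H).root β) :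
    ‖E.liftCoeff τ π γ‖ = ‖E.liftCoeff τ π α‖ * ‖E.liftCoeff τ π β‖ := by
  have h1 := congrArg norm (h.liftCoeff_sq_add E hE hγ)
  rw [norm_mul, norm_pow, norm_pow, norm_pow, ← mul_pow] at h1
  exact (pow_left_inj₀ (norm_nonneg _) (by positivity) two_ne_zero).mp h1

end IsLift

lemma liftCoeff_iter_succ {τ : L ≃ₗ⁅ℂ⁆ L} {π : Equiv.Perm H.root} (h : IsLift τ π)
    (E : RootVectors H) (k : ℕ) (α : H.root) :
    E.liftCoeff (lieIter τ (k + 1)) (π ^ (k + 1)) α =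
      E.liftCoeff τ π α * E.liftCoeff (lieIter τ k) (π ^ k) (π α) := by
  have h1 := (h.iterate (k + 1)).map_e E α
  have h2 : lieIter τ (k + 1) (E.e α) = lieIter τ k (τ (E.e α)) := by
    rw [lieIter_apply, lieIter_apply, Function.iterate_succ_apply]
  rw [h2, h.map_e, map_smul, (h.iterate k).map_e, smul_smul] at h1
  have h3 : (π ^ k) (π α) = (π ^ (k + 1)) α := by rw [pow_succ]; rfl
  rw [h3] at h1
  exact (smul_left_injective ℂ (E.e_ne_zero _) h1).symm

lemma liftCoeff_iter {τ : L ≃ₗ⁅ℂ⁆ L} {π : Equiv.Perm H.root} (h : IsLift τ π)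
    (E : RootVectors H) (k : ℕ) (α : H.root) :
    E.liftCoeff (lieIter τ k) (π ^ k) α =
      ∏ j ∈ Finset.range k, E.liftCoeff τ π ((π ^ j) α) := by
  induction k generalizing α with
  | zero =>
    rw [Finset.prod_range_zero]
    exact E.killingForm_e_neg α
  | succ k ih =>
    rw [liftCoeff_iter_succ h, ih, Finset.prod_range_succ', mul_comm]
    congr 1

end Lift

/-! ### Root vectors whose involution commutes with a lift -/

section Commuting

/-- Rescaling of root vectors by positive numbers. -/
def RootVectors.rescale (E : RootVectors H) (a : H.root → ℝ) (ha : ∀ α, a α * a (negRoot α) = 1) :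
    RootVectors H where
  e α := (a α : ℂ) • E.e α
  e_mem α := Submodule.smul_mem _ _ (E.e_mem α)
  lie_e α β hβ := by
    rw [coe_eq_neg_iff] at hβ
    subst hβ
    rw [smul_lie, lie_smul, smul_smul, E.lie_e_neg, ← Complex.ofReal_mul, ha, Complex.ofReal_one,
      one_smul]
    rfl

/-- A multiplicative rescaling leaves every structure constant unchanged. -/
lemma RootVectors.IsUnitary.rescale {E : RootVectors H} (hE : E.IsUnitary) (a : H.root → ℝ)
    (ha : ∀ α, a α * a (negRoot α) = 1)
    (hadd : ∀ α β γ, (rootSystem H).root γ = (rootSystem H).root α + (rootSystem H).root β →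
      a γ = a α * a β) : (E.rescale a ha).IsUnitary := by
  have key : ∀ α β γ, (rootSystem H).root γ = (rootSystem H).root α + (rootSystem H).root β →
      (E.rescale a ha).structConst α β = E.structConst α β := by
    intro α β γ h
    have h1 := (E.rescale a ha).lie_e_e h
    change ⁅(a α : ℂ) • E.e α, (a β : ℂ) • E.e β⁆ = _ • ((a γ : ℂ) • E.e γ) at h1
    rw [smul_lie, lie_smul, E.lie_e_e h, smul_smul, smul_smul, smul_smul, hadd α β γ h] at h1
    have h2 := smul_left_injective ℂ (E.e_ne_zero _) h1
    have h3 : ((a α * a β : ℝ) : ℂ) ≠ 0 := by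
      rw [Complex.ofReal_ne_zero]
      exact mul_ne_zero (left_ne_zero_of_mul_eq_one (ha α)) (left_ne_zero_of_mul_eq_one (ha β))
    refine (mul_right_cancel₀ h3 (Eq.trans ?_ h2)).symm
    push_cast; ring
  intro α β γ h
  rw [key α β γ h, key _ _ _ (RootVectors.root_neg_add h), hE α β γ h]

/-- On e α, commuting means that u(-α) = u(α)⁻¹ equals the conjugate of u(α), which is what |u(α)| =
1 provides. -/
lemma IsLift.commute {τ : L ≃ₗ⁅ℂ⁆ L} {π : Equiv.Perm H.root} (h : IsLift τ π) (E : RootVectors H)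
    (hu : ∀ α, ‖E.liftCoeff τ π α‖ = 1) (x : L) : τ (E.conjStar x) = E.conjStar (τ x) := by
  refine semilinear_ext (f := (τ.toLinearEquiv.toLinearMap.comp E.conjStar : L →ₛₗ[starRingEnd ℂ] L))
    (g := (E.conjStar.comp τ.toLinearEquiv.toLinearMap : L →ₛₗ[starRingEnd ℂ] L)) E (fun α => ?_)
    (fun α => ?_) x
  · change τ (E.conjStar (rootH α : L)) = E.conjStar (τ (rootH α : L))
    rw [E.conjStar_rootH, h.map_rootH, E.conjStar_rootH]
  · change τ (E.conjStar (E.e α)) = E.conjStar (τ (E.e α))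
    rw [E.conjStar_e, h.map_e, h.map_e, LinearMap.map_smulₛₗ, E.conjStar_e, h.map_negRoot,
      h.liftCoeff_neg, ← Complex.inv_eq_conj (hu α)]

lemma IsLift.eq_of_forall_apply {τ : L ≃ₗ⁅ℂ⁆ L} {π : Equiv.Perm H.root} (h : IsLift τ π)
    (hτ : ∀ x, τ x = x) (α : H.root) : π α = α :=
  rootH_injective (Subtype.ext (by rw [← h.map_rootH, hτ]))

lemma IsLift.liftCoeff_eq_one {τ : L ≃ₗ⁅ℂ⁆ L} {π : Equiv.Perm H.root} (h : IsLift τ π)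
    (E : RootVectors H) (hτ : ∀ x, τ x = x) (α : H.root) : E.liftCoeff τ π α = 1 := by
  rw [RootVectors.liftCoeff, hτ, h.eq_of_forall_apply hτ, E.killingForm_e_neg]

/-- For a lift of finite order there are root vectors of compact type whose involution commutes
with the lift. -/
lemma IsLift.exists_commute {τ : L ≃ₗ⁅ℂ⁆ L} {π : Equiv.Perm H.root} (h : IsLift τ π) {n : ℕ}
    (hn : 0 < n) (hτ : ∀ x, lieIter τ n x = x) :
    ∃ (E : RootVectors H) (star : L →ₛₗ[starRingEnd ℂ] L),
      E.IsCompactType ∧ E.IsInvolution star ∧ ∀ x : L, τ (star x) = star (τ x) := by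
  obtain ⟨E, ω, hE⟩ := exists_isAdapted H
  let u : ℕ → H.root → ℝ := fun k α => ‖E.liftCoeff (lieIter τ k) (π ^ k) α‖
  have hu0 : ∀ k α, 0 < u k α := fun k α => norm_pos_iff.mpr ((h.iterate k).liftCoeff_ne_zero E α)
  -- The aim is a multiplicative positive `a` with a(πα) = a(α) |u(α)|; a product over the cyclic
  -- group generated by the lift provides it.
  let P : H.root → ℝ := fun α => ∏ k ∈ Finset.range n, u k α
  have hP0 : ∀ α, 0 < P α := fun α => Finset.prod_pos fun k _ => hu0 k α
  have hPadd : ∀ α β γ, (rootSystem H).root γ = (rootSystem H).root α + (rootSystem H).root β →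
      P γ = P α * P β := fun α β γ hγ => by
    rw [← Finset.prod_mul_distrib]
    exact Finset.prod_congr rfl fun k _ => (h.iterate k).norm_liftCoeff_add E hE hγ
  have hPneg : ∀ α, P α * P (negRoot α) = 1 := fun α => by
    rw [← Finset.prod_mul_distrib]
    refine Finset.prod_eq_one fun k _ => ?_
    rw [← norm_mul, (h.iterate k).liftCoeff_mul_neg, norm_one]
  -- The coefficient of the (k+1)-st power at α is u(α) times that of the k-th power at πα. The
  -- index shift costs nothing, since the zeroth and n-th powers both have coefficient 1.
  have hPπ : ∀ α, P (π α) * ‖E.liftCoeff τ π α‖ ^ n = P α := fun α => by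
    have h1 : u n α = 1 := by
      change ‖_‖ = _
      rw [(h.iterate n).liftCoeff_eq_one E hτ, norm_one]
    have h0 : u 0 α = 1 := by
      change ‖killingForm ℂ L (E.e α) (E.e (negRoot α))‖ = 1
      rw [E.killingForm_e_neg, norm_one]
    have h2 : ∏ k ∈ Finset.range n, u (k + 1) α = P α := by
      have h3 := Finset.prod_range_succ (fun k => u k α) n
      rw [Finset.prod_range_succ', h0, h1, mul_one, mul_one] at h3
      exact h3
    rw [← h2, ← Finset.card_range n, ← Finset.prod_const, Finset.card_range,
      ← Finset.prod_mul_distrib]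
    refine Finset.prod_congr rfl fun k _ => ?_
    change _ = ‖_‖
    rw [liftCoeff_iter_succ h, norm_mul, mul_comm]
  let a : H.root → ℝ := fun α => P α ^ (-(1 / n : ℝ))
  have ha0 : ∀ α, 0 < a α := fun α => Real.rpow_pos_of_pos (hP0 α) _
  have haneg : ∀ α, a α * a (negRoot α) = 1 := fun α => by
    rw [← Real.mul_rpow (hP0 _).le (hP0 _).le, hPneg, Real.one_rpow]
  have haadd : ∀ α β γ, (rootSystem H).root γ = (rootSystem H).root α + (rootSystem H).root β →
      a γ = a α * a β := fun α β γ hγ => by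
    rw [← Real.mul_rpow (hP0 _).le (hP0 _).le, ← hPadd α β γ hγ]
  have haπ : ∀ α, a α * ‖E.liftCoeff τ π α‖ = a (π α) := fun α => by
    have hn' : (n : ℝ) ≠ 0 := by exact_mod_cast hn.ne'
    have h1 : 0 < ‖E.liftCoeff τ π α‖ := norm_pos_iff.mpr (h.liftCoeff_ne_zero E α)
    change P α ^ (-(1 / n : ℝ)) * _ = _
    rw [← hPπ α, Real.mul_rpow (hP0 _).le (by positivity), ← Real.rpow_natCast, ← Real.rpow_mul h1.le,
      show (n : ℝ) * -(1 / n) = -1 by field_simp, Real.rpow_neg_one, mul_assoc,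
      inv_mul_cancel₀ h1.ne', mul_one]
  refine ⟨E.rescale a haneg, (E.rescale a haneg).conjStar,
    (hE.isUnitary.rescale a haneg haadd).isCompactType, RootVectors.isInvolution_conjStar _,
    h.commute _ fun α => ?_⟩
  have h1 := h.map_e (E.rescale a haneg) α
  change τ ((a α : ℂ) • E.e α) = _ • ((a (π α) : ℂ) • E.e (π α)) at h1
  rw [map_smul, h.map_e E, smul_smul, smul_smul] at h1
  have h2 := congrArg norm (smul_left_injective ℂ (E.e_ne_zero _) h1)
  simp only [norm_mul, Complex.norm_real, Real.norm_of_nonneg (ha0 _).le, haπ] at h2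
  exact (mul_eq_right₀ (ha0 (π α)).ne').mp h2.symm

end Commuting

/-! ### Pairings of roots and zero sums -/

section Pairings

/-- The integer `2 (α, β) / (β, β)`. -/
def pr (α β : H.root) : ℤ := (rootSystem H).pairingIn ℤ α β

lemma pr_cast (α β : H.root) :
    (pr α β : ℂ) = (rootSystem H).root α ((rootSystem H).coroot β) :=
  (rootSystem H).algebraMap_pairingIn ℤ α β

lemma pr_add {α β γ : H.root}
    (h : (rootSystem H).root γ = (rootSystem H).root α + (rootSystem H).root β) (δ : H.root) :
    pr γ δ = pr α δ + pr β δ := by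
  have : (pr γ δ : ℂ) = (pr α δ + pr β δ : ℤ) := by
    push_cast
    rw [pr_cast, pr_cast, pr_cast, h, LinearMap.add_apply]
  exact_mod_cast this

lemma pr_negRoot (α β : H.root) : pr (negRoot α) β = -pr α β := by
  have : (pr (negRoot α) β : ℂ) = (-pr α β : ℤ) := by
    push_cast
    rw [pr_cast, pr_cast, root_negRoot, LinearMap.neg_apply]
  exact_mod_cast this

lemma pr_self (α : H.root) : pr α α = 2 := (rootSystem H).pairingIn_same ℤ α

lemma pr_mul_len (α β : H.root) : (pr α β : ℂ) * len β = pr β α * len α := pairing_mul_len α β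

lemma pr_comm {α β : H.root} (h : len α = len β) : pr α β = pr β α := by
  have h1 := pr_mul_len α β
  rw [h] at h1
  exact_mod_cast mul_right_cancel₀ (len_ne_zero β) h1

lemma pr_mem_of_ne {α β : H.root} (h1 : α ≠ β) (h2 : α ≠ negRoot β) :
    (pr α β, pr β α) ∈ ({(0, 0), (1, 1), (-1, -1), (1, 2), (2, 1), (-1, -2), (-2, -1), (1, 3),
      (3, 1), (-1, -3), (-3, -1)} : Set (ℤ × ℤ)) :=
  (rootSystem H).pairingIn_pairingIn_mem_set_of_isCrystal_of_isRed' α β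
    (fun h => h1 (root_injective h)) (fun h => h2 (eq_negRoot h))

lemma pr_cases {α β : H.root} (h : len α = len β) (h1 : α ≠ β) (h2 : α ≠ negRoot β) :
    pr α β = -1 ∨ pr α β = 0 ∨ pr α β = 1 := by
  have h3 := pr_mem_of_ne h1 h2
  rw [← pr_comm h] at h3
  simp only [Set.mem_insert_iff, Prod.mk.injEq, Set.mem_singleton_iff] at h3
  omega

lemma exists_add_of_pr_neg {α β : H.root} (h : pr α β < 0) (h2 : α ≠ negRoot β) :
    ∃ γ : H.root, (rootSystem H).root γ = (rootSystem H).root α + (rootSystem H).root β :=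
  (rootSystem H).root_add_root_mem_of_pairingIn_neg h fun h' => h2 (eq_negRoot h')

lemma exists_sub_of_pr_pos {α β : H.root} (h : 0 < pr α β) (h2 : α ≠ β) :
    ∃ γ : H.root, (rootSystem H).root γ = (rootSystem H).root α - (rootSystem H).root β :=
  (rootSystem H).root_sub_root_mem_of_pairingIn_pos h h2

lemma pr_multiset_sum (s : Multiset H.root) (β : H.root)
    (hs : (s.map fun α => (rootSystem H).root α).sum = 0) : (s.map fun α => pr α β).sum = 0 := by
  have h1 : ((s.map fun α => pr α β).sum : ℂ) =
      (s.map fun α => (rootSystem H).root α).sum ((rootSystem H).coroot β) := by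
    clear hs
    induction s using Multiset.induction_on with
    | empty => simp
    | cons a s ih =>
      rw [Multiset.map_cons, Multiset.sum_cons, Multiset.map_cons, Multiset.sum_cons,
        LinearMap.add_apply, ← ih, ← pr_cast]
      push_cast; rfl
  rw [hs, LinearMap.zero_apply] at h1
  exact_mod_cast h1

/-- A set of roots closed under addition. -/
def IsAddClosed (Ψ : Set H.root) : Prop :=
  ∀ α ∈ Ψ, ∀ β ∈ Ψ, ∀ γ : H.root,
    (rootSystem H).root γ = (rootSystem H).root α + (rootSystem H).root β → γ ∈ Ψ

/-- A function on roots that is multiplicative on sums takes product one on families of roots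
with sum zero. -/
lemma prod_eq_one_of_sum_eq_zero {M : Type*} [CommMonoid M] {Ψ : Set H.root} (hΨ : IsAddClosed Ψ)
    (f : H.root → M) (hneg : ∀ α ∈ Ψ, f α * f (negRoot α) = 1)
    (hadd : ∀ α ∈ Ψ, ∀ β ∈ Ψ, ∀ γ : H.root,
      (rootSystem H).root γ = (rootSystem H).root α + (rootSystem H).root β → f γ = f α * f β)
    (s : Multiset H.root) (hsΨ : ∀ α ∈ s, α ∈ Ψ)
    (hs : (s.map fun α => (rootSystem H).root α).sum = 0) : (s.map f).prod = 1 := by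
  induction hn : s.card using Nat.strong_induction_on generalizing s with
  | _ n ih =>
  rcases Multiset.empty_or_exists_mem s with rfl | ⟨i, hi⟩
  · simp
  obtain ⟨t, rfl⟩ := Multiset.exists_cons_of_mem hi
  have h1 := pr_multiset_sum _ i hs
  rw [Multiset.map_cons, Multiset.sum_cons, pr_self] at h1
  -- The sum of all `pr j i` vanishes and `i` itself contributes 2, so some member is at an obtuse
  -- angle to `i`. The pair either cancels or can be replaced by its sum, which is a root.
  obtain ⟨j, hj, hji⟩ : ∃ j ∈ t, pr j i < 0 := by
    by_contra! hcon
    have : 0 ≤ (t.map fun α => pr α i).sum := Multiset.sum_nonneg fun x hx => by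
      obtain ⟨j, hj, rfl⟩ := Multiset.mem_map.mp hx
      exact hcon j hj
    omega
  obtain ⟨r, rfl⟩ := Multiset.exists_cons_of_mem hj
  have hiΨ := hsΨ i (by simp)
  have hjΨ := hsΨ j (by simp)
  simp only [Multiset.map_cons, Multiset.sum_cons, Multiset.prod_cons, Multiset.card_cons] at hs hn ⊢
  by_cases hij : j = negRoot i
  · subst hij
    rw [← mul_assoc, hneg i hiΨ, one_mul]
    refine ih _ (by omega) r (fun α hα => hsΨ α (by simp [hα])) ?_ rfl
    rwa [root_negRoot, add_neg_cancel_left] at hs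
  · obtain ⟨k, hk⟩ := exists_add_of_pr_neg hji hij
    have hk' := hadd j hjΨ i hiΨ k hk
    rw [← mul_assoc, mul_comm (f i), ← hk', ← Multiset.prod_cons, ← Multiset.map_cons]
    refine ih _ ?_ (k ::ₘ r) ?_ ?_ rfl
    · rw [Multiset.card_cons]; omega
    · intro α hα
      rcases Multiset.mem_cons.mp hα with rfl | hα
      · exact hΨ j hjΨ i hiΨ _ hk
      · exact hsΨ α (by simp [hα])
    · rw [Multiset.map_cons, Multiset.sum_cons, hk, add_comm (rootSystem H |>.root j), add_assoc, hs]

lemma prod_range_eq_one {M : Type*} [CommMonoid M] {Ψ : Set H.root} (hΨ : IsAddClosed Ψ)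
    (f : H.root → M) (hneg : ∀ α ∈ Ψ, f α * f (negRoot α) = 1)
    (hadd : ∀ α ∈ Ψ, ∀ β ∈ Ψ, ∀ γ : H.root,
      (rootSystem H).root γ = (rootSystem H).root α + (rootSystem H).root β → f γ = f α * f β)
    (x : ℕ → H.root) (hx : ∀ k, x k ∈ Ψ) (d : ℕ)
    (hs : ∑ k ∈ Finset.range d, (rootSystem H).root (x k) = 0) :
    ∏ k ∈ Finset.range d, f (x k) = 1 := by
  have := prod_eq_one_of_sum_eq_zero hΨ f hneg hadd ((Finset.range d).val.map x)
    (fun α hα => by obtain ⟨k, -, rfl⟩ := Multiset.mem_map.mp hα; exact hx k)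
    (by rw [Multiset.map_map]; exact hs)
  rw [Multiset.map_map] at this
  exact this

end Pairings

/-! ### Bilinear forms on lattices -/

section Lattice

variable {M : Type*} [AddCommGroup M]

/-- An even integral symmetric form on a lattice is the symmetrization of an integral form. -/
lemma exists_bilin_add_flip [Module.Finite ℤ M] [Module.Free ℤ M] (F : M →ₗ[ℤ] M →ₗ[ℤ] ℂ)
    (hsymm : ∀ x y, F x y = F y x) (hint : ∀ x y, ∃ n : ℤ, F x y = n)
    (heven : ∀ x, ∃ n : ℤ, F x x = 2 * n) :
    ∃ β : M →ₗ[ℤ] M →ₗ[ℤ] ℤ, ∀ x y, ((β x y + β y x : ℤ) : ℂ) = F x y := by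
  classical
  let b := Module.finBasis ℤ M
  choose n hn using hint
  choose m hm using heven
  -- The matrix of β is the part of the Gram matrix above the diagonal together with half the
  -- diagonal, which is integral by evenness.
  let β : M →ₗ[ℤ] M →ₗ[ℤ] ℤ := b.constr ℤ fun i => b.constr ℤ fun j =>
    if i < j then n (b i) (b j) else if i = j then m (b i) else 0
  have hβ : ∀ i j, β (b i) (b j) =
      if i < j then n (b i) (b j) else if i = j then m (b i) else 0 := fun i j => by
    simp only [β, Module.Basis.constr_basis]
  let c : ℤ →ₗ[ℤ] ℂ := (Int.castAddHom ℂ).toIntLinearMap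
  have key : (β + β.flip).compr₂ c = F := by
    refine b.ext fun i => b.ext fun j => ?_
    change ((β (b i) (b j) + β (b j) (b i) : ℤ) : ℂ) = _
    rw [hβ, hβ]
    rcases lt_trichotomy i j with h | h | h
    · simp [h, h.not_gt, h.ne', hn]
    · subst h
      simp only [lt_self_iff_false, if_false, if_true, hm]
      push_cast; ring
    · rw [hsymm]
      simp [h, h.not_gt, h.ne', hn]
  exact ⟨β, fun x y => by rw [← key]; rfl⟩

/-- An integral alternating form on a lattice is the antisymmetrization of an integral form. -/
lemma exists_bilin_sub_flip [Module.Finite ℤ M] [Module.Free ℤ M] (g : M →ₗ[ℤ] M →ₗ[ℤ] ℤ)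
    (hg : ∀ x, g x x = 0) : ∃ γ : M →ₗ[ℤ] M →ₗ[ℤ] ℤ, ∀ x y, γ x y - γ y x = g x y := by
  classical
  let b := Module.finBasis ℤ M
  have hskew : ∀ x y, g x y = -g y x := fun x y => by
    have := hg (x + y)
    simp only [map_add, LinearMap.add_apply, hg] at this
    omega
  let γ : M →ₗ[ℤ] M →ₗ[ℤ] ℤ := b.constr ℤ fun i => b.constr ℤ fun j =>
    if i < j then g (b i) (b j) else 0
  have hγ : ∀ i j, γ (b i) (b j) = if i < j then g (b i) (b j) else 0 := fun i j => by
    simp only [γ, Module.Basis.constr_basis]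
  have key : γ - γ.flip = g := by
    refine b.ext fun i => b.ext fun j => ?_
    change γ (b i) (b j) - γ (b j) (b i) = _
    rw [hγ, hγ]
    rcases lt_trichotomy i j with h | h | h
    · simp [h, h.not_gt]
    · subst h
      simp [hg]
    · simp [h, h.not_gt, hskew (b i)]
  exact ⟨γ, fun x y => by rw [← key]; rfl⟩

/-- A parity statement for zero-sum orbits of an endomorphism of a lattice. -/
lemma even_sum_of_orbit (S : M →ₗ[ℤ] M) (β γ : M →ₗ[ℤ] M →ₗ[ℤ] ℤ)
    (hγ : ∀ x y, γ x y - γ y x = β x y - β (S x) (S y)) (x : ℕ → M) (d : ℕ)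
    (hx : ∀ k, x (k + 1) = S (x k)) (hd : x d = x 0) (hsum : ∑ k ∈ Finset.range d, x k = 0) :
    Even (∑ k ∈ Finset.range d, γ (x k) (x k)) := by
  have h1 : ∀ m : ℕ, S (∑ k ∈ Finset.range m, x k) = ∑ k ∈ Finset.range (m + 1), x k - x 0 := by
    intro m
    rw [map_sum, Finset.sum_range_succ', add_sub_cancel_right]
    exact Finset.sum_congr rfl fun k _ => (hx k).symm
  -- Expanding γ on partial sums T, the cross terms are 2 γ(x_m,T) + β(T,x_m) - β(ST,Sx_m). Since S
  -- shifts the orbit, the β-terms telescope to a boundary contribution, which vanishes for the full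
  -- sum.
  have h2 : ∀ m : ℕ, ∃ n : ℤ, γ (∑ k ∈ Finset.range m, x k) (∑ k ∈ Finset.range m, x k) =
      ∑ k ∈ Finset.range m, γ (x k) (x k) + 2 * n +
        (- β (∑ k ∈ Finset.range m, x k) (x m) + β (x 0) (∑ k ∈ Finset.range m, x (k + 1))) := by
    intro m
    induction m with
    | zero => exact ⟨0, by simp⟩
    | succ m ih =>
      obtain ⟨n, hn⟩ := ih
      set T := ∑ k ∈ Finset.range m, x k with hT
      have h3 := hγ T (x m)
      rw [h1 m, ← hx, Finset.sum_range_succ, ← hT] at h3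
      refine ⟨n + γ (x m) T, ?_⟩
      rw [Finset.sum_range_succ, Finset.sum_range_succ, Finset.sum_range_succ (fun k => x (k + 1)),
        ← hT]
      simp only [map_add, map_sub, LinearMap.add_apply, LinearMap.sub_apply] at h3 ⊢
      linear_combination hn + h3
  obtain ⟨n, hn⟩ := h2 d
  have h4 : ∑ k ∈ Finset.range d, x (k + 1) = 0 := by
    have := Finset.sum_range_succ' x d
    rw [Finset.sum_range_succ, hsum, hd] at this
    have h5 : x 0 + 0 = x 0 + ∑ k ∈ Finset.range d, x (k + 1) := by
      rw [add_zero, add_comm (x 0)]; rw [← this, zero_add]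
    exact (add_left_cancel h5).symm
  rw [hsum, h4] at hn
  simp only [map_zero, LinearMap.zero_apply, neg_zero, add_zero] at hn
  exact ⟨-n, by omega⟩

end Lattice

/-! ### Trivializing a cocycle of signs on roots of equal length -/

section Signs

/-- A function of signs on pairs of roots in `Ψ` that has the formal properties of
`(-1) ^ β(i, j) * N(i, j)`. -/
structure IsSignCocycle (Ψ : Set H.root) (A : H.root → H.root → ℂ) : Prop where
  sq : ∀ i ∈ Ψ, ∀ j ∈ Ψ, ∀ k ∈ Ψ,
    (rootSystem H).root k = (rootSystem H).root i + (rootSystem H).root j → A i j ^ 2 = 1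
  symm : ∀ i ∈ Ψ, ∀ j ∈ Ψ, ∀ k ∈ Ψ,
    (rootSystem H).root k = (rootSystem H).root i + (rootSystem H).root j → A j i = A i j
  cyclic : ∀ i ∈ Ψ, ∀ j ∈ Ψ, ∀ k ∈ Ψ,
    (rootSystem H).root i + (rootSystem H).root j + (rootSystem H).root k = 0 → A j k = A i j
  neg : ∀ i ∈ Ψ, ∀ j ∈ Ψ, ∀ k ∈ Ψ,
    (rootSystem H).root k = (rootSystem H).root i + (rootSystem H).root j →
      A (negRoot i) (negRoot j) = -A i j
  assoc : ∀ i ∈ Ψ, ∀ j ∈ Ψ, ∀ k ∈ Ψ, ∀ p ∈ Ψ, ∀ q ∈ Ψ, ∀ r ∈ Ψ, pr i k = 0 →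
    (rootSystem H).root p = (rootSystem H).root i + (rootSystem H).root j →
    (rootSystem H).root q = (rootSystem H).root j + (rootSystem H).root k →
    (rootSystem H).root r = (rootSystem H).root p + (rootSystem H).root k →
      A p k * A i j = A i q * A j k

variable {Ψ : Set H.root} {A : H.root → H.root → ℂ}

lemma height_negRoot (b : (rootSystem H).Base) (α : H.root) :
    b.height (negRoot α) = -b.height α := by
  rw [← reflectionPerm_self_eq]
  exact b.height_reflectionPerm_self α

/-- Independence of the decomposition of a positive root. -/
lemma IsSignCocycle.decomposition_indep (hA : IsSignCocycle Ψ A) (hneg : ∀ α ∈ Ψ, negRoot α ∈ Ψ)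
    (hΨ : IsAddClosed Ψ) (hlen : ∀ α ∈ Ψ, ∀ β ∈ Ψ, len α = len β) (b : (rootSystem H).Base)
    (t : H.root → ℂ) {k : H.root} (hkΨ : k ∈ Ψ)
    (ht : ∀ i ∈ Ψ, ∀ j ∈ Ψ, ∀ l ∈ Ψ, 0 < b.height i → 0 < b.height j →
      b.height l < b.height k →
      (rootSystem H).root l = (rootSystem H).root i + (rootSystem H).root j →
      t l = A i j * t i * t j)
    {i j i' j' : H.root} (hi : i ∈ Ψ) (hj : j ∈ Ψ) (hi' : i' ∈ Ψ) (hj' : j' ∈ Ψ)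
    (hpi : 0 < b.height i) (hpj : 0 < b.height j) (hpi' : 0 < b.height i')
    (hpj' : 0 < b.height j')
    (h : (rootSystem H).root k = (rootSystem H).root i + (rootSystem H).root j)
    (h' : (rootSystem H).root k = (rootSystem H).root i' + (rootSystem H).root j') :
    A i j * t i * t j = A i' j' * t i' * t j' := by
  have sub_mem : ∀ x ∈ Ψ, ∀ y ∈ Ψ, ∀ z : H.root,
      (rootSystem H).root z = (rootSystem H).root x - (rootSystem H).root y → z ∈ Ψ :=
    fun x hx y hy z hz => hΨ x hx _ (hneg y hy) z (by rw [hz, root_negRoot, sub_eq_add_neg])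
  -- With equal lengths, a sum that is again of this length makes an angle of 60 degrees with each
  -- summand.
  have hki : ∀ {x y : H.root}, x ∈ Ψ → y ∈ Ψ →
      (rootSystem H).root k = (rootSystem H).root x + (rootSystem H).root y → pr k x = 1 := by
    intro x y hx hy hk
    have e1 := pr_add hk x
    have e2 := pr_add hk y
    have e3 := pr_add hk k
    have e4 := pr_comm (hlen y hy x hx)
    have e5 := pr_comm (hlen x hx k hkΨ)
    have e6 := pr_comm (hlen y hy k hkΨ)
    rw [pr_self] at e1 e2 e3
    omega
  -- the case of a positive difference
  have main : ∀ {i j i' j' : H.root}, i ∈ Ψ → j ∈ Ψ → i' ∈ Ψ → j' ∈ Ψ →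
      0 < b.height i → 0 < b.height j → 0 < b.height i' → 0 < b.height j' →
      (rootSystem H).root k = (rootSystem H).root i + (rootSystem H).root j →
      (rootSystem H).root k = (rootSystem H).root i' + (rootSystem H).root j' →
      pr i' j = 0 → ∀ c ∈ Ψ,
      (rootSystem H).root c = (rootSystem H).root i - (rootSystem H).root i' →
      0 < b.height c → A i j * t i * t j = A i' j' * t i' * t j' := by
    intro i j i' j' hi hj hi' hj' hpi hpj hpi' hpj' h h' hp c hc hci hpc
    have e1 : (rootSystem H).root i = (rootSystem H).root i' + (rootSystem H).root c := by
      rw [hci]; abel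
    have e2 : (rootSystem H).root j' = (rootSystem H).root c + (rootSystem H).root j := by
      have : (rootSystem H).root j' = (rootSystem H).root i + (rootSystem H).root j -
          (rootSystem H).root i' := by rw [← h, h']; abel
      rw [this, hci]; abel
    have f1 := ht i' hi' c hc i hi hpi' hpc (by rw [b.height_add h]; omega) e1
    have f2 := ht c hc j hj j' hj' hpc hpj (by rw [b.height_add h']; omega) e2
    -- With c = i - i' the root `k` is i' + c + j, and the two decompositions are its two
    -- bracketings.
    have f3 := hA.assoc i' hi' c hc j hj i hi j' hj' k hkΨ hp e1 e2 h
    rw [f1, f2]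
    linear_combination (t i' * t c * t j) * f3
  -- reduce to `pr i i' = 1`
  have step : ∀ {i' j' : H.root}, i' ∈ Ψ → j' ∈ Ψ → 0 < b.height i' → 0 < b.height j' →
      (rootSystem H).root k = (rootSystem H).root i' + (rootSystem H).root j' →
      pr i i' = 1 → A i j * t i * t j = A i' j' * t i' * t j' := by
    intro i' j' hi' hj' hpi' hpj' h' hp
    have hne : i ≠ i' := by rintro rfl; rw [pr_self] at hp; omega
    obtain ⟨c, hc⟩ := exists_sub_of_pr_pos (by omega : 0 < pr i i') hne
    have hcΨ := sub_mem i hi i' hi' c hc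
    have e1 := hki hi' hj' h'
    have e2 := pr_add h i'
    have e3 := hki hi hj h
    have e4 := pr_add h' i
    have h0 : pr j i' = 0 := by omega
    have h0' : pr j' i = 0 := by
      rw [pr_comm (hlen i hi i' hi')] at hp
      omega
    rcases lt_trichotomy (b.height c) 0 with hh | hh | hh
    · refine (main hi' hj' hi hj hpi' hpj' hpi hpj h' h ?_ (negRoot c) (hneg c hcΨ) ?_ ?_).symm
      · rw [pr_comm (hlen i hi j' hj'), h0']
      · rw [root_negRoot, hc, neg_sub]
      · rw [height_negRoot]; omega
    · exact absurd hh (b.height_ne_zero c)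
    · refine main hi hj hi' hj' hpi hpj hpi' hpj' h h' ?_ c hcΨ hc hh
      rw [pr_comm (hlen i' hi' j hj), h0]
  have hswap : A j' i' = A i' j' := hA.symm i' hi' j' hj' k hkΨ h'
  by_cases c1 : i = i'
  · subst c1
    have : j = j' := by
      apply root_injective
      rw [h] at h'
      exact add_left_cancel h'
    rw [this]
  by_cases c2 : i = j'
  · subst c2
    have : j = i' := by
      apply root_injective
      rw [h, add_comm] at h'
      exact add_right_cancel h'
    rw [this, ← hswap]
    ring
  have e1 := hki hi hj h
  have e2 := pr_add h' i
  rw [pr_comm (hlen i' hi' i hi), pr_comm (hlen j' hj' i hi)] at e2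
  have hn1 : i ≠ negRoot i' := by
    rintro rfl; rw [height_negRoot] at hpi; omega
  have hn2 : i ≠ negRoot j' := by
    rintro rfl; rw [height_negRoot] at hpi; omega
  have d1 := pr_cases (hlen i hi i' hi') c1 hn1
  have d2 := pr_cases (hlen i hi j' hj') c2 hn2
  -- The two integers lie between -1 and 1 and add up to `pr k i = 1`.
  rcases (by omega : pr i i' = 1 ∨ pr i j' = 1) with d | d
  · exact step hi' hj' hpi' hpj' h' d
  · rw [step hj' hi' hpj' hpi' (by rw [h', add_comm]) d, hswap]
    ring

/-- A cocycle of signs is a coboundary. -/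
lemma IsSignCocycle.exists_trivialization (hA : IsSignCocycle Ψ A)
    (hneg : ∀ α ∈ Ψ, negRoot α ∈ Ψ) (hΨ : IsAddClosed Ψ)
    (hlen : ∀ α ∈ Ψ, ∀ β ∈ Ψ, len α = len β) :
    ∃ t : H.root → ℂ, (∀ i ∈ Ψ, t i ^ 2 = 1) ∧ (∀ i, t (negRoot i) = -t i) ∧
      ∀ i ∈ Ψ, ∀ j ∈ Ψ, ∀ k : H.root,
        (rootSystem H).root k = (rootSystem H).root i + (rootSystem H).root j →
        t k = A i j * t i * t j := by
  classical
  obtain ⟨b⟩ := RootPairing.nonempty_base (rootSystem H)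
  have pos : ∀ n : ℕ, ∃ t : H.root → ℂ, (∀ i ∈ Ψ, t i ^ 2 = 1) ∧
      ∀ i ∈ Ψ, ∀ j ∈ Ψ, ∀ k ∈ Ψ, 0 < b.height i → 0 < b.height j → b.height k ≤ n →
        (rootSystem H).root k = (rootSystem H).root i + (rootSystem H).root j →
        t k = A i j * t i * t j := by
    intro n
    induction n with
    | zero =>
      refine ⟨fun _ => 1, fun _ _ => one_pow 2, fun i hi j hj k hk hpi hpj hkn h => ?_⟩
      have := b.height_add h
      push_cast at hkn
      omega
    | succ n ih =>
      obtain ⟨t, ht1, ht2⟩ := ih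
      let D : H.root → Prop := fun k => ∃ x : H.root × H.root, x.1 ∈ Ψ ∧ x.2 ∈ Ψ ∧
        0 < b.height x.1 ∧ 0 < b.height x.2 ∧
        (rootSystem H).root k = (rootSystem H).root x.1 + (rootSystem H).root x.2
      -- At height n + 1 one decomposition is chosen, and `decomposition_indep` makes the choice
      -- immaterial. Indecomposable roots keep their old value, which is a sign.
      let t' : H.root → ℂ := fun k =>
        if h : b.height k = n + 1 ∧ k ∈ Ψ ∧ D k then
          A h.2.2.choose.1 h.2.2.choose.2 * t h.2.2.choose.1 * t h.2.2.choose.2 else t k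
      have hlow : ∀ k, b.height k ≤ n → t' k = t k := fun k hk => dif_neg (by omega)
      refine ⟨t', fun i hi => ?_, fun i hi j hj k hk hpi hpj hkn h => ?_⟩
      · by_cases h : b.height i = n + 1 ∧ i ∈ Ψ ∧ D i
        · have h1 : t' i = _ := dif_pos h
          obtain ⟨g1, g2, g3, g4, g5⟩ := h.2.2.choose_spec
          rw [h1, mul_pow, mul_pow, ht1 _ g1, ht1 _ g2, hA.sq _ g1 _ g2 _ hi g5]
          norm_num
        · have h1 : t' i = t i := dif_neg h
          rw [h1, ht1 i hi]
      · have hk' := b.height_add h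
        rw [hlow i (by push_cast at hkn; omega), hlow j (by push_cast at hkn; omega)]
        by_cases hkn' : b.height k ≤ n
        · rw [hlow k hkn', ht2 i hi j hj k hk hpi hpj hkn' h]
        · have hD : b.height k = n + 1 ∧ k ∈ Ψ ∧ D k :=
            ⟨by push_cast at hkn; omega, hk, ⟨(i, j), hi, hj, hpi, hpj, h⟩⟩
          have h1 : t' k = _ := dif_pos hD
          obtain ⟨g1, g2, g3, g4, g5⟩ := hD.2.2.choose_spec
          rw [h1]
          exact hA.decomposition_indep hneg hΨ hlen b t hk
            (fun i hi j hj l hl hpi hpj hlt hl' =>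
              ht2 i hi j hj l hl hpi hpj (by omega) hl') g1 g2 hi hj g3 g4 hpi hpj g5 h
  obtain ⟨N, hN⟩ : ∃ N : ℕ, ∀ k : H.root, b.height k ≤ N := by
    refine ⟨(∑ k : H.root, |b.height k|).toNat, fun k => ?_⟩
    have h1 : |b.height k| ≤ ∑ k : H.root, |b.height k| :=
      Finset.single_le_sum (f := fun k => |b.height k|) (fun _ _ => abs_nonneg _)
        (Finset.mem_univ k)
    have h2 := le_abs_self (b.height k)
    omega
  obtain ⟨s, hs1, hs2⟩ := pos N
  -- The extension to negative roots is odd because the cocycle changes sign under negation of both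
  -- arguments.
  let t : H.root → ℂ := fun k => if 0 < b.height k then s k else -s (negRoot k)
  have tp : ∀ k, 0 < b.height k → t k = s k := fun k hk => if_pos hk
  have hn0 : ∀ k, b.height k ≠ 0 := fun k => b.height_ne_zero k
  have tneg : ∀ k, t (negRoot k) = -t k := by
    intro k
    have h1 := height_negRoot b k
    by_cases hk : 0 < b.height k
    · have h2 : t (negRoot k) = _ := if_neg (by omega)
      rw [h2, tp k hk, negRoot_negRoot]
    · have h2 : t k = _ := if_neg hk
      rw [h2, tp (negRoot k) (by have := hn0 k; omega), neg_neg]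
  have tsq : ∀ k ∈ Ψ, t k ^ 2 = 1 := by
    intro k hk
    by_cases h : 0 < b.height k
    · rw [tp k h, hs1 k hk]
    · have h2 : t k = _ := if_neg h
      rw [h2, neg_sq, hs1 _ (hneg k hk)]
  have tpos : ∀ i ∈ Ψ, ∀ j ∈ Ψ, ∀ k ∈ Ψ, 0 < b.height i → 0 < b.height j →
      (rootSystem H).root k = (rootSystem H).root i + (rootSystem H).root j →
      t k = A i j * t i * t j := by
    intro i hi j hj k hk hpi hpj h
    have := b.height_add h
    rw [tp i hpi, tp j hpj, tp k (by omega)]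
    exact hs2 i hi j hj k hk hpi hpj (hN k) h
  -- one positive and one negative summand
  have tmix : ∀ i ∈ Ψ, ∀ j ∈ Ψ, ∀ k ∈ Ψ, 0 < b.height i → b.height j < 0 →
      (rootSystem H).root k = (rootSystem H).root i + (rootSystem H).root j →
      t k = A i j * t i * t j := by
    intro i hi j hj k hk hpi hpj h
    have hnj := height_negRoot b j
    have hnk := height_negRoot b k
    -- The roots i, j, -k have sum zero. Cyclic invariance turns the mixed relation into a positive
    -- decomposition of `i` or of -j, according to the sign of `k`.
    have hc1 : A j (negRoot k) = A i j := hA.cyclic i hi j hj (negRoot k) (hneg k hk) (by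
      rw [root_negRoot, h]; abel)
    have hc2 : A (negRoot k) i = A j (negRoot k) := hA.cyclic j hj (negRoot k) (hneg k hk) i hi (by
      rw [root_negRoot, h]; abel)
    have sq1 := hA.sq i hi j hj k hk h
    by_cases hpk : 0 < b.height k
    · have e1 : (rootSystem H).root i = (rootSystem H).root k + (rootSystem H).root (negRoot j) := by
        rw [root_negRoot, h]; abel
      have e2 := tpos k hk (negRoot j) (hneg j hj) i hi hpk (by omega) e1
      have e3 := hA.neg k hk (negRoot j) (hneg j hj) i hi e1
      rw [negRoot_negRoot] at e3
      have e4 : A (negRoot k) j = A j (negRoot k) := hA.symm j hj (negRoot k) (hneg k hk)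
        (negRoot i) (hneg i hi) (by rw [root_negRoot, root_negRoot, h]; abel)
      rw [tneg, show A k (negRoot j) = -A i j by rw [← hc1, ← e4, e3, neg_neg]] at e2
      have e6 := tsq j hj
      rw [e2]
      linear_combination (-t k) * sq1 - (t k * A i j ^ 2) * e6
    · have hpk' : 0 < b.height (negRoot k) := by have := hn0 k; omega
      have e1 : (rootSystem H).root (negRoot j) =
          (rootSystem H).root i + (rootSystem H).root (negRoot k) := by
        rw [root_negRoot, root_negRoot, h]; abel
      have e2 := tpos i hi (negRoot k) (hneg k hk) (negRoot j) (hneg j hj) hpi hpk' e1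
      have e4 : A (negRoot k) i = A i (negRoot k) := hA.symm i hi (negRoot k) (hneg k hk)
        (negRoot j) (hneg j hj) e1
      rw [tneg, tneg, ← e4, hc2, hc1] at e2
      have e5 : t j = A i j * t i * t k := by linear_combination -e2
      have e6 := tsq i hi
      rw [e5]
      linear_combination (-t k) * sq1 - (t k * A i j ^ 2) * e6
  refine ⟨t, tsq, tneg, fun i hi j hj k h => ?_⟩
  have hk := hΨ i hi j hj k h
  have hni := height_negRoot b i
  have hnj := height_negRoot b j
  have hsym := hA.symm i hi j hj k hk h
  rcases (hn0 i).lt_or_gt with hpi | hpi <;> rcases (hn0 j).lt_or_gt with hpj | hpj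
  · have e1 := tpos (negRoot i) (hneg i hi) (negRoot j) (hneg j hj) (negRoot k) (hneg k hk)
      (by omega) (by omega) (RootVectors.root_neg_add h)
    rw [tneg, tneg, tneg, hA.neg i hi j hj k hk h] at e1
    linear_combination -e1
  · rw [tmix j hj i hi k hk hpj hpi (h.trans (add_comm _ _)), hsym]
    ring
  · exact tmix i hi j hj k hk hpi hpj h
  · exact tpos i hi j hj k hk hpi hpj h

end Signs

/-! ### Triviality of the stabilizer action on root spaces: roots of equal length -/

section EqualLength

/-- The sign `(-1) ^ n`. -/
def sgn (n : ℤ) : ℂ := (-1) ^ n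

lemma sgn_add (m n : ℤ) : sgn (m + n) = sgn m * sgn n :=
  zpow_add₀ (neg_ne_zero.mpr one_ne_zero) m n

lemma sgn_neg_one : sgn (-1) = -1 := by simp [sgn]

lemma sgn_of_even {n : ℤ} (h : Even n) : sgn n = 1 := h.neg_one_zpow

lemma sgn_sq (n : ℤ) : sgn n ^ 2 = 1 := by
  rw [sq, ← sgn_add]; exact sgn_of_even ⟨n, rfl⟩

lemma sgn_neg (n : ℤ) : sgn (-n) = sgn n := by
  have h1 : sgn (-n) * sgn n = 1 := by rw [← sgn_add, neg_add_cancel]; exact sgn_of_even ⟨0, rfl⟩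
  have h2 := sgn_sq n
  have h3 : sgn n ≠ 0 := right_ne_zero_of_mul_eq_one h1
  exact mul_right_cancel₀ h3 (by rw [h1, ← sq, h2])

lemma sgn_sum {ι : Type*} (s : Finset ι) (f : ι → ℤ) : sgn (∑ i ∈ s, f i) = ∏ i ∈ s, sgn (f i) := by
  classical
  induction s using Finset.induction_on with
  | empty => simp [sgn]
  | insert a s ha ih => rw [Finset.sum_insert ha, Finset.prod_insert ha, sgn_add, ih]

lemma pr_eq_neg_one_of_add {α β γ : H.root} (h1 : len α = len β) (h2 : len α = len γ)
    (h : (rootSystem H).root γ = (rootSystem H).root α + (rootSystem H).root β) :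
    pr α β = -1 := by
  have e1 := pr_add h α
  have e2 := pr_add h β
  have e3 := pr_add h γ
  have e4 := pr_comm h1
  have e5 := pr_comm h2
  have e6 := pr_comm (h1.symm.trans h2)
  rw [pr_self] at e1 e2 e3
  omega

/-- As β - α is not a root, the Jacobi identity reduces ad e_{-α} ad e_α on e_β to -β(t_α) = len α /
2. -/
lemma RootVectors.IsAdapted.structConst_sq {E : RootVectors H} {ω : L ≃ₗ⁅ℂ⁆ L}
    (hE : E.IsAdapted ω) {α β γ : H.root} (h1 : len α = len β) (h2 : len α = len γ)
    (h : (rootSystem H).root γ = (rootSystem H).root α + (rootSystem H).root β)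
    (hsub : (rootSystem H).root (negRoot α) + (rootSystem H).root β ∉
      Set.range (rootSystem H).root) : E.structConst α β ^ 2 = len α / 2 := by
  have hne : (rootSystem H).root (negRoot α) + (rootSystem H).root β ≠ 0 := by
    intro h0
    rw [root_negRoot, neg_add_eq_zero] at h0
    have h3 := root_injective h0
    subst h3
    have h4 := pr_eq_neg_one_of_add h1 h2 h
    rw [pr_self] at h4
    omega
  have h3 := E.lie_lie_e h
  rw [leibniz_lie, lie_eq_zero_of_add_notMem hsub hne (E.e_mem _) (E.e_mem _), lie_zero, add_zero,
    ← lie_skew (E.e (negRoot α)), E.lie_e_neg, neg_lie, lie_coe_rsp (E.e_mem β), hE.structConst_neg h, ← neg_smul,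
    root_rootH] at h3
  have h4 := smul_left_injective ℂ (E.e_ne_zero β) h3
  have h5 : (rootSystem H).pairingIn ℤ β α = -1 := by
    have := pr_eq_neg_one_of_add h1 h2 h
    rwa [pr_comm h1] at this
  simp only [h5] at h4
  push_cast at h4
  linear_combination -h4

/-- The action of a lift on the Cartan subalgebra. -/
def IsLift.restrict {τ : L ≃ₗ⁅ℂ⁆ L} {π : Equiv.Perm H.root} (h : IsLift τ π) : H →ₗ[ℂ] H :=
  LinearMap.codRestrict H.toSubmodule (τ.toLinearEquiv.toLinearMap.comp H.toSubmodule.subtype)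
    (fun z => by
      change τ (z : L) ∈ H
      have h2 : (z : L) = ∑ α : H.root, (rootSystem H).root α z • (rootH α : L) := by
        conv_lhs => rw [eq_sum_rootH z]
        simp
      rw [h2, map_sum]
      refine sum_mem fun α _ => ?_
      rw [map_smul, h.map_rootH]
      exact H.smul_mem _ (rootH (π α)).2)

lemma IsLift.coe_restrict {τ : L ≃ₗ⁅ℂ⁆ L} {π : Equiv.Perm H.root} (h : IsLift τ π) (z : H) :
    (h.restrict z : L) = τ (z : L) := rfl

lemma IsLift.restrict_rootH {τ : L ≃ₗ⁅ℂ⁆ L} {π : Equiv.Perm H.root} (h : IsLift τ π)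
    (α : H.root) : h.restrict (rootH α) = rootH (π α) := Subtype.ext (h.map_rootH α)

/-- The lattice generated by a set of roots. -/
abbrev rootLattice (Ψ : Set H.root) : Submodule ℤ H := Submodule.span ℤ (rootH '' Ψ)

lemma finite_rootLattice (Ψ : Set H.root) : Module.Finite ℤ (rootLattice Ψ) :=
  Module.Finite.span_of_finite ℤ (Set.toFinite _)

lemma free_rootLattice (Ψ : Set H.root) : Module.Free ℤ (rootLattice Ψ) := by
  have := finite_rootLattice Ψ
  have : Module.IsTorsionFree ℤ H := Module.IsTorsionFree.trans_faithfulSMul ℤ ℂ H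
  exact Module.free_of_finite_type_torsion_free'

/-- The Killing form on the lattice generated by `Ψ`, rescaled by `2 / ℓ`. -/
def latticeForm (Ψ : Set H.root) (l : ℂ) : rootLattice Ψ →ₗ[ℤ] rootLattice Ψ →ₗ[ℤ] ℂ :=
  LinearMap.mk₂ ℤ (fun x y => 2 / l * killingForm ℂ L ((x : H) : L) ((y : H) : L))
    (fun x y z => by
      simp only [Submodule.coe_add, coe_add_sub, map_add, LinearMap.add_apply, mul_add])
    (fun n x y => by
      rw [Submodule.coe_smul, show (((n • (x : H) : H)) : L) = n • ((x : H) : L) from rfl, map_zsmul,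
        LinearMap.smul_apply, mul_smul_comm])
    (fun x y z => by
      simp only [Submodule.coe_add, coe_add_sub, map_add, mul_add])
    (fun n x y => by
      rw [Submodule.coe_smul, show (((n • (y : H) : H)) : L) = n • ((y : H) : L) from rfl, map_zsmul,
        mul_smul_comm])

lemma latticeForm_apply (Ψ : Set H.root) (l : ℂ) (x y : rootLattice Ψ) :
    latticeForm Ψ l x y = 2 / l * killingForm ℂ L ((x : H) : L) ((y : H) : L) := rfl

lemma latticeForm_rootH {Ψ : Set H.root} {l : ℂ} {α β : H.root} (hβ : len β = l)
    {x y : rootLattice Ψ} (hx : (x : H) = rootH α) (hy : (y : H) = rootH β) :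
    latticeForm Ψ l x y = pr α β := by
  have h1 := len_ne_zero β
  rw [latticeForm_apply, hx, hy, killingForm_rootH, root_rootH, ← hβ, pr]
  field_simp

lemma exists_latticeForm_eq {Ψ : Set H.root} {l : ℂ} (hl : ∀ α ∈ Ψ, len α = l)
    (x y : rootLattice Ψ) : ∃ n : ℤ, latticeForm Ψ l x y = n := by
  obtain ⟨x, hx⟩ := x
  obtain ⟨y, hy⟩ := y
  induction hx using Submodule.span_induction with
  | mem x hx =>
    obtain ⟨α, hα, rfl⟩ := hx
    induction hy using Submodule.span_induction with
    | mem y hy =>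
      obtain ⟨β, hβ, rfl⟩ := hy
      exact ⟨pr α β, latticeForm_rootH (hl β hβ) rfl rfl⟩
    | zero => exact ⟨0, by rw [latticeForm_apply]; simp⟩
    | add x y hx hy ihx ihy =>
      obtain ⟨m, hm⟩ := ihx
      obtain ⟨n, hn⟩ := ihy
      refine ⟨m + n, ?_⟩
      push_cast
      rw [← hm, ← hn, ← map_add]
      rfl
    | smul a x hx ih =>
      obtain ⟨m, hm⟩ := ih
      refine ⟨a * m, ?_⟩
      push_cast
      rw [← hm, ← zsmul_eq_mul, ← map_smul]
      rfl
  | zero => exact ⟨0, by rw [latticeForm_apply]; simp⟩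
  | add x y hx hy ihx ihy =>
    obtain ⟨m, hm⟩ := ihx
    obtain ⟨n, hn⟩ := ihy
    refine ⟨m + n, ?_⟩
    push_cast
    rw [← hm, ← hn, ← LinearMap.add_apply, ← map_add]
    rfl
  | smul a x hx ih =>
    obtain ⟨m, hm⟩ := ih
    refine ⟨a * m, ?_⟩
    push_cast
    rw [← hm, ← zsmul_eq_mul, ← LinearMap.smul_apply, ← map_smul]
    rfl

lemma latticeForm_comm {Ψ : Set H.root} {l : ℂ} (x y : rootLattice Ψ) :
    latticeForm Ψ l x y = latticeForm Ψ l y x := by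
  rw [latticeForm_apply, latticeForm_apply, killingForm_comm]

lemma exists_latticeForm_self_eq {Ψ : Set H.root} {l : ℂ} (hl : ∀ α ∈ Ψ, len α = l)
    (x : rootLattice Ψ) : ∃ n : ℤ, latticeForm Ψ l x x = 2 * n := by
  obtain ⟨x, hx⟩ := x
  induction hx using Submodule.span_induction with
  | mem x hx =>
    obtain ⟨α, hα, rfl⟩ := hx
    refine ⟨1, ?_⟩
    rw [latticeForm_rootH (hl α hα) rfl rfl, pr_self]
    norm_num
  | zero => exact ⟨0, by rw [latticeForm_apply]; simp⟩
  | add x y hx hy ihx ihy =>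
    obtain ⟨m, hm⟩ := ihx
    obtain ⟨n, hn⟩ := ihy
    obtain ⟨p, hp⟩ := exists_latticeForm_eq hl ⟨x, hx⟩ ⟨y, hy⟩
    refine ⟨m + n + p, ?_⟩
    have h1 : (⟨x + y, Submodule.add_mem _ hx hy⟩ : rootLattice Ψ) = ⟨x, hx⟩ + ⟨y, hy⟩ := rfl
    simp only [h1, map_add, LinearMap.add_apply]
    rw [hm, hn, latticeForm_comm ⟨y, hy⟩ ⟨x, hx⟩, hp]
    push_cast; ring
  | smul a x hx ih =>
    obtain ⟨m, hm⟩ := ih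
    refine ⟨a * a * m, ?_⟩
    have h1 : (⟨a • x, Submodule.smul_mem _ a hx⟩ : rootLattice Ψ) = a • ⟨x, hx⟩ := rfl
    simp only [h1, map_smul, LinearMap.smul_apply]
    rw [hm, zsmul_eq_mul, zsmul_eq_mul]
    push_cast; ring

/-- If `π` has no nonzero fixed vectors on the orbit, the coefficient of the stabilizer is one:
the case of a closed set of roots of equal length. -/
theorem IsLift.prod_liftCoeff_eq_one_of_len_eq {τ : L ≃ₗ⁅ℂ⁆ L} {π : Equiv.Perm H.root}
    (h : IsLift τ π) {E : RootVectors H} {ω : L ≃ₗ⁅ℂ⁆ L} (hE : E.IsAdapted ω) {Ψ : Set H.root}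
    (hneg : ∀ α ∈ Ψ, negRoot α ∈ Ψ) (hΨ : IsAddClosed Ψ)
    (hlen : ∀ α ∈ Ψ, ∀ β ∈ Ψ, len α = len β) (hπ : ∀ α ∈ Ψ, π α ∈ Ψ)
    {α : H.root} (hα : α ∈ Ψ) {d : ℕ} (hd : (π ^ d) α = α)
    (hsum : ∑ k ∈ Finset.range d, rootH ((π ^ k) α) = 0) :
    ∏ k ∈ Finset.range d, E.liftCoeff τ π ((π ^ k) α) = 1 := by
  classical
  have hl : ∀ β ∈ Ψ, len β = len α := fun β hβ => hlen β hβ α hα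
  have := finite_rootLattice Ψ
  have := free_rootLattice Ψ
  -- The rescaled Killing form is even on the lattice, so it is the symmetrization of an integral
  -- form. The signs (-1)^β model the structure constants.
  obtain ⟨β, hβ⟩ := exists_bilin_add_flip (latticeForm Ψ (len α)) latticeForm_comm
    (exists_latticeForm_eq hl) (exists_latticeForm_self_eq hl)
  -- the lattice vector of a root
  let r : H.root → rootLattice Ψ := fun i =>
    if hi : i ∈ Ψ then ⟨rootH i, Submodule.subset_span ⟨i, hi, rfl⟩⟩ else 0
  have hr : ∀ i ∈ Ψ, ((r i : rootLattice Ψ) : H) = rootH i := fun i hi => by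
    simp only [r, dif_pos hi]
  have radd : ∀ i ∈ Ψ, ∀ j ∈ Ψ, ∀ k ∈ Ψ,
      (rootSystem H).root k = (rootSystem H).root i + (rootSystem H).root j → r k = r i + r j :=
    fun i hi j hj k hk hijk => by
      apply Subtype.ext
      rw [Submodule.coe_add, hr i hi, hr j hj, hr k hk, rootH_eq_add_iff.mpr hijk]
  have rneg : ∀ i ∈ Ψ, r (negRoot i) = -r i := fun i hi => by
    apply Subtype.ext
    rw [Submodule.coe_neg, hr i hi, hr _ (hneg i hi), rootH_negRoot]
  have hβself : ∀ i ∈ Ψ, β (r i) (r i) = 1 := fun i hi => by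
    have h1 := hβ (r i) (r i)
    rw [latticeForm_rootH (hl i hi) (hr i hi) (hr i hi), pr_self] at h1
    have h2 : β (r i) (r i) + β (r i) (r i) = 2 := by exact_mod_cast h1
    omega
  have hβadd : ∀ i ∈ Ψ, ∀ j ∈ Ψ, ∀ k ∈ Ψ,
      (rootSystem H).root k = (rootSystem H).root i + (rootSystem H).root j →
      β (r j) (r i) = -1 - β (r i) (r j) := fun i hi j hj k hk hijk => by
    have h1 := hβ (r i) (r j)
    rw [latticeForm_rootH (hl j hj) (hr i hi) (hr j hj),
      pr_eq_neg_one_of_add (hlen i hi j hj) (hlen i hi k hk) hijk] at h1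
    have h2 : β (r i) (r j) + β (r j) (r i) = -1 := by exact_mod_cast h1
    omega
  obtain ⟨lam, hlam⟩ := IsAlgClosed.exists_pow_nat_eq (len α / 2) (n := 2) (by norm_num)
  have hlam0 : lam ≠ 0 := by
    rintro rfl
    have := len_ne_zero α
    rw [zero_pow two_ne_zero] at hlam
    exact div_ne_zero this two_ne_zero hlam.symm
  have hNsq : ∀ i ∈ Ψ, ∀ j ∈ Ψ, ∀ k ∈ Ψ,
      (rootSystem H).root k = (rootSystem H).root i + (rootSystem H).root j →
      E.structConst i j ^ 2 = lam ^ 2 := fun i hi j hj k hk hijk => by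
    rw [hE.structConst_sq (hlen i hi j hj) (hlen i hi k hk) hijk, hlam, hl i hi]
    rintro ⟨l, hl'⟩
    have hlΨ := hΨ _ (hneg i hi) j hj l hl'
    have h1 := pr_eq_neg_one_of_add (hlen i hi j hj) (hlen i hi k hk) hijk
    have h2 := pr_eq_neg_one_of_add (hlen _ (hneg i hi) j hj) (hlen _ (hneg i hi) l hlΨ) hl'
    rw [pr_negRoot] at h2
    omega
  -- Both factors are antisymmetric on pairs whose sum is a root, so their product is symmetric;
  -- `lam` normalizes the structure constants to square one. `A` measures the discrepancy between
  -- them and (-1)^β and will be trivialized.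
  let A : H.root → H.root → ℂ := fun i j => sgn (β (r i) (r j)) * (E.structConst i j / lam)
  have hA : IsSignCocycle Ψ A := by
    constructor
    · intro i hi j hj k hk hijk
      change (_ * _) ^ 2 = _
      rw [mul_pow, sgn_sq, div_pow, hNsq i hi j hj k hk hijk, one_mul,
        div_self (pow_ne_zero 2 hlam0)]
    · intro i hi j hj k hk hijk
      change sgn _ * _ = sgn _ * _
      rw [hβadd i hi j hj k hk hijk, E.structConst_swap hijk, sub_eq_add_neg, sgn_add, sgn_neg_one,
        sgn_neg]
      ring
    · intro i hi j hj k hk hijk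
      change sgn _ * _ = sgn _ * _
      have hk' : (rootSystem H).root (negRoot k) =
          (rootSystem H).root i + (rootSystem H).root j := by
        rw [root_negRoot, neg_eq_iff_add_eq_zero, ← hijk]; abel
      have h1 : r k = -(r i + r j) := by
        rw [← radd i hi j hj _ (hneg k hk) hk', rneg k hk, neg_neg]
      rw [E.structConst_cyclic hijk, h1, map_neg, map_add, hβadd i hi j hj _ (hneg k hk) hk',
        hβself j hj]
      congr 2
      ring
    · intro i hi j hj k hk hijk
      change sgn _ * _ = -(sgn _ * _)
      rw [hE.structConst_neg hijk, rneg i hi, rneg j hj, map_neg, map_neg, LinearMap.neg_apply,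
        neg_neg]
      ring
    · intro i hi j hj k hk p hp q hq s hs hik hp' hq' hs'
      have hs'' : (rootSystem H).root s = (rootSystem H).root i + (rootSystem H).root q := by
        rw [hs', hp', hq', add_assoc]
      have h0 : ⁅E.e i, E.e k⁆ = 0 := by
        apply lie_eq_zero_of_add_notMem _ _ (E.e_mem i) (E.e_mem k)
        · rintro ⟨l, hl'⟩
          have := pr_eq_neg_one_of_add (hlen i hi k hk) (hlen i hi l (hΨ i hi k hk l hl')) hl'
          omega
        · intro h0
          have : i = negRoot k := eq_negRoot (eq_neg_of_add_eq_zero_left h0)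
          rw [this, pr_negRoot, pr_self] at hik
          omega
      have h1 : E.structConst i j * E.structConst p k = E.structConst j k * E.structConst i q := by
        have h2 : ⁅⁅E.e i, E.e j⁆, E.e k⁆ = ⁅E.e i, ⁅E.e j, E.e k⁆⁆ := by
          rw [leibniz_lie (E.e i), h0, lie_zero, add_zero]
        rw [E.lie_e_e hp', E.lie_e_e hq', smul_lie, lie_smul, E.lie_e_e hs', E.lie_e_e hs'',
          smul_smul, smul_smul] at h2
        exact smul_left_injective ℂ (E.e_ne_zero s) h2
      have h3 : sgn (β (r p) (r k)) * sgn (β (r i) (r j)) =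
          sgn (β (r i) (r q)) * sgn (β (r j) (r k)) := by
        rw [← sgn_add, ← sgn_add, radd i hi j hj p hp hp', radd j hj k hk q hq hq']
        congr 1
        simp only [map_add, LinearMap.add_apply]
        ring
      change sgn _ * _ * (sgn _ * _) = sgn _ * _ * (sgn _ * _)
      have h4 : sgn (β (r p) (r k)) * sgn (β (r i) (r j)) *
          (E.structConst i j * E.structConst p k) = sgn (β (r i) (r q)) * sgn (β (r j) (r k)) *
          (E.structConst j k * E.structConst i q) := by rw [h1, h3]
      field_simp
      linear_combination h4
  obtain ⟨t, ht1, ht2, ht3⟩ := hA.exists_trivialization hneg hΨ hlen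
  -- the action on the lattice
  let S : rootLattice Ψ →ₗ[ℤ] rootLattice Ψ := (h.restrict.restrictScalars ℤ).restrict (by
    intro x hx
    have h1 : rootLattice Ψ ≤ (rootLattice Ψ).comap (h.restrict.restrictScalars ℤ) := by
      rw [Submodule.span_le]
      rintro - ⟨i, hi, rfl⟩
      exact Submodule.subset_span ⟨π i, hπ i hi, (h.restrict_rootH i).symm⟩
    exact h1 hx)
  have hS : ∀ i ∈ Ψ, S (r i) = r (π i) := fun i hi => by
    apply Subtype.ext
    rw [hr _ (hπ i hi), ← h.restrict_rootH, ← hr i hi]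
    rfl
  have hFS : ∀ x y, latticeForm Ψ (len α) (S x) (S y) = latticeForm Ψ (len α) x y := fun x y => by
    rw [latticeForm_apply, latticeForm_apply]
    congr 1
    exact killingForm_of_equiv_apply τ _ _
  -- `S` preserves the lattice form and β(x,x) is half of it, so β minus its transform by `S` is
  -- alternating.
  obtain ⟨γ, hγ⟩ := exists_bilin_sub_flip (β - (β.compl₁₂ S S)) (fun x => by
    change β x x - β (S x) (S x) = 0
    have h1 := hβ x x
    have h2 := hβ (S x) (S x)
    rw [hFS, ← h1] at h2
    have h3 : β (S x) (S x) + β (S x) (S x) = β x x + β x x := by exact_mod_cast h2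
    omega)
  replace hγ : ∀ x y, γ x y - γ y x = β x y - β (S x) (S y) := hγ
  -- The signs t trivialize `A` at a root and at its image, and (-1)^γ(i,i) absorbs the change of β
  -- under `S`. The corrected coefficient is exactly multiplicative.
  let v : H.root → ℂ := fun i => E.liftCoeff τ π i * t i * t (π i) * sgn (γ (r i) (r i))
  have hsucc : ∀ k, π ((π ^ k) α) = (π ^ (k + 1)) α := fun k => by rw [pow_succ']; rfl
  have hmem : ∀ k : ℕ, (π ^ k) α ∈ Ψ := by
    intro k
    induction k with
    | zero => exact hα
    | succ k ih => rw [← hsucc]; exact hπ _ ih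
  have hv : ∏ k ∈ Finset.range d, v ((π ^ k) α) = 1 := by
    refine prod_range_eq_one hΨ v ?_ ?_ (fun k => (π ^ k) α) hmem d ?_
    · intro i hi
      change _ * _ * _ * _ * (_ * _ * _ * _) = _
      rw [h.map_negRoot, ht2, ht2, rneg i hi, map_neg, map_neg, LinearMap.neg_apply, neg_neg]
      linear_combination (t i ^ 2 * t (π i) ^ 2 * sgn (γ (r i) (r i)) ^ 2) *
        h.liftCoeff_mul_neg E i + t (π i) ^ 2 * sgn (γ (r i) (r i)) ^ 2 * ht1 i hi +
        sgn (γ (r i) (r i)) ^ 2 * ht1 _ (hπ i hi) + sgn_sq (γ (r i) (r i))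
    · intro i hi j hj k hijk
      have hk := hΨ i hi j hj k hijk
      have h1 := h.structConst_mul_liftCoeff E hijk
      have h2 := ht3 i hi j hj k hijk
      have h3 := ht3 _ (hπ i hi) _ (hπ j hj) _ (h.root_add hijk)
      have h4 := hγ (r i) (r j)
      rw [hS i hi, hS j hj] at h4
      have h5 : sgn (γ (r k) (r k)) = sgn (γ (r i) (r i)) * sgn (γ (r j) (r j)) *
          (sgn (β (r i) (r j)) * sgn (β (r (π i)) (r (π j)))) := by
        rw [← sgn_add, ← sgn_neg (β (r (π i)) _), ← sgn_add, ← sgn_add, radd i hi j hj k hk hijk]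
        have h6 : γ (r i + r j) (r i + r j) = γ (r i) (r i) + γ (r j) (r j) +
            (β (r i) (r j) + -β (r (π i)) (r (π j))) + 2 * γ (r j) (r i) := by
          simp only [map_add, LinearMap.add_apply]
          linear_combination h4
        rw [h6, sgn_add, sgn_of_even (even_two_mul _), mul_one]
      change t k = sgn _ * _ * _ * _ at h2
      change t (π k) = sgn _ * _ * _ * _ at h3
      change E.liftCoeff τ π k * t k * t (π k) * sgn (γ (r k) (r k)) =
        (E.liftCoeff τ π i * t i * t (π i) * sgn (γ (r i) (r i))) *
        (E.liftCoeff τ π j * t j * t (π j) * sgn (γ (r j) (r j)))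
      rw [h2, h3, h5]
      have h7 := hNsq _ (hπ i hi) _ (hπ j hj) _ (hπ k hk) (h.root_add hijk)
      have h8 := sgn_sq (β (r i) (r j))
      have h9 := sgn_sq (β (r (π i)) (r (π j)))
      have h10 : E.structConst (π i) (π j) * E.structConst i j * E.liftCoeff τ π k =
          E.liftCoeff τ π i * E.liftCoeff τ π j * lam ^ 2 := by
        rw [← h7]; linear_combination E.structConst (π i) (π j) * h1
      have h11 : (E.structConst (π i) (π j) / lam) * (E.structConst i j / lam) *
          E.liftCoeff τ π k = E.liftCoeff τ π i * E.liftCoeff τ π j := by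
        field_simp
        linear_combination h10
      have e : ∀ s1 s2 n1 n2 u ti tj si sj g1 g2 w : ℂ, s1 ^ 2 = 1 → s2 ^ 2 = 1 →
          n2 * n1 * u = w →
          u * (s1 * n1 * ti * tj) * (s2 * n2 * si * sj) * (g1 * g2 * (s1 * s2)) =
            w * (ti * si * g1 * (tj * sj * g2)) := by
        intro s1 s2 n1 n2 u ti tj si sj g1 g2 w e1 e2 e3
        subst e3
        linear_combination (u * n1 * n2 * ti * tj * si * sj * g1 * g2) * (s2 ^ 2 * e1 + e2)
      rw [e _ _ _ _ _ _ _ _ _ _ _ _ h8 h9 h11]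
      ring
    · have h1 : ∀ z : H, (∑ k ∈ Finset.range d, (rootSystem H).root ((π ^ k) α)) z = 0 := by
        intro z
        rw [LinearMap.sum_apply]
        have h2 : killingForm ℂ L ((∑ k ∈ Finset.range d, rootH ((π ^ k) α) : H) : L) (z : L) = 0 := by
          rw [hsum]; simp
        rw [← h2]
        simp only [AddSubmonoidClass.coe_finsetSum, map_sum, LinearMap.sum_apply,
          killingForm_rootH]
      ext z
      exact h1 z
  -- The second product is the first one shifted along a closed orbit, so together they give a
  -- product of squares of signs.
  have ht : (∏ k ∈ Finset.range d, t ((π ^ k) α)) * ∏ k ∈ Finset.range d, t (π ((π ^ k) α)) = 1 := by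
    have h1 := Finset.prod_range_succ (fun k => t ((π ^ k) α)) d
    rw [Finset.prod_range_succ', hd, pow_zero, Equiv.Perm.one_apply] at h1
    have h2 : t α ≠ 0 := by
      intro h0
      have := ht1 α hα
      rw [h0] at this; norm_num at this
    simp only [hsucc]
    rw [mul_right_cancel₀ h2 h1, ← sq, ← Finset.prod_pow]
    exact Finset.prod_eq_one fun k _ => ht1 _ (hmem k)
  have hγ1 : ∏ k ∈ Finset.range d, sgn (γ (r ((π ^ k) α)) (r ((π ^ k) α))) = 1 := by
    rw [← sgn_sum]
    apply sgn_of_even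
    refine even_sum_of_orbit S β γ hγ (fun k => r ((π ^ k) α)) d (fun k => ?_) ?_ ?_
    · rw [hS _ (hmem k), hsucc]
    · rw [hd]; rfl
    · apply Subtype.ext
      rw [AddSubmonoidClass.coe_finsetSum, Submodule.coe_zero, ← hsum]
      exact Finset.sum_congr rfl fun k _ => hr _ (hmem k)
  change ∏ k ∈ Finset.range d, (_ * _ * _ * _) = 1 at hv
  rw [Finset.prod_mul_distrib, Finset.prod_mul_distrib, Finset.prod_mul_distrib, hγ1, mul_one,
    mul_assoc, ht, mul_one] at hv
  exact hv

end EqualLength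

/-! ### Root systems with two root lengths -/

section TwoLength

/-- The span is invariant under the Weyl group and the root system is irreducible. -/
lemma span_root_eq_top_of_reflectionPerm {s : Set H.root} (hs : s.Nonempty)
    (h : ∀ i, ∀ j ∈ s, (rootSystem H).reflectionPerm i j ∈ s) :
    Submodule.span ℂ ((rootSystem H).root '' s) = ⊤ := by
  refine RootPairing.IsIrreducible.eq_top_of_invtSubmodule_reflection (P := rootSystem H) _
    (fun i => ?_) ?_
  · rw [Module.End.mem_invtSubmodule, Submodule.span_le]
    rintro _ ⟨j, hj, rfl⟩
    refine Submodule.subset_span ⟨_, h i j hj, ?_⟩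
    rw [RootPairing.root_reflectionPerm]; rfl
  · obtain ⟨j, hj⟩ := hs
    intro h0
    refine (rootSystem H).ne_zero j ?_
    rw [← Submodule.mem_bot ℂ, ← h0]
    exact Submodule.subset_span ⟨j, hj, rfl⟩

/-- Otherwise the coroot of `i` would be killed by every functional, in particular by `i`. -/
lemma exists_pr_ne_zero_of_span {s : Set H.root}
    (h : Submodule.span ℂ ((rootSystem H).root '' s) = ⊤) (i : H.root) : ∃ j ∈ s, pr j i ≠ 0 := by
  by_contra! hc
  have h1 : Submodule.span ℂ ((rootSystem H).root '' s) ≤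
      LinearMap.ker (LinearMap.applyₗ (R := ℂ) (M₂ := ℂ) ((rootSystem H).coroot i)) := by
    rw [Submodule.span_le]
    rintro _ ⟨j, hj, rfl⟩
    have := pr_cast j i
    rw [hc j hj, Int.cast_zero] at this
    exact this.symm
  rw [h] at h1
  have h2 : (rootSystem H).root i ((rootSystem H).coroot i) = 0 :=
    h1 (Submodule.mem_top (x := (rootSystem H).root i))
  rw [← pr_cast, pr_self] at h2
  norm_num at h2

lemma pr_reflectionPerm (k i j : H.root) :
    pr ((rootSystem H).reflectionPerm k i) ((rootSystem H).reflectionPerm k j) = pr i j := by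
  have : (pr ((rootSystem H).reflectionPerm k i) ((rootSystem H).reflectionPerm k j) : ℂ) =
      pr i j := by
    rw [pr_cast, pr_cast]
    have := (rootSystem H).pairing_reflectionPerm k i ((rootSystem H).reflectionPerm k j)
    rw [RootPairing.reflectionPerm_self] at this
    exact this.symm
  exact_mod_cast this

lemma len_reflectionPerm (k i : H.root) : len ((rootSystem H).reflectionPerm k i) = len i := by
  have h : (rootSystem H).root ((rootSystem H).reflectionPerm k i) =
      (rootSystem H).root i - (pr i k : ℂ) • (rootSystem H).root k := by
    rw [RootPairing.root_reflectionPerm, RootPairing.reflection_apply, pr_cast]; rfl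
  have h' : rootH ((rootSystem H).reflectionPerm k i) = rootH i - (pr i k : ℂ) • rootH k := by
    change (cartanEquivDual H).symm ((rootSystem H).root _) = _
    rw [h, map_sub, map_smul]; rfl
  have e1 : (rootSystem H).root i (rootH k) = pr i k * (len k / 2) := root_rootH i k
  have e2 : (rootSystem H).root k (rootH i) = pr i k * (len k / 2) := by
    rw [root_rootH_comm, e1]
  rw [len, h, h']
  simp only [LinearMap.sub_apply, LinearMap.smul_apply, map_sub, map_smul, smul_eq_mul, e1, e2]
  change len i - _ - _ * (_ - _ * len k) = _
  ring

/-- A root of given length that is not orthogonal to a given root. -/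
lemma exists_len_eq_pr_ne_zero (i j : H.root) : ∃ k, len k = len j ∧ pr k i ≠ 0 :=
  exists_pr_ne_zero_of_span (s := {k | len k = len j})
    (span_root_eq_top_of_reflectionPerm ⟨j, rfl⟩ fun i k hk => (len_reflectionPerm i k).trans hk) i

/-- The integral inner product for which the roots of length `l` have squared length two. -/
def nm (l : ℂ) (i j : H.root) : ℤ :=
  letI := Classical.propDecidable
  if len j = l then pr i j else 2 * pr i j

variable {l : ℂ} (hl : ∀ i : H.root, len i = l ∨ len i = 2 * l)
include hl

lemma ne_zero_of_len (i : H.root) : l ≠ 0 := by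
  rintro rfl
  have := len_ne_zero i
  rcases hl i with h | h <;> simp [h] at this

lemma nm_cast (i j : H.root) : (nm l i j : ℂ) * (l / 2) = (rootSystem H).root i (rootH j) := by
  rw [root_rootH, nm]
  split_ifs with h
  · rw [h]; rfl
  · rw [(hl j).resolve_left h, pr]; push_cast; ring

lemma nm_inj {m : ℤ} {i j : H.root}
    (h : (m : ℂ) * (l / 2) = (rootSystem H).root i (rootH j)) : nm l i j = m := by
  rw [← nm_cast hl] at h
  exact_mod_cast (mul_right_cancel₀ (div_ne_zero (ne_zero_of_len hl i) two_ne_zero) h).symm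

lemma nm_comm (i j : H.root) : nm l i j = nm l j i :=
  nm_inj hl (by rw [nm_cast hl, root_rootH_comm])

omit hl in
lemma nm_add {i j k : H.root}
    (h : (rootSystem H).root k = (rootSystem H).root i + (rootSystem H).root j) (z : H.root) :
    nm l k z = nm l i z + nm l j z := by
  rw [nm, nm, nm, pr_add h]
  split_ifs <;> ring

omit hl in
lemma nm_neg (i z : H.root) : nm l (negRoot i) z = -nm l i z := by
  rw [nm, nm, pr_negRoot]
  split_ifs <;> ring

lemma nm_neg' (i z : H.root) : nm l i (negRoot z) = -nm l i z := by
  rw [nm_comm hl, nm_neg, nm_comm hl]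

omit hl in
lemma nm_sub {i j k : H.root}
    (h : (rootSystem H).root k = (rootSystem H).root i - (rootSystem H).root j) (z : H.root) :
    nm l k z = nm l i z - nm l j z := by
  rw [sub_eq_add_neg, ← root_negRoot] at h
  rw [nm_add h, nm_neg, sub_eq_add_neg]

lemma nm_add_self {i j k : H.root}
    (h : (rootSystem H).root k = (rootSystem H).root i + (rootSystem H).root j) :
    nm l k k = nm l i i + 2 * nm l i j + nm l j j := by
  rw [nm_add h, nm_comm hl i, nm_comm hl j, nm_add h, nm_add h, nm_comm hl j i]; ring

lemma nm_sub_self {i j k : H.root}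
    (h : (rootSystem H).root k = (rootSystem H).root i - (rootSystem H).root j) :
    nm l k k = nm l i i - 2 * nm l i j + nm l j j := by
  rw [nm_sub h, nm_comm hl i, nm_comm hl j, nm_sub h, nm_sub h, nm_comm hl j i]; ring

omit hl in
lemma nm_eq_zero_iff {i j : H.root} : nm l i j = 0 ↔ pr i j = 0 := by
  rw [nm]; split_ifs <;> omega

lemma nm_self_of_len {i : H.root} (h : len i = l) : nm l i i = 2 := by
  rw [nm, if_pos h, pr_self]

lemma nm_self_of_len' {i : H.root} (h : len i = 2 * l) : nm l i i = 4 := by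
  have := ne_zero_of_len hl i
  rw [nm, if_neg, pr_self]
  · rfl
  intro h2
  rw [h] at h2
  exact this (by linear_combination h2)

lemma len_of_nm {i : H.root} (h : nm l i i = 2) : len i = l :=
  (hl i).resolve_right fun h2 => by rw [nm_self_of_len' hl h2] at h; omega

lemma len_of_nm' {i : H.root} (h : nm l i i = 4) : len i = 2 * l :=
  (hl i).resolve_left fun h2 => by rw [nm_self_of_len hl h2] at h; omega

lemma nm_self_cases (i : H.root) : nm l i i = 2 ∨ nm l i i = 4 :=
  (hl i).imp (nm_self_of_len hl) (nm_self_of_len' hl)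

lemma exists_add_of_nm_neg {i j : H.root} (h : nm l i j < 0) (h2 : i ≠ negRoot j) :
    ∃ k : H.root, (rootSystem H).root k = (rootSystem H).root i + (rootSystem H).root j :=
  exists_add_of_pr_neg (by rw [nm] at h; split_ifs at h <;> omega) h2

lemma exists_sub_of_nm_pos {i j : H.root} (h : 0 < nm l i j) (h2 : i ≠ j) :
    ∃ k : H.root, (rootSystem H).root k = (rootSystem H).root i - (rootSystem H).root j :=
  exists_sub_of_pr_pos (by rw [nm] at h; split_ifs at h <;> omega) h2

lemma nm_short_short {i j : H.root} (hi : nm l i i = 2) (hj : nm l j j = 2) :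
    (nm l i j = 2 ∧ i = j) ∨ (nm l i j = -2 ∧ i = negRoot j) ∨ nm l i j = -1 ∨ nm l i j = 0 ∨
      nm l i j = 1 := by
  by_cases h1 : i = j
  · subst h1; exact Or.inl ⟨hi, rfl⟩
  by_cases h2 : i = negRoot j
  · subst h2; exact Or.inr (Or.inl ⟨by rw [nm_neg, hj], rfl⟩)
  have := pr_cases ((len_of_nm hl hi).trans (len_of_nm hl hj).symm) h1 h2
  rw [nm, if_pos (len_of_nm hl hj)]
  tauto

lemma nm_long_long {i j : H.root} (hi : nm l i i = 4) (hj : nm l j j = 4) :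
    (nm l i j = 4 ∧ i = j) ∨ (nm l i j = -4 ∧ i = negRoot j) ∨ nm l i j = -2 ∨ nm l i j = 0 ∨
      nm l i j = 2 := by
  by_cases h1 : i = j
  · subst h1; exact Or.inl ⟨hi, rfl⟩
  by_cases h2 : i = negRoot j
  · subst h2; exact Or.inr (Or.inl ⟨by rw [nm_neg, hj], rfl⟩)
  have h3 := pr_cases ((len_of_nm' hl hi).trans (len_of_nm' hl hj).symm) h1 h2
  have h4 : nm l i j = 2 * pr i j := by
    rw [nm, if_neg]
    intro h; rw [nm_self_of_len hl h] at hj; omega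
  omega

lemma nm_short_long {i j : H.root} (hi : nm l i i = 2) (hj : nm l j j = 4) :
    nm l i j = -2 ∨ nm l i j = 0 ∨ nm l i j = 2 := by
  have h1 : i ≠ j := by rintro rfl; omega
  have h2 : i ≠ negRoot j := by rintro rfl; rw [nm_neg, nm_neg' hl] at hi; omega
  have h3 := pr_mem_of_ne h1 h2
  have h4 : nm l i j = 2 * pr i j := by
    rw [nm, if_neg]
    intro h; rw [nm_self_of_len hl h] at hj; omega
  have h5 : nm l j i = pr j i := by rw [nm, if_pos (len_of_nm hl hi)]
  have h6 := nm_comm hl i j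
  simp only [Set.mem_insert_iff, Prod.mk.injEq, Set.mem_singleton_iff] at h3
  omega

/-- If two short roots have an angle of 120 degrees, then every short root is at such an angle with
another short root. -/
lemma exists_short_nm_eq_one {p q : H.root} (hp : nm l p p = 2) (hq : nm l q q = 2)
    (hpq : nm l p q = -1) {i : H.root} (hi : nm l i i = 2) : ∃ j, nm l j j = 2 ∧ nm l j i = 1 := by
  have hr : ∀ k i j : H.root, nm l ((rootSystem H).reflectionPerm k i)
      ((rootSystem H).reflectionPerm k j) = nm l i j := fun k i j => by
    rw [nm, nm, pr_reflectionPerm, len_reflectionPerm]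
  -- The short roots with the desired property form a nonempty Weyl-invariant set and so span; one
  -- of them is not orthogonal to `i`.
  obtain ⟨k, ⟨hk, j, hj, hjk⟩, hki⟩ := exists_pr_ne_zero_of_span
    (s := {k : H.root | nm l k k = 2 ∧ ∃ j, nm l j j = 2 ∧ nm l j k = 1})
    (span_root_eq_top_of_reflectionPerm ⟨q, hq, negRoot p, by rw [nm_neg, nm_neg' hl, hp]; rfl,
      by rw [nm_neg, hpq]; rfl⟩ fun m k hk => ⟨by rw [hr, hk.1], by
        obtain ⟨j, hj, hjk⟩ := hk.2
        exact ⟨_, by rw [hr m j, hj], by rw [hr m j, hjk]⟩⟩) i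
  have hki' : nm l k i ≠ 0 := fun h => hki (nm_eq_zero_iff.mp h)
  rcases nm_short_short hl hk hi with ⟨-, rfl⟩ | ⟨-, rfl⟩ | h | h | h
  · exact ⟨j, hj, hjk⟩
  · exact ⟨negRoot j, by rw [nm_neg, nm_neg' hl, hj]; rfl, by rw [nm_neg, ← nm_neg' hl, hjk]⟩
  · exact ⟨negRoot k, by rw [nm_neg, nm_neg' hl, hk]; rfl, by rw [nm_neg, h]; rfl⟩
  · exact absurd h hki'
  · exact ⟨k, hk, h⟩

/-- The short roots that are not orthogonal to a given long root span. -/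
lemma span_short_eq_top {p q : H.root} (hp : nm l p p = 2) (hq : nm l q q = 2)
    (hpq : nm l p q = -1) (x : H.root) :
    Submodule.span ℂ ((rootSystem H).root '' {i | nm l i i = 2 ∧ nm l i x ≠ 0}) = ⊤ := by
  set X : Set H.root := {i | nm l i i = 2 ∧ nm l i x ≠ 0} with hX
  set W := Submodule.span ℂ ((rootSystem H).root '' X) with hW
  have hXW : ∀ i ∈ X, (rootSystem H).root i ∈ W := fun i hi => Submodule.subset_span ⟨i, hi, rfl⟩
  have hXn : ∀ i ∈ X, negRoot i ∈ X := fun i hi =>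
    ⟨by rw [nm_neg, nm_neg' hl, hi.1]; rfl, by rw [nm_neg]; exact neg_ne_zero.mpr hi.2⟩
  have short : ∀ j, nm l j j = 2 → ∀ i ∈ X, nm l j i ≠ 0 → (rootSystem H).root j ∈ W := by
    -- j - i is short. If `j` is orthogonal to `x`, then j - i is not, so j - i lies in `X`; either
    -- way `j` lies in `W`.
    have pos : ∀ j, nm l j j = 2 → ∀ i ∈ X, nm l j i = 1 → (rootSystem H).root j ∈ W := by
      intro j hj i hi hji
      obtain ⟨k, hk⟩ := exists_sub_of_nm_pos hl (i := j) (j := i) (by omega)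
        (by rintro rfl; omega)
      by_cases hjx : nm l j x = 0
      · have h1 := hXW k ⟨by rw [nm_sub_self hl hk, hj, hi.1, hji]; rfl, by
          rw [nm_sub hk, hjx, zero_sub]; exact neg_ne_zero.mpr hi.2⟩
        rw [hk] at h1
        exact (Submodule.sub_mem_iff_left _ (hXW i hi)).mp h1
      · exact hXW j ⟨hj, hjx⟩
    intro j hj i hi hji
    rcases nm_short_short hl hj hi.1 with ⟨-, rfl⟩ | ⟨-, rfl⟩ | h | h | h
    · exact hXW _ hi
    · exact hXW _ (hXn _ hi)
    · exact pos j hj _ (hXn i hi) (by rw [nm_neg' hl, h]; rfl)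
    · exact absurd h hji
    · exact pos j hj i hi h
  have long : ∀ j, nm l j j = 4 → ∀ i ∈ X, nm l j i ≠ 0 → (rootSystem H).root j ∈ W := by
    have pos : ∀ j, nm l j j = 4 → ∀ i ∈ X, nm l j i = 2 → (rootSystem H).root j ∈ W := by
      intro j hj i hi hji
      have hi2 := hi.1
      obtain ⟨k, hk⟩ := exists_sub_of_nm_pos hl (i := j) (j := i) (by omega)
        (by rintro rfl; omega)
      have hkk : nm l k k = 2 := by rw [nm_sub_self hl hk, hj, hi.1, hji]; rfl
      have hki : nm l k i = 0 := by rw [nm_sub hk, hji, hi.1]; rfl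
      suffices h : (rootSystem H).root k ∈ W by
        rw [hk] at h
        exact (Submodule.sub_mem_iff_left _ (hXW i hi)).mp h
      -- The short root k = j - i is orthogonal to `i` and is split as m + (k - m). Since (m,j) is
      -- even and (m,k) = 1, the number (m,i) is odd, so both short summands are nonorthogonal to
      -- `i` and lie in `W`.
      obtain ⟨m, hm, hmk⟩ := exists_short_nm_eq_one hl hp hq hpq hkk
      have h1 := nm_short_long hl hm hj
      have h2 := nm_comm hl m j
      have h3 := nm_sub hk (l := l) m
      have h4 := nm_comm hl m k
      have h5 := nm_comm hl m i
      obtain ⟨n, hn⟩ := exists_sub_of_nm_pos hl (i := k) (j := m) (by omega)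
        (by rintro rfl; omega)
      have hmi : nm l m i ≠ 0 := by omega
      have hmW := short m hm i hi hmi
      have hnW := short n (by rw [nm_sub_self hl hn]; omega) i hi (by rw [nm_sub hn]; omega)
      rw [hn] at hnW
      exact (Submodule.sub_mem_iff_left _ hmW).mp hnW
    intro j hj i hi hji
    have h1 := nm_short_long hl hi.1 hj
    have h2 := nm_comm hl i j
    by_cases h : nm l j i = 2
    · exact pos j hj i hi h
    · exact pos j hj _ (hXn i hi) (by rw [nm_neg' hl]; omega)
  have hne : X.Nonempty := by
    obtain ⟨k, hk, hkx⟩ := exists_len_eq_pr_ne_zero x p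
    exact ⟨k, nm_self_of_len hl (hk.trans (len_of_nm hl hp)), fun h => hkx (nm_eq_zero_iff.mp h)⟩
  -- By irreducibility it is enough that roots outside `W` be orthogonal to `X`.
  refine (rootSystem H).span_root_image_eq_top_of_forall_orthogonal X hne fun j hj i hi => ?_
  rw [RootPairing.IsOrthogonal]
  have h0 : nm l j i = 0 := by
    by_contra h
    rcases nm_self_cases hl j with h1 | h1
    · exact hj (short j h1 i hi h)
    · exact hj (long j h1 i hi h)
  have h1 := nm_eq_zero_iff.mp h0
  rw [nm_comm hl] at h0
  have h2 := nm_eq_zero_iff.mp h0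
  rw [← RootPairing.root_coroot_eq_pairing, ← RootPairing.root_coroot_eq_pairing]
  change (rootSystem H).root j ((rootSystem H).coroot i) = 0 ∧
    (rootSystem H).root i ((rootSystem H).coroot j) = 0
  rw [← pr_cast, ← pr_cast, h1, h2]
  simp

/-- Half the sum of two orthogonal long roots is a root, unless the short roots are pairwise
orthogonal or proportional. -/
lemma exists_half_add {p q : H.root} (hp : nm l p p = 2) (hq : nm l q q = 2)
    (hpq : nm l p q = -1) {x y : H.root} (hx : nm l x x = 4) (hy : nm l y y = 4)
    (hxy : nm l x y = 0) : ∃ i : H.root,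
      (rootSystem H).root i + (rootSystem H).root i =
        (rootSystem H).root x + (rootSystem H).root y := by
  have hyx := nm_comm hl x y
  have main : ∀ i, nm l i i = 2 → nm l i x = 2 → nm l i y = 2 → ∃ i : H.root,
      (rootSystem H).root i + (rootSystem H).root i =
        (rootSystem H).root x + (rootSystem H).root y := by
    intro i hi hix hiy
    have hxi := nm_comm hl x i
    have hyi := nm_comm hl y i
    obtain ⟨j, hj⟩ := exists_sub_of_nm_pos hl (i := x) (j := i) (by omega) (by rintro rfl; omega)
    obtain ⟨k, hk⟩ := exists_sub_of_nm_pos hl (i := y) (j := i) (by omega) (by rintro rfl; omega)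
    have h1 : nm l j j = 2 := by rw [nm_sub_self hl hj]; omega
    have h2 : nm l k k = 2 := by rw [nm_sub_self hl hk]; omega
    -- The short roots x - i and y - i have inner product -2, so they are opposite, that is, x + y =
    -- 2i.
    have h3 : nm l j k = -2 := by
      rw [nm_sub hj, nm_comm hl x, nm_comm hl i, nm_sub hk, nm_sub hk]
      omega
    rcases nm_short_short hl h1 h2 with h | ⟨-, h⟩ | h | h | h
    · omega
    · refine ⟨i, ?_⟩
      have h4 := root_negRoot k
      rw [← h, hj, hk, sub_eq_iff_eq_add] at h4
      rw [h4]
      abel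
    all_goals omega
  have main' : ∀ i, nm l i i = 2 → nm l i x = 2 → nm l i y ≠ 0 → ∃ i : H.root,
      (rootSystem H).root i + (rootSystem H).root i =
        (rootSystem H).root x + (rootSystem H).root y := by
    intro i hi hix hiy
    rcases nm_short_long hl hi hy with h | h | h
    -- Adding `y` to `i` changes its inner product with `y` from -2 to 2 and keeps its length and
    -- its inner product with `x`.
    · obtain ⟨j, hj⟩ := exists_add_of_nm_neg hl (i := i) (j := y) (by omega)
        (by rintro rfl; rw [nm_neg] at h; omega)
      exact main j (by rw [nm_add_self hl hj]; omega) (by rw [nm_add hj]; omega)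
        (by rw [nm_add hj]; omega)
    · exact absurd h hiy
    · exact main i hi hix h
  obtain ⟨i, ⟨hi, hix⟩, hiy⟩ := exists_pr_ne_zero_of_span (span_short_eq_top hl hp hq hpq x) y
  have hiy' : nm l i y ≠ 0 := fun h => hiy (nm_eq_zero_iff.mp h)
  rcases nm_short_long hl hi hx with h | h | h
  · exact main' (negRoot i) (by rw [nm_neg, nm_neg' hl, hi]; rfl) (by rw [nm_neg, h]; rfl)
      (by rw [nm_neg]; exact neg_ne_zero.mpr hiy')
  · exact absurd h hix
  · exact main' i hi h hiy'

end TwoLength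


/-! ### Cyclic products of the coefficients of an elliptic lift -/

section KeyTheorem

variable {τ : L ≃ₗ⁅ℂ⁆ L} {π : Equiv.Perm H.root}

/-- The sum over a closed orbit is invariant, and there are no nonzero invariants. -/
lemma IsLift.sum_rootH_eq_zero (h : IsLift τ π) (hell : ∀ z : H, h.restrict z = z → z = 0)
    {α : H.root} {d : ℕ} (hd : (π ^ d) α = α) :
    ∑ k ∈ Finset.range d, rootH ((π ^ k) α) = 0 := by
  apply hell
  have h1 : h.restrict (∑ k ∈ Finset.range d, rootH ((π ^ k) α)) =
      ∑ k ∈ Finset.range d, rootH ((π ^ (k + 1)) α) := by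
    rw [map_sum]
    refine Finset.sum_congr rfl fun k _ => ?_
    rw [h.restrict_rootH, pow_succ']; rfl
  have h2 := (Finset.sum_range_succ (fun k => rootH ((π ^ k) α)) d).symm.trans
    (Finset.sum_range_succ' (fun k => rootH ((π ^ k) α)) d)
  rw [hd] at h2
  rw [h1]
  exact (add_right_cancel h2).symm

lemma IsLift.eq_of_span (h : IsLift τ π) {s : Set H.root}
    (hs : Submodule.span ℂ ((rootSystem H).root '' s) = ⊤) (hπ : ∀ i ∈ s, π i = i) (i : H.root) :
    π i = i := by
  have h0 : ∀ (i : H.root) (z : H),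
      (rootSystem H).root (π i) (h.restrict z) = (rootSystem H).root i z := by
    intro i z
    rw [← killingForm_rootH, ← killingForm_rootH, ← h.map_rootH, h.coe_restrict,
      killingForm_of_equiv_apply]
  have h1 : ∀ z : H, h.restrict z = z := by
    intro z
    have h2 : ∀ f : Module.Dual ℂ H, f (h.restrict z) = f z := by
      intro f
      have hf : f ∈ Submodule.span ℂ ((rootSystem H).root '' s) := hs ▸ Submodule.mem_top
      induction hf using Submodule.span_induction with
      | mem f hf =>
        obtain ⟨j, hj, rfl⟩ := hf
        rw [← h0 j z, hπ j hj]
      | zero => rfl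
      | add f g _ _ hf hg => rw [LinearMap.add_apply, LinearMap.add_apply, hf, hg]
      | smul c f _ hf => rw [LinearMap.smul_apply, LinearMap.smul_apply, hf]
    rw [← sub_eq_zero, ← Module.forall_dual_apply_eq_zero_iff ℂ]
    exact fun f => by rw [map_sub, h2, sub_self]
  apply rootH_injective
  rw [← h.restrict_rootH, h1]

lemma IsLift.nm_map (h : IsLift τ π) (l : ℂ) (i j : H.root) : nm l (π i) (π j) = nm l i j := by
  rw [nm, nm, h.len_map]
  simp only [pr, h.pairingIn_map]

/-- For a lift of order two, root vectors of roots `i + π i` are mapped to their negatives. -/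
lemma IsLift.liftCoeff_eq_neg_one (h : IsLift τ π) (E : RootVectors H) (h2 : ∀ x, τ (τ x) = x)
    {i k : H.root} (hk : (rootSystem H).root k = (rootSystem H).root i + (rootSystem H).root (π i)) :
    E.liftCoeff τ π k = -1 := by
  have hπ : π (π i) = i :=
    rootH_injective (Subtype.ext (by rw [← h.map_rootH, ← h.map_rootH, h2]))
  have h1 : E.liftCoeff τ π i * E.liftCoeff τ π (π i) = 1 := by
    have h3 := h2 (E.e i)
    rw [h.map_e, map_smul, h.map_e, smul_smul, hπ] at h3
    exact smul_left_injective ℂ (E.e_ne_zero i) (h3.trans (one_smul ℂ _).symm)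
  -- The involution exchanges the two summands, and swapping them changes the sign of the structure
  -- constant.
  have h3 := h.structConst_mul_liftCoeff E hk
  rw [h1, one_mul, hπ, E.structConst_swap hk] at h3
  exact mul_left_cancel₀ (E.structConst_ne_zero hk) (h3.trans (by ring))

lemma len_add {i j k : H.root}
    (h : (rootSystem H).root k = (rootSystem H).root i + (rootSystem H).root j) :
    len k = len i + pr i j * len j + len j := by
  have h' : rootH k = rootH i + rootH j := rootH_eq_add_iff.mpr h
  have e1 : (rootSystem H).root i (rootH j) = pr i j * (len j / 2) := root_rootH i j
  have e2 : (rootSystem H).root j (rootH i) = pr i j * (len j / 2) := by rw [root_rootH_comm, e1]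
  rw [len, h, h', LinearMap.add_apply, map_add, map_add, e1, e2]
  change len i + _ + (_ + len j) = _
  ring

lemma len_negRoot (α : H.root) : len (negRoot α) = len α := by
  rw [len, len, rootH_negRoot, root_negRoot, map_neg, LinearMap.neg_apply, neg_neg]

/-- The roots of maximal length are closed under addition, so the equal-length case applies to them.
-/
lemma IsLift.prod_liftCoeff_eq_one_of_long (h : IsLift τ π)
    (hell : ∀ z : H, h.restrict z = z → z = 0) {E : RootVectors H} {ω : L ≃ₗ⁅ℂ⁆ L}
    (hE : E.IsAdapted ω) {α : H.root} (hα : ∀ β : H.root, (len β).re ≤ (len α).re) {d : ℕ}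
    (hd : (π ^ d) α = α) : ∏ k ∈ Finset.range d, E.liftCoeff τ π ((π ^ k) α) = 1 := by
  refine h.prod_liftCoeff_eq_one_of_len_eq hE (Ψ := {β | len β = len α}) (fun β hβ => ?_)
    (fun i hi j hj k hk => ?_) (fun i hi j hj => hi.trans hj.symm)
    (fun i hi => (h.len_map i).trans hi) rfl hd (h.sum_rootH_eq_zero hell hd)
  · exact (len_negRoot β).trans hβ
  · change len k = len α
    have h1 := len_add hk
    rw [show len i = len α from hi, show len j = len α from hj] at h1
    obtain ⟨r, hr, hr'⟩ := exists_len_eq α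
    obtain ⟨t, ht, ht'⟩ := exists_len_eq k
    have h2 := hα k
    rw [hr', ht', Complex.ofReal_re, Complex.ofReal_re] at h2
    -- The squared length of the sum is a positive integral multiple of the maximal one, hence equal
    -- to it.
    have h3 : t = r * (2 + pr i j : ℤ) := by
      rw [hr', ht'] at h1
      have h4 : (t : ℂ) = ((r * (2 + pr i j : ℤ) : ℝ) : ℂ) := by
        rw [h1]; push_cast; ring
      exact_mod_cast h4
    have h4 : (0 : ℝ) < (2 + pr i j : ℤ) := by
      rw [h3] at ht
      exact (mul_pos_iff_of_pos_left hr).mp ht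
    have h5 : ((2 + pr i j : ℤ) : ℝ) ≤ 1 := by
      rw [h3] at h2
      exact (mul_le_iff_le_one_right hr).mp h2
    have h6 : 2 + pr i j = 1 :=
      le_antisymm (by exact_mod_cast h5) (by have : 0 < 2 + pr i j := by exact_mod_cast h4
                                             omega)
    rw [h6, Int.cast_one, mul_one] at h3
    rw [hr', ht', h3]

/-! ### Signs on long roots when the squared lengths have ratio two -/

section Long

variable {l : ℂ} (hl : ∀ i : H.root, len i = l ∨ len i = 2 * l)
include hl

lemma IsLift.sum_nm_eq_zero (h : IsLift τ π) (hell : ∀ z : H, h.restrict z = z → z = 0)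
    {α : H.root} {d : ℕ} (hd : (π ^ d) α = α) (z : H.root) :
    ∑ k ∈ Finset.range d, nm l ((π ^ k) α) z = 0 := by
  have h1 : ((∑ k ∈ Finset.range d, nm l ((π ^ k) α) z : ℤ) : ℂ) * (l / 2) = 0 := by
    rw [Int.cast_sum, Finset.sum_mul]
    simp only [nm_cast hl]
    simp only [root_rootH_comm _ z]
    rw [← map_sum, h.sum_rootH_eq_zero hell hd, map_zero]
  exact_mod_cast (mul_eq_zero.mp h1).resolve_right (div_ne_zero (ne_zero_of_len hl z) two_ne_zero)

/-- If the short roots are not pairwise orthogonal, then the power of order two of an elliptic lift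
changes the sign of some long root. -/
lemma IsLift.exists_long_map_eq_neg (h : IsLift τ π) (hell : ∀ z : H, h.restrict z = z → z = 0)
    {m : ℕ} (hm : 0 < m) (hπ : ∀ i, (π ^ (m + m)) i = i) (hne : ∃ i, (π ^ m) i ≠ i)
    {p q : H.root} (hp : nm l p p = 2) (hq : nm l q q = 2) (hpq : nm l p q = -1)
    {x : H.root} (hx : nm l x x = 4)
    (hadd : ∀ i k, nm l k k = 4 →
      (rootSystem H).root k ≠ (rootSystem H).root i + (rootSystem H).root ((π ^ m) i)) :
    ∃ i, nm l i i = 4 ∧ (π ^ m) i = negRoot i := by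
  have hk : ∀ (k : ℕ) i j, nm l ((π ^ k) i) ((π ^ k) j) = nm l i j := fun k => (h.iterate k).nm_map l
  have hS : ∀ i, (π ^ m) ((π ^ m) i) = i := fun i => by
    rw [← Equiv.Perm.mul_apply, ← pow_add, hπ]
  -- The long roots span, so the nontrivial involution s = π^m moves one of them.
  obtain ⟨i, hi, hine⟩ : ∃ i, nm l i i = 4 ∧ (π ^ m) i ≠ i := by
    by_contra! hc
    obtain ⟨j, hj⟩ := hne
    refine hj ((h.iterate m).eq_of_span (s := {k | len k = len x})
      (span_root_eq_top_of_reflectionPerm ⟨x, rfl⟩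
        fun i k hk => (len_reflectionPerm i k).trans hk) (fun k hk => hc k ?_) j)
    exact nm_self_of_len' hl ((show len k = len x from hk).trans (len_of_nm' hl hx))
  have hi' : nm l ((π ^ m) i) ((π ^ m) i) = 4 := by rw [hk, hi]
  rcases nm_long_long hl hi' hi with ⟨-, h1⟩ | ⟨-, h1⟩ | h1 | h1 | h1
  · exact absurd h1 hine
  · exact ⟨i, hi, h1⟩
  · obtain ⟨k, hk⟩ := exists_add_of_nm_neg hl (i := (π ^ m) i) (j := i) (by omega)
      (by intro h0; rw [h0, nm_neg] at h1; omega)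
    exact absurd (hk.trans (add_comm _ _)) (hadd i k (by rw [nm_add_self hl hk]; omega))
  -- This is the only hard case. For inner product -2 the sum i + s i would be a long root, which
  -- `hadd` forbids; for 2 the difference i - s i is a long root negated by s.
  · have h1' : nm l i ((π ^ m) i) = 0 := by rw [nm_comm hl, h1]
    obtain ⟨n, hn⟩ := exists_half_add hl hp hq hpq hi hi' h1'
    -- n = (i + s i) / 2 is a root and has even inner product with every long root.
    have heven : ∀ z, nm l z z = 4 → Even (nm l z i / 2 + nm l z ((π ^ m) i) / 2) ∧
        Even (nm l z i) ∧ Even (nm l z ((π ^ m) i)) := by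
      intro z hz
      have e2 : nm l n z + nm l n z = nm l i z + nm l ((π ^ m) i) z := by
        have e3 : ((nm l n z + nm l n z : ℤ) : ℂ) * (l / 2) =
            ((nm l i z + nm l ((π ^ m) i) z : ℤ) : ℂ) * (l / 2) := by
          rw [Int.cast_add, Int.cast_add, add_mul, add_mul, nm_cast hl, nm_cast hl, nm_cast hl, ← LinearMap.add_apply, hn,
            LinearMap.add_apply]
        exact_mod_cast mul_right_cancel₀
          (div_ne_zero (ne_zero_of_len hl z) two_ne_zero) e3
      have hnn : nm l n z = -2 ∨ nm l n z = 0 ∨ nm l n z = 2 ∨ nm l n z = 4 ∨ nm l n z = -4 := by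
        rcases nm_self_cases hl n with h3 | h3
        · have := nm_short_long hl h3 hz; tauto
        · have := nm_long_long hl h3 hz; tauto
      have h4 := nm_long_long hl hz hi
      have h5 := nm_long_long hl hz hi'
      rw [nm_comm hl z i, nm_comm hl z] at *
      simp only [Int.even_iff]
      omega
    set a : ℕ → ℤ := fun k => nm l ((π ^ k) i) i with ha
    have ha0 : a 0 = 4 := hi
    have ham : a m = 0 := h1
    have hlong : ∀ k, nm l ((π ^ k) i) ((π ^ k) i) = 4 := fun k => by rw [hk, hi]
    have hmod : ∀ k ≤ m, Even (a (m - k) / 2 + a k / 2) := by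
      intro k hkm
      have e1 : a (m - k) = nm l ((π ^ k) i) ((π ^ m) i) := by
        rw [ha]
        change nm l ((π ^ (m - k)) i) i = _
        rw [← hk k ((π ^ (m - k)) i) i, ← Equiv.Perm.mul_apply, ← pow_add,
          Nat.add_sub_cancel' hkm, nm_comm hl]
      rw [e1, add_comm]
      exact (heven _ (hlong k)).1
    have ha2 : ∀ k, Even (a k) := fun k => (heven _ (hlong k)).2.1
    have hsymm : ∀ k ≤ m, a (m + k) = a (m - k) := by
      intro k hkm
      have e1 : a (m - k) = nm l ((π ^ (m + k)) ((π ^ (m - k)) i)) ((π ^ (m + k)) i) :=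
        (hk _ _ _).symm
      rw [← Equiv.Perm.mul_apply, ← pow_add, show m + k + (m - k) = m + m by omega, hπ,
        nm_comm hl] at e1
      exact e1.symm
    have hsum := h.sum_nm_eq_zero hl hell (hπ i) i
    -- The full orbit sum is zero, a 0 = 4, a m = 0, and the remaining terms agree in pairs by
    -- reflection about m.
    have hsum2 : ∑ k ∈ Finset.Ico 1 m, a k = -2 := by
      rw [Finset.sum_range_add] at hsum
      have e1 : ∑ k ∈ Finset.range m, a k = 4 + ∑ k ∈ Finset.Ico 1 m, a k := by
        rw [Finset.range_eq_Ico, Finset.sum_eq_sum_Ico_succ_bot hm, ha0]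
      have e2 : ∑ k ∈ Finset.range m, a (m + k) = 0 + ∑ k ∈ Finset.Ico 1 m, a k := by
        rw [Finset.range_eq_Ico, Finset.sum_eq_sum_Ico_succ_bot hm, add_zero, ham]
        congr 1
        have e3 := Finset.sum_Ico_reflect a 1 (Nat.le_succ m)
        rw [Nat.add_sub_cancel_left, Nat.add_sub_cancel] at e3
        rw [← e3]
        refine (Finset.sum_congr rfl fun k hk => ?_)
        have := Finset.mem_Ico.mp hk
        rw [hsymm k (by omega)]
      change ∑ k ∈ Finset.range m, a k + ∑ k ∈ Finset.range m, a (m + k) = 0 at hsum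
      omega
    -- The halves a k / 2 have odd sum -1 over 0 < k < m but cancel modulo 2 under k ↦ m - k. A
    -- fixed point of this reflection must carry an odd term.
    obtain ⟨j, hjm, hj⟩ : ∃ j, j + j = m ∧ Odd (a j / 2) := by
      by_contra! hc
      have e1 : ((∑ k ∈ Finset.Ico 1 m, a k / 2 : ℤ) : ZMod 2) = 0 := by
        rw [Int.cast_sum]
        refine Finset.sum_involution (fun k _ => m - k) (fun k hk => ?_) (fun k hk hk0 => ?_)
          (fun k hk => ?_) (fun k hk => ?_)
        · have := Finset.mem_Ico.mp hk
          have h3 := hmod k (by omega)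
          rw [← Int.cast_add, add_comm]
          exact (ZMod.intCast_eq_zero_iff_even).mpr h3
        · intro h4
          have := Finset.mem_Ico.mp hk
          have h5 := hc k (by omega)
          rw [Int.not_odd_iff_even] at h5
          exact hk0 ((ZMod.intCast_eq_zero_iff_even).mpr h5)
        · have := Finset.mem_Ico.mp hk
          exact Finset.mem_Ico.mpr (by omega)
        · have := Finset.mem_Ico.mp hk
          change m - (m - k) = k
          omega
      have e2 : 2 * ∑ k ∈ Finset.Ico 1 m, a k / 2 = ∑ k ∈ Finset.Ico 1 m, a k := by
        rw [Finset.mul_sum]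
        exact Finset.sum_congr rfl fun k _ => Int.mul_ediv_cancel' (ha2 k).two_dvd
      have e3 := (ZMod.intCast_eq_zero_iff_even).mp e1
      rw [Int.even_iff] at e3
      omega
    set w := (π ^ j) i with hw
    have hwj : (π ^ j) w = (π ^ m) i := by
      rw [hw, ← Equiv.Perm.mul_apply, ← pow_add, hjm]
    have hww : nm l w w = 4 := hlong j
    have f1 : nm l i w = a j := nm_comm hl _ _
    have f2 : nm l w ((π ^ m) i) = a j := by rw [← hwj, ← f1, ← hk j i w]
    have f3 : nm l i ((π ^ m) w) = a j := by
      rw [← hk m, hS, nm_comm hl, f2]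
    have f4 : nm l w ((π ^ m) w) = 0 := by
      rw [hw, ← Equiv.Perm.mul_apply, ← pow_add, add_comm m j, pow_add, Equiv.Perm.mul_apply, hk,
        h1']
    have haj : a j = 2 ∨ a j = -2 := by
      rw [Int.odd_iff] at hj
      have := nm_long_long hl hww hi
      change (a j = 4 ∧ _) ∨ (a j = -4 ∧ _) ∨ a j = -2 ∨ a j = 0 ∨ a j = 2 at this
      omega
    -- With a j = ±2 the vector v = i ∓ w is a long root, and (v, s v) = ∓2 a j = -4.
    have fin : ∀ v, nm l v v = 4 → nm l v ((π ^ m) v) = -4 →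
        ∃ i, nm l i i = 4 ∧ (π ^ m) i = negRoot i := by
      intro v hv hvS
      refine ⟨v, hv, ?_⟩
      rw [nm_comm hl] at hvS
      rcases nm_long_long hl ((hk m v v).trans hv) hv with h5 | ⟨-, h5⟩ | h5 | h5 | h5
      all_goals first | exact h5 | omega
    rcases haj with haj | haj
    · obtain ⟨v, hv⟩ := exists_sub_of_nm_pos hl (i := i) (j := w) (by omega) (by
        intro h0; rw [← h0] at f1; omega)
      have hv' : (rootSystem H).root ((π ^ m) v) =
          (rootSystem H).root ((π ^ m) i) - (rootSystem H).root ((π ^ m) w) := by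
        have := (h.iterate m).root_add (α := v) (β := w) (γ := i) (by rw [hv, sub_add_cancel])
        rw [this, add_sub_cancel_right]
      refine fin v (by rw [nm_sub_self hl hv]; omega) ?_
      rw [nm_sub hv, nm_comm hl i, nm_comm hl w, nm_sub hv', nm_sub hv', nm_comm hl _ i,
        nm_comm hl _ i, nm_comm hl _ w, nm_comm hl _ w]
      omega
    · obtain ⟨v, hv⟩ := exists_add_of_nm_neg hl (i := i) (j := w) (by omega) (by
        intro h0; rw [h0, nm_neg, hww] at f1; omega)
      have hv' := (h.iterate m).root_add hv
      refine fin v (by rw [nm_add_self hl hv]; omega) ?_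
      rw [nm_add hv, nm_comm hl i, nm_comm hl w, nm_add hv', nm_add hv', nm_comm hl _ i,
        nm_comm hl _ i, nm_comm hl _ w, nm_comm hl _ w]
      omega
  · obtain ⟨k, hk'⟩ := exists_sub_of_nm_pos hl (i := i) (j := (π ^ m) i)
      (by rw [nm_comm hl]; omega) (fun h0 => hine h0.symm)
    rw [nm_comm hl] at h1
    refine ⟨k, by rw [nm_sub_self hl hk']; omega, ?_⟩
    apply root_injective
    have := (h.iterate m).root_add (α := k) (β := (π ^ m) i) (γ := i) (by rw [hk', sub_add_cancel])
    rw [hS] at this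
    rw [root_negRoot, hk', neg_sub, this, add_sub_cancel_right]

end Long

lemma prod_range_mul_liftCoeff (E : RootVectors H) {α : H.root} {d : ℕ} (hd : (π ^ d) α = α)
    (r : ℕ) : ∏ k ∈ Finset.range (d * r), E.liftCoeff τ π ((π ^ k) α) =
      (∏ k ∈ Finset.range d, E.liftCoeff τ π ((π ^ k) α)) ^ r := by
  have hd' : ∀ r : ℕ, (π ^ (d * r)) α = α := by
    intro r
    induction r with
    | zero => rfl
    | succ r ih => rw [mul_add_one, pow_add, Equiv.Perm.mul_apply, hd, ih]
  induction r with
  | zero => simp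
  | succ r ih =>
    rw [mul_add_one, Finset.prod_range_add, ih, pow_succ]
    congr 1
    refine Finset.prod_congr rfl fun k _ => ?_
    rw [add_comm, pow_add, Equiv.Perm.mul_apply, hd']

/-- u² is multiplicative on sums of roots, and the roots of the orbit add up to zero. -/
lemma IsLift.prod_liftCoeff_sq (h : IsLift τ π) (hell : ∀ z : H, h.restrict z = z → z = 0)
    {E : RootVectors H} {ω : L ≃ₗ⁅ℂ⁆ L} (hE : E.IsAdapted ω) {α : H.root} {d : ℕ}
    (hd : (π ^ d) α = α) : (∏ k ∈ Finset.range d, E.liftCoeff τ π ((π ^ k) α)) ^ 2 = 1 := by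
  rw [← Finset.prod_pow]
  refine prod_range_eq_one (Ψ := Set.univ) (fun _ _ _ _ _ _ => trivial)
    (fun α => E.liftCoeff τ π α ^ 2)
    (fun α _ => by rw [← mul_pow, h.liftCoeff_mul_neg, one_pow])
    (fun α _ β _ γ hγ => h.liftCoeff_sq_add E hE hγ) _ (fun _ => trivial) d ?_
  have h1 := h.sum_rootH_eq_zero hell hd
  have h2 := congrArg (fun z : H => (cartanEquivDual H z)) h1
  rw [map_sum, map_zero] at h2
  rw [← h2]
  refine Finset.sum_congr rfl fun k _ => ?_
  rw [rootH, LinearEquiv.apply_symm_apply]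
  rfl

/-- If no pair of roots is as in type `G₂`, then squared lengths differ by a factor at most two. -/
lemma len_cases (hG : ∀ i j : H.root, pr i j ≠ -3) (i j : H.root) :
    len i = len j ∨ len i = 2 * len j ∨ len j = 2 * len i := by
  -- By irreducibility `j` may be replaced by a root of the same length that is not orthogonal to
  -- `i`; the two Cartan integers then give the ratio of lengths.
  obtain ⟨k, hk, hki⟩ := exists_len_eq_pr_ne_zero i j
  rw [← hk]
  have hG' : ∀ i j : H.root, pr i j ≠ 3 := fun i j h3 =>
    hG (negRoot i) j (by rw [pr_negRoot, h3])
  by_cases h1 : k = i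
  · exact Or.inl (by rw [h1])
  by_cases h2 : k = negRoot i
  · exact Or.inl (by rw [h2, len_negRoot])
  have h3 := pr_mem_of_ne h1 h2
  have h4 := pr_mul_len k i
  have h5 := hG k i
  have h6 := hG i k
  have h7 := hG' k i
  have h8 := hG' i k
  simp only [Set.mem_insert_iff, Prod.mk.injEq, Set.mem_singleton_iff] at h3
  rcases h3 with h | h | h | h | h | h | h | h | h | h | h
  · exact absurd h.1 hki
  · rw [h.1, h.2] at h4; exact Or.inl (by simpa using h4)
  · rw [h.1, h.2] at h4; exact Or.inl (by simpa using h4)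
  · rw [h.1, h.2] at h4; exact Or.inr (Or.inl (by simpa using h4))
  · rw [h.1, h.2] at h4; exact Or.inr (Or.inr (by simpa using h4.symm))
  · rw [h.1, h.2] at h4; exact Or.inr (Or.inl (by simpa using h4))
  · rw [h.1, h.2] at h4; exact Or.inr (Or.inr (by simpa using h4.symm))
  · exact absurd h.2 h8
  · exact absurd h.1 h7
  · exact absurd h.2 h6
  · exact absurd h.1 h5

/-- In type `G₂` two roots of different lengths span. -/
lemma span_pair_eq_top_of_pr_eq {i j : H.root} (hij : pr i j = -3) {α δ : H.root}
    (hne : len δ ≠ len α) :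
    Submodule.span ℂ ((rootSystem H).root '' {α, δ}) = ⊤ := by
  have : (rootSystem H).EmbeddedG2 := ⟨i, j, hij⟩
  have h1 := RootPairing.EmbeddedG2.span_eq_top (rootSystem H)
  have h2 : Module.finrank ℂ (Module.Dual ℂ H) ≤ 2 := by
    rw [← finrank_top, ← h1]
    have h4 : ({RootPairing.EmbeddedG2.longRoot (rootSystem H),
        RootPairing.EmbeddedG2.shortRoot (rootSystem H)} : Set (Module.Dual ℂ H)) =
        Set.range ![RootPairing.EmbeddedG2.longRoot (rootSystem H),
          RootPairing.EmbeddedG2.shortRoot (rootSystem H)] := by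
      rw [Matrix.range_cons, Matrix.range_cons, Matrix.range_empty, Set.union_empty]; rfl
    rw [h4]
    exact finrank_range_le_card _
  have h3 : LinearIndependent ℂ ![(rootSystem H).root α, (rootSystem H).root δ] := by
    refine RootPairing.IsReduced.linearIndependent _ (fun h => hne (by rw [h])) fun h => hne ?_
    rw [eq_negRoot (α := δ) (β := α) h, len_negRoot]
  have h4 := h3.span_eq_top_of_card_eq_finrank' (le_antisymm h3.fintype_card_le_finrank h2)
  rw [Matrix.range_cons, Matrix.range_cons, Matrix.range_empty, Set.union_empty] at h4
  rw [Set.image_pair]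
  exact h4

/-- The coefficient of a power of an elliptic lift at a root fixed by this power is one. -/
theorem IsLift.prod_liftCoeff_eq_one (h : IsLift τ π)
    (hell : ∀ z : H, h.restrict z = z → z = 0) {E : RootVectors H} {ω : L ≃ₗ⁅ℂ⁆ L}
    (hE : E.IsAdapted ω) {n : ℕ} (hn : 0 < n) (hτ : ∀ x, lieIter τ n x = x)
    (hmin : ∀ k, 0 < k → k < n → ∃ β, (π ^ k) β ≠ β) {α : H.root} {d : ℕ} (hd : (π ^ d) α = α) :
    ∏ k ∈ Finset.range d, E.liftCoeff τ π ((π ^ k) α) = 1 := by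
  have hπn : ∀ β, (π ^ n) β = β := (h.iterate n).eq_of_forall_apply hτ
  set d₀ := Function.minimalPeriod π α with hd₀
  have hdvd : ∀ k : ℕ, (π ^ k) α = α → d₀ ∣ k := fun k hk =>
    Function.IsPeriodicPt.minimalPeriod_dvd (by
      rwa [← Equiv.Perm.iterate_eq_pow] at hk)
  have hd0 : (π ^ d₀) α = α := by
    rw [← Equiv.Perm.iterate_eq_pow]
    exact Function.isPeriodicPt_minimalPeriod π α
  suffices hmain : ∏ k ∈ Finset.range d₀, E.liftCoeff τ π ((π ^ k) α) = 1 by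
    obtain ⟨r, rfl⟩ := hdvd d hd
    rw [prod_range_mul_liftCoeff E hd0, hmain, one_pow]
  by_contra hc
  have hc1 : ∏ k ∈ Finset.range d₀, E.liftCoeff τ π ((π ^ k) α) = -1 :=
    (mul_self_eq_one_iff.mp ((sq _).symm.trans (h.prod_liftCoeff_sq hell hE hd0))).resolve_left hc
  -- If the product over the minimal period is -1, only an even number of turns can give 1. Applied
  -- to n this shows that m = n / 2 is still a multiple of the minimal period.
  have hodd : ∀ r : ℕ, ∏ k ∈ Finset.range (d₀ * r), E.liftCoeff τ π ((π ^ k) α) = 1 → Even r := by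
    intro r hr
    rw [prod_range_mul_liftCoeff E hd0, hc1] at hr
    by_contra h1
    rw [Nat.not_even_iff_odd] at h1
    rw [h1.neg_one_pow] at hr
    norm_num at hr
  obtain ⟨r, hr⟩ := hdvd n (hπn α)
  obtain ⟨r', rfl⟩ := hodd r (by
    rw [← hr, ← liftCoeff_iter h E]
    exact (h.iterate n).liftCoeff_eq_one E hτ α)
  set m := d₀ * r' with hm
  have hnm : n = m + m := by rw [hr, hm, mul_add]
  have hm0 : 0 < m := by omega
  have hfix : ∀ k, (π ^ k) ((π ^ m) α) = (π ^ k) α := by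
    intro k
    have : (π ^ m) α = α := by
      rw [hm]
      have := Function.IsPeriodicPt.mul_const (Function.isPeriodicPt_minimalPeriod π α) r'
      rw [Function.IsPeriodicPt, Equiv.Perm.iterate_eq_pow] at this
      exact this
    rw [this]
  have hcomm : ∀ (k : ℕ) (β : H.root), (π ^ m) ((π ^ k) β) = (π ^ k) ((π ^ m) β) := by
    intro k β
    rw [← Equiv.Perm.mul_apply, ← pow_add, add_comm, pow_add, Equiv.Perm.mul_apply]
  obtain ⟨ι, hι⟩ := hmin m hm0 (by omega)
  -- the negative of `α` is not in the orbit
  have hneg : ∀ j : ℕ, (π ^ j) α ≠ negRoot α := by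
    intro j hj
    have hjj : (π ^ (j + j)) α = α := by
      rw [pow_add, Equiv.Perm.mul_apply, hj, (h.iterate j).map_negRoot, hj, negRoot_negRoot]
    obtain ⟨t, ht⟩ := hdvd _ hjj
    -- If the orbit contained the negative of `α`, its factors would cancel in opposite pairs, so
    -- already π^j would fix `α`.
    obtain ⟨t', rfl⟩ := hodd t (by
      rw [← ht, Finset.prod_range_add]
      simp_rw [show ∀ k, (π ^ (j + k)) α = (π ^ k) (negRoot α) from fun k => by
        rw [add_comm, pow_add, Equiv.Perm.mul_apply, hj]]
      rw [← Finset.prod_mul_distrib]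
      refine Finset.prod_eq_one fun k _ => ?_
      rw [(h.iterate k).map_negRoot, h.liftCoeff_mul_neg])
    have h1 : j = d₀ * t' := by rw [mul_add] at ht; omega
    have h2 : (π ^ j) α = α := by
      rw [h1]
      have := Function.IsPeriodicPt.mul_const (Function.isPeriodicPt_minimalPeriod π α) t'
      rw [Function.IsPeriodicPt, Equiv.Perm.iterate_eq_pow] at this
      exact this
    exact negRoot_ne α (hj.symm.trans h2)
  -- the span of the orbit
  set W := Submodule.span ℂ (Set.range fun k : ℕ => rootH ((π ^ k) α)) with hW
  have hWfix : ∀ z ∈ W, (h.iterate m).restrict z = z := by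
    intro z hz
    induction hz using Submodule.span_induction with
    | mem z hz =>
      obtain ⟨k, rfl⟩ := hz
      rw [IsLift.restrict_rootH]
      change rootH ((π ^ m) ((π ^ k) α)) = rootH ((π ^ k) α)
      rw [hcomm, hfix]
    | zero => exact map_zero _
    | add x y _ _ hx hy => rw [map_add, hx, hy]
    | smul c x _ hx => rw [map_smul, hx]
  have hWπ : ∀ z ∈ W, h.restrict z ∈ W := by
    intro z hz
    induction hz using Submodule.span_induction with
    | mem z hz =>
      obtain ⟨k, rfl⟩ := hz
      change h.restrict (rootH ((π ^ k) α)) ∈ W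
      rw [IsLift.restrict_rootH, ← Equiv.Perm.mul_apply, ← pow_succ']
      exact Submodule.subset_span ⟨k + 1, rfl⟩
    | zero => rw [map_zero]; exact W.zero_mem
    | add x y _ _ hx hy => rw [map_add]; exact W.add_mem hx hy
    | smul c x _ hx => rw [map_smul]; exact W.smul_mem c hx
  have hαW : rootH α ∈ W := Submodule.subset_span ⟨0, rfl⟩
  have hWroot : ∀ δ, rootH δ ∈ W → (π ^ m) δ = δ := by
    intro δ hδ
    apply rootH_injective
    rw [← (h.iterate m).restrict_rootH, hWfix _ hδ]
  -- If all roots in `W` had the same length, they would form a closed set to which the equal-length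
  -- theorem applies.
  obtain ⟨δ, hδW, hδ⟩ : ∃ δ, rootH δ ∈ W ∧ len δ ≠ len α := by
    by_contra! hall
    refine hc (h.prod_liftCoeff_eq_one_of_len_eq hE (Ψ := {β | rootH β ∈ W}) (fun β hβ => ?_)
      (fun i hi j hj k hk => ?_) (fun i hi j hj => (hall i hi).trans (hall j hj).symm)
      (fun i hi => ?_) hαW hd0 (h.sum_rootH_eq_zero hell hd0))
    · change rootH (negRoot β) ∈ W
      rw [rootH_negRoot]
      exact W.neg_mem hβ
    · change rootH k ∈ W
      rw [rootH_eq_add_iff.mpr hk]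
      exact W.add_mem hi hj
    · change rootH (π i) ∈ W
      rw [← h.restrict_rootH]
      exact hWπ _ hi
  -- In type G₂ the fixed roots `α` and `δ` already span, so π^m would be trivial.
  have hG : ∀ i j : H.root, pr i j ≠ -3 := by
    intro i j hij
    refine hι ((h.iterate m).eq_of_span (span_pair_eq_top_of_pr_eq hij hδ) ?_ ι)
    rintro k (rfl | rfl)
    · exact hWroot _ hαW
    · exact hWroot _ hδW
  obtain ⟨β, hβ⟩ : ∃ β : H.root, (len α).re < (len β).re := by
    by_contra! hmax
    exact hc (h.prod_liftCoeff_eq_one_of_long hell hE hmax hd0)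
  obtain ⟨a, ha, ha'⟩ := exists_len_eq α
  have hβα : len β = 2 * len α := by
    obtain ⟨b, hb, hb'⟩ := exists_len_eq β
    rcases len_cases hG α β with h1 | h1 | h1
    · rw [h1] at hβ; exact absurd hβ (lt_irrefl _)
    · rw [h1, hb', Complex.ofReal_re, ← Complex.ofReal_ofNat, ← Complex.ofReal_mul,
        Complex.ofReal_re] at hβ
      linarith
    · exact h1
  have hl : ∀ i : H.root, len i = len α ∨ len i = 2 * len α := by
    intro i
    have hne := len_ne_zero i
    rcases len_cases hG i α with h1 | h1 | h1
    · exact Or.inl h1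
    · exact Or.inr h1
    · rcases len_cases hG i β with h2 | h2 | h2
      · exact Or.inr (h2.trans hβα)
      · rw [hβα, h1] at h2
        exact absurd (by linear_combination (-1 / 7 : ℂ) * h2) hne
      · rw [hβα, h1] at h2
        exact absurd (by linear_combination (1 / 2 : ℂ) * h2) hne
  have hα2 : nm (len α) α α = 2 := nm_self_of_len hl rfl
  have hδ4 : nm (len α) δ δ = 4 := nm_self_of_len' hl ((hl δ).resolve_left hδ)
  have hlongmax : ∀ k : H.root, nm (len α) k k = 4 → ∀ β : H.root, (len β).re ≤ (len k).re := by
    intro k hk β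
    rw [len_of_nm' hl hk, ha', ← Complex.ofReal_ofNat, ← Complex.ofReal_mul]
    rcases hl β with h1 | h1
    · rw [h1, ha', Complex.ofReal_re, Complex.ofReal_re]; linarith
    · rw [h1, ha', ← Complex.ofReal_ofNat, ← Complex.ofReal_mul]
  -- On such a root space the involutive power acts by -1, whereas the result for long roots gives
  -- 1.
  have hadd : ∀ i k : H.root, nm (len α) k k = 4 →
      (rootSystem H).root k ≠ (rootSystem H).root i + (rootSystem H).root ((π ^ m) i) := by
    intro i k hk hik
    have hS : ∀ x, lieIter τ m (lieIter τ m x) = x := by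
      intro x
      rw [lieIter_apply, lieIter_apply, ← Function.iterate_add_apply, ← hnm, ← lieIter_apply, hτ]
    have h1 := (h.iterate m).liftCoeff_eq_neg_one E hS hik
    have h2 : (π ^ m) k = k := by
      apply root_injective
      rw [(h.iterate m).root_add hik, hik, ← Equiv.Perm.mul_apply, ← pow_add, ← hnm, hπn, add_comm]
    rw [liftCoeff_iter h, h.prod_liftCoeff_eq_one_of_long hell hE (hlongmax k hk) h2] at h1
    norm_num at h1
  -- The inner products of the orbit with `α` add up to zero and start with 2, so one is negative;
  -- -2 is excluded because -α is not in the orbit. Hence the short roots are not pairwise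
  -- orthogonal.
  obtain ⟨j, hj⟩ : ∃ j : ℕ, nm (len α) ((π ^ j) α) α = -1 := by
    by_contra! hnone
    have h1 := h.sum_nm_eq_zero hl hell (hπn α) α
    obtain ⟨n', rfl⟩ : ∃ n', n = n' + 1 := ⟨n - 1, by omega⟩
    rw [Finset.sum_range_succ'] at h1
    have h2 : 0 ≤ ∑ k ∈ Finset.range n', nm (len α) ((π ^ (k + 1)) α) α := by
      refine Finset.sum_nonneg fun k _ => ?_
      rcases nm_short_short hl (i := (π ^ (k + 1)) α)
        (((h.iterate (k + 1)).nm_map _ α α).trans hα2) hα2 with h3 | h3 | h3 | h3 | h3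
      · omega
      · exact absurd h3.2 (hneg _)
      · exact absurd h3 (hnone _)
      all_goals omega
    rw [pow_zero, Equiv.Perm.one_apply, hα2] at h1
    omega
  obtain ⟨i, hi, hiS⟩ := h.exists_long_map_eq_neg hl hell hm0 (fun i => by rw [← hnm, hπn])
    ⟨ι, hι⟩ (((h.iterate j).nm_map _ α α).trans hα2) hα2 hj hδ4 hadd
  have hδS := hWroot δ hδW
  have h0 : nm (len α) δ i = 0 := by
    have := (h.iterate m).nm_map (len α) δ i
    rw [hδS, hiS, nm_neg' hl] at this
    omega
  -- `δ` is fixed and `i` is negated by π^m, so they are orthogonal. Half their sum is a root `e`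
  -- with image (δ - i) / 2, whence δ is the sum of `e` and its image.
  obtain ⟨e, he⟩ := exists_half_add hl (((h.iterate j).nm_map _ α α).trans hα2) hα2 hj hδ4 hi h0
  refine hadd e δ hδ4 ?_
  have h1 : (rootSystem H).root ((π ^ m) e) + (rootSystem H).root ((π ^ m) e) =
      (rootSystem H).root δ - (rootSystem H).root i := by
    have h2 : rootH e + rootH e = rootH δ + rootH i := by
      have := congrArg (cartanEquivDual H).symm he
      rw [map_add, map_add] at this
      exact this
    have h3 := congrArg (h.iterate m).restrict h2
    rw [map_add, map_add, IsLift.restrict_rootH, IsLift.restrict_rootH, IsLift.restrict_rootH,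
      hδS, hiS, rootH_negRoot] at h3
    have h4 := congrArg (cartanEquivDual H) h3
    rw [map_add, map_add, map_neg, ← sub_eq_add_neg] at h4
    simp only [rootH, LinearEquiv.apply_symm_apply] at h4
    exact h4
  have h2 : (2 : ℂ) • (rootSystem H).root δ = (2 : ℂ) •
      ((rootSystem H).root e + (rootSystem H).root ((π ^ m) e)) := by
    rw [two_smul, two_smul, add_add_add_comm, he, h1]
    abel
  exact smul_right_injective _ (two_ne_zero) h2

end KeyTheorem


/-! ### The mass operator on the fixed space of an elliptic lift -/

section MassOperator

variable {τ : L ≃ₗ⁅ℂ⁆ L} {π : Equiv.Perm H.root}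

/-- The coefficient of the d-th power at α is a product over d steps of the orbit. Adapted root
vectors enter only in the proof; the conclusion does not depend on them. -/
lemma IsLift.lieIter_apply_eq (h : IsLift τ π) (hell : ∀ z : H, h.restrict z = z → z = 0) {n : ℕ}
    (hn : 0 < n) (hτ : ∀ x, lieIter τ n x = x)
    (hmin : ∀ k, 0 < k → k < n → ∃ β, (π ^ k) β ≠ β) {α : H.root} {d : ℕ} (hd : (π ^ d) α = α)
    {x : L} (hx : x ∈ rsp α) : lieIter τ d x = x := by
  obtain ⟨E, ω, hE⟩ := exists_isAdapted H
  rw [E.eq_smul hx, map_smul, (h.iterate d).map_e, liftCoeff_iter h, hd,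
    h.prod_liftCoeff_eq_one hell hE hn hτ hmin hd, one_smul]

/-- The fixed space of an automorphism. -/
def fixedSpace (τ : L ≃ₗ⁅ℂ⁆ L) : Submodule ℂ L :=
  LinearMap.eqLocus τ.toLinearEquiv.toLinearMap LinearMap.id

lemma mem_fixedSpace {x : L} : x ∈ fixedSpace τ ↔ τ x = x := Iff.rfl

lemma mem_fieldSpace {star : L →ₛₗ[starRingEnd ℂ] L} {x : L} :
    x ∈ fieldSpace τ star ↔ τ x = x ∧ star x = x := Iff.rfl

/-- The sum of the iterates of `τ`. -/
def orbitSum (τ : L ≃ₗ⁅ℂ⁆ L) (n : ℕ) : L →ₗ[ℂ] L :=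
  ∑ k ∈ Finset.range n, (lieIter τ k).toLinearEquiv.toLinearMap

lemma orbitSum_apply (n : ℕ) (x : L) :
    orbitSum τ n x = ∑ k ∈ Finset.range n, lieIter τ k x := by
  rw [orbitSum, LinearMap.sum_apply]; rfl

lemma lieIter_succ_apply (k : ℕ) (x : L) : lieIter τ (k + 1) x = lieIter τ k (τ x) := by
  rw [lieIter_apply, lieIter_apply, Function.iterate_succ_apply]

lemma orbitSum_map {n : ℕ} (hτ : ∀ x, lieIter τ n x = x) (x : L) :
    orbitSum τ n (τ x) = orbitSum τ n x := by
  rw [orbitSum_apply, orbitSum_apply]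
  simp only [← lieIter_succ_apply]
  have h2 := (Finset.sum_range_succ (fun k => lieIter τ k x) n).symm.trans
    (Finset.sum_range_succ' (fun k => lieIter τ k x) n)
  rw [hτ] at h2
  exact (add_right_cancel h2).symm

lemma orbitSum_lieIter {n : ℕ} (hτ : ∀ x, lieIter τ n x = x) (k : ℕ) (x : L) :
    orbitSum τ n (lieIter τ k x) = orbitSum τ n x := by
  induction k generalizing x with
  | zero => rfl
  | succ k ih => rw [lieIter_succ_apply, ih, orbitSum_map hτ]

lemma map_orbitSum {n : ℕ} (hτ : ∀ x, lieIter τ n x = x) (x : L) :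
    τ (orbitSum τ n x) = orbitSum τ n x := by
  conv_rhs => rw [← orbitSum_map hτ]
  rw [orbitSum_apply, orbitSum_apply, map_sum]
  refine Finset.sum_congr rfl fun k _ => ?_
  rw [← lieIter_succ_apply]; rfl

lemma orbitSum_of_mem {n : ℕ} {x : L} (hx : τ x = x) : orbitSum τ n x = (n : ℂ) • x := by
  have h1 : ∀ k, lieIter τ k x = x := fun k => by
    induction k with
    | zero => rfl
    | succ k ih => rw [lieIter_succ_apply, hx, ih]
  rw [orbitSum_apply, Finset.sum_congr rfl fun k _ => h1 k, Finset.sum_const, Finset.card_range,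
    Nat.cast_smul_eq_nsmul]

lemma IsLift.orbitSum_coe (h : IsLift τ π) (hell : ∀ z : H, h.restrict z = z → z = 0) {n : ℕ}
    (hτ : ∀ x, lieIter τ n x = x) (α : H.root) : orbitSum τ n (rootH α : L) = 0 := by
  have h1 := h.sum_rootH_eq_zero hell ((h.iterate n).eq_of_forall_apply hτ α)
  rw [orbitSum_apply, Finset.sum_congr rfl fun k _ => (h.iterate k).map_rootH α]
  have h2 := congrArg (fun z : H => (z : L)) h1
  simpa using h2

/-- Orbit sums of root vectors form a basis of the fixed space. -/
lemma IsLift.exists_basis_fixedSpace (h : IsLift τ π)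
    (hell : ∀ z : H, h.restrict z = z → z = 0) {n : ℕ} (hn : 0 < n)
    (hτ : ∀ x, lieIter τ n x = x) (hmin : ∀ k, 0 < k → k < n → ∃ β, (π ^ k) β ≠ β)
    (E : RootVectors H) {s : ℕ} {γ : Fin s → H.root}
    (hγ : ∀ α : H.root, ∃! i : Fin s, ∃ k : ℕ, (π ^ k) (γ i) = α) :
    ∃ b : Module.Basis (Fin s) ℂ (fixedSpace τ), ∀ i, (b i : L) = orbitSum τ n (E.e (γ i)) := by
  classical
  let v : Fin s → fixedSpace τ := fun i => ⟨orbitSum τ n (E.e (γ i)), map_orbitSum hτ _⟩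
  -- Distinct orbits pair to zero. On the diagonal every power that fixes the root contributes 1, so
  -- the value is the positive number of such powers below n.
  have horth : ∀ i j, killingForm ℂ L (v i) (E.e (negRoot (γ j))) ≠ 0 ↔ i = j := by
    intro i j
    have h1 : killingForm ℂ L (v i) (E.e (negRoot (γ j))) = ∑ k ∈ Finset.range n,
        killingForm ℂ L (lieIter τ k (E.e (γ i))) (E.e (negRoot (γ j))) := by
      change killingForm ℂ L (orbitSum τ n (E.e (γ i))) _ = _
      rw [orbitSum_apply, map_sum, LinearMap.sum_apply]
    have h2 : ∀ k, (π ^ k) (γ i) ≠ γ j →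
        killingForm ℂ L (lieIter τ k (E.e (γ i))) (E.e (negRoot (γ j))) = 0 := by
      intro k hk
      rw [(h.iterate k).map_e, map_smul, LinearMap.smul_apply,
        killingForm_rsp_eq_zero _ (E.e_mem _) (E.e_mem _), smul_zero]
      intro h3
      have h4 := congrArg negRoot h3
      rw [negRoot_negRoot, negRoot_negRoot] at h4
      exact hk h4.symm
    rw [h1]
    constructor
    · intro hne
      obtain ⟨k, -, hk⟩ := Finset.exists_ne_zero_of_sum_ne_zero hne
      by_contra hij
      refine hk (h2 k fun h3 => hij ?_)
      exact (hγ (γ j)).unique ⟨k, h3⟩ ⟨0, rfl⟩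
    · rintro rfl
      have h3 : ∀ k, killingForm ℂ L (lieIter τ k (E.e (γ i))) (E.e (negRoot (γ i))) =
          (((if (π ^ k) (γ i) = γ i then 1 else 0 : ℕ)) : ℂ) := by
        intro k
        split_ifs with hk
        · rw [h.lieIter_apply_eq hell hn hτ hmin hk (E.e_mem _), E.killingForm_e_neg, Nat.cast_one]
        · rw [h2 k hk, Nat.cast_zero]
      simp only [h3]
      rw [← Nat.cast_sum, Nat.cast_ne_zero]
      refine (Finset.sum_pos' (fun _ _ => Nat.zero_le _) ⟨0, Finset.mem_range.mpr hn, ?_⟩).ne'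
      rw [pow_zero, Equiv.Perm.one_apply, if_pos rfl]; exact one_pos
  have hli : LinearIndependent ℂ v := by
    rw [Fintype.linearIndependent_iff]
    intro g hg j
    have h1 := congrArg (fun x : fixedSpace τ => killingForm ℂ L (x : L) (E.e (negRoot (γ j)))) hg
    simp only [Submodule.coe_sum, Submodule.coe_smul, map_sum, map_smul, LinearMap.sum_apply,
      LinearMap.smul_apply, Submodule.coe_zero, map_zero, LinearMap.zero_apply] at h1
    rw [Finset.sum_eq_single_of_mem j (Finset.mem_univ j) fun i _ hij => by
      rw [not_ne_iff.mp (mt (horth i j).mp hij), smul_zero]] at h1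
    exact (smul_eq_zero.mp h1).resolve_right ((horth j j).mpr rfl)
  have hmem : ∀ x : L, orbitSum τ n x ∈ (Submodule.span ℂ (Set.range v)).map
      (fixedSpace τ).subtype := by
    intro x
    rw [E.eq_sum x, map_add, map_sum, map_sum]
    refine Submodule.add_mem _ (Submodule.sum_mem _ fun α _ => ?_) (Submodule.sum_mem _ fun α _ => ?_)
    · rw [map_smul, h.orbitSum_coe hell hτ, smul_zero]
      exact Submodule.zero_mem _
    · rw [map_smul]
      refine Submodule.smul_mem _ _ ?_
      obtain ⟨i, ⟨k, hk⟩, -⟩ := hγ α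
      have h1 := congrArg (orbitSum τ n) ((h.iterate k).map_e E (γ i))
      rw [orbitSum_lieIter hτ, map_smul, hk] at h1
      have h2 : orbitSum τ n (E.e α) =
          (E.liftCoeff (lieIter τ k) (π ^ k) (γ i))⁻¹ • orbitSum τ n (E.e (γ i)) := by
        rw [h1, smul_smul, inv_mul_cancel₀ ((h.iterate k).liftCoeff_ne_zero E _), one_smul]
      rw [h2]
      exact Submodule.smul_mem _ _ ⟨v i, Submodule.subset_span ⟨i, rfl⟩, rfl⟩
  refine ⟨Module.Basis.mk hli fun x _ => ?_, fun i => by rw [Module.Basis.mk_apply]⟩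
  -- A fixed vector is the orbit sum of its n-th part.
  obtain ⟨y, hy, hyx⟩ := hmem ((n : ℂ)⁻¹ • (x : L))
  rw [map_smul, orbitSum_of_mem x.2, smul_smul,
    inv_mul_cancel₀ (Nat.cast_ne_zero.mpr hn.ne'), one_smul] at hyx
  have : y = x := Subtype.ext hyx
  rwa [← this]

lemma RootVectors.root_conjStar (E : RootVectors H) (α : H.root) (z : H) :
    (rootSystem H).root α ⟨E.conjStar (z : L), E.conjStar_coe z⟩ =
      (starRingEnd ℂ) ((rootSystem H).root α z) := by
  have h1 : (⟨E.conjStar (z : L), E.conjStar_coe z⟩ : H) =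
      ∑ β : H.root, (starRingEnd ℂ) ((rootSystem H).root β z) • rootH β := by
    apply Subtype.ext
    have h2 : (z : L) = ∑ β : H.root, (rootSystem H).root β z • (rootH β : L) := by
      conv_lhs => rw [eq_sum_rootH z]
      simp
    change E.conjStar (z : L) = _
    rw [h2, map_sum]
    simp only [LinearMap.map_smulₛₗ, E.conjStar_rootH]
    simp
  rw [h1]
  conv_rhs => rw [eq_sum_rootH z]
  simp only [map_sum, map_smul, smul_eq_mul, map_mul, conj_root_rootH]

/-- The operator `ad (*Λ) ∘ ad Λ`. -/
def RootVectors.massOp (E : RootVectors H) (Λ : H) : L →ₗ[ℂ] L :=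
  ad ℂ L (E.conjStar (Λ : L)) ∘ₗ ad ℂ L (Λ : L)

namespace RootVectors

variable (E : RootVectors H) (Λ : H)

lemma massOp_apply (x : L) : E.massOp Λ x = ⁅E.conjStar (Λ : L), ⁅(Λ : L), x⁆⁆ := rfl

lemma massOp_of_mem {α : H.root} {x : L} (hx : x ∈ rsp α) :
    E.massOp Λ x = ((‖(rootSystem H).root α Λ‖ ^ 2 : ℝ) : ℂ) • x := by
  rw [massOp_apply, lie_coe_rsp hx, lie_smul,
    lie_coe_rsp hx ⟨E.conjStar (Λ : L), E.conjStar_coe Λ⟩, E.root_conjStar, smul_smul,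
    Complex.mul_conj, Complex.normSq_eq_norm_sq]

lemma lie_coe_coe (y z : H) : ⁅(y : L), (z : L)⁆ = 0 := by
  have h1 : ⁅y, z⁆ = 0 := trivial_lie_zero H H y z
  have h2 := congrArg (fun w : H => (w : L)) h1
  exact h2

lemma massOp_coe (z : H) : E.massOp Λ (z : L) = 0 := by
  rw [massOp_apply, lie_coe_coe, lie_zero]

lemma massOp_conjStar (x : L) : E.massOp Λ (E.conjStar x) = E.conjStar (E.massOp Λ x) := by
  refine semilinear_ext (f := ((E.massOp Λ).comp E.conjStar : L →ₛₗ[starRingEnd ℂ] L))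
    (g := (E.conjStar.comp (E.massOp Λ) : L →ₛₗ[starRingEnd ℂ] L)) E (fun α => ?_) (fun α => ?_) x
  · change E.massOp Λ (E.conjStar (rootH α : L)) = E.conjStar (E.massOp Λ (rootH α : L))
    rw [E.conjStar_rootH, massOp_coe, map_zero]
  · change E.massOp Λ (E.conjStar (E.e α)) = E.conjStar (E.massOp Λ (E.e α))
    rw [E.conjStar_e, E.massOp_of_mem Λ (E.e_mem _), E.massOp_of_mem Λ (E.e_mem _),
      LinearMap.map_smulₛₗ, Complex.conj_ofReal, E.conjStar_e, root_negRoot, LinearMap.neg_apply,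
      norm_neg]

/-- Each ad is skew for the Killing form, and the two factors commute because both elements lie in
`H`. -/
lemma killingForm_massOp (x y : L) :
    killingForm ℂ L (E.massOp Λ x) y = killingForm ℂ L x (E.massOp Λ y) := by
  rw [massOp_apply, massOp_apply, ← lie_skew, map_neg, LinearMap.neg_apply, killingForm_lie,
    ← lie_skew, map_neg, LinearMap.neg_apply, killingForm_lie, neg_neg, leibniz_lie,
    lie_coe_coe Λ ⟨_, E.conjStar_coe Λ⟩, zero_lie, zero_add]

/-- Λ and its conjugate are scaled by μ and its conjugate, whose product is 1. -/
lemma massOp_map {μ : ℂ} (hμ : ‖μ‖ = 1) (hΛ : τ (Λ : L) = μ • (Λ : L))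
    (hcomm : ∀ x, τ (E.conjStar x) = E.conjStar (τ x)) (x : L) :
    τ (E.massOp Λ x) = E.massOp Λ (τ x) := by
  rw [massOp_apply, LieEquiv.map_lie, LieEquiv.map_lie, hcomm, hΛ, LinearMap.map_smulₛₗ, smul_lie,
    smul_lie, lie_smul, smul_smul, mul_comm, Complex.mul_conj, Complex.normSq_eq_norm_sq, hμ]
  simp [massOp_apply]

lemma killingForm_conjStar (x y : L) : killingForm ℂ L x (E.conjStar y) =
    ∑ α : H.root, (starRingEnd ℂ) (killingForm ℂ L y (rootH α)) * killingForm ℂ L x (rootH α) +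
    ∑ α : H.root, (starRingEnd ℂ) (killingForm ℂ L y (E.e (negRoot α))) *
      killingForm ℂ L x (E.e (negRoot α)) := by
  rw [conjStar_apply]
  simp only [map_add, map_sum, map_smul, smul_eq_mul]

lemma conj_killingForm {x y : L} (hx : E.conjStar x = x) (hy : E.conjStar y = y) :
    (starRingEnd ℂ) (killingForm ℂ L x y) = killingForm ℂ L x y := by
  conv_rhs => rw [killingForm_comm, ← hx, killingForm_conjStar]
  conv_lhs => rw [← hy, killingForm_conjStar]
  simp only [map_add, map_sum, map_mul, Complex.conj_conj]
  congr 1 <;> exact Finset.sum_congr rfl fun _ _ => mul_comm _ _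

lemma ofReal_re_killingForm {x y : L} (hx : E.conjStar x = x) (hy : E.conjStar y = y) :
    ((killingForm ℂ L x y).re : ℂ) = killingForm ℂ L x y :=
  Complex.conj_eq_iff_re.mp (E.conj_killingForm hx hy)

/-- For a fixed vector of the involution the Killing form is the sum of the squared absolute values
of its coefficients. -/
lemma killingForm_self_pos {x : L} (hx : E.conjStar x = x) (hx0 : x ≠ 0) :
    0 < (killingForm ℂ L x x).re := by
  have h1 : (killingForm ℂ L x x).re = ∑ α : H.root, ‖killingForm ℂ L x (rootH α)‖ ^ 2 +
      ∑ α : H.root, ‖killingForm ℂ L x (E.e (negRoot α))‖ ^ 2 := by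
    nth_rewrite 2 [← hx]
    rw [killingForm_conjStar]
    simp only [mul_comm ((starRingEnd ℂ) _), Complex.mul_conj, Complex.normSq_eq_norm_sq]
    rw [← Complex.ofReal_sum, ← Complex.ofReal_sum, ← Complex.ofReal_add, Complex.ofReal_re]
  rw [h1]
  have e1 : 0 ≤ ∑ α : H.root, ‖killingForm ℂ L x (rootH α)‖ ^ 2 :=
    Finset.sum_nonneg fun _ _ => sq_nonneg _
  have e2 : 0 ≤ ∑ α : H.root, ‖killingForm ℂ L x (E.e (negRoot α))‖ ^ 2 :=
    Finset.sum_nonneg fun _ _ => sq_nonneg _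
  refine (add_nonneg e1 e2).lt_of_ne' fun h0 => hx0 ?_
  have f1 := (Finset.sum_eq_zero_iff_of_nonneg fun _ _ => sq_nonneg _).mp
    ((add_eq_zero_iff_of_nonneg e1 e2).mp h0).1
  have f2 := (Finset.sum_eq_zero_iff_of_nonneg fun _ _ => sq_nonneg _).mp
    ((add_eq_zero_iff_of_nonneg e1 e2).mp h0).2
  rw [← hx, conjStar_apply]
  rw [Finset.sum_eq_zero fun α hα => by
      rw [norm_eq_zero.mp (pow_eq_zero_iff two_ne_zero |>.mp (f1 α hα)), map_zero, zero_smul],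
    Finset.sum_eq_zero fun α hα => by
      rw [norm_eq_zero.mp (pow_eq_zero_iff two_ne_zero |>.mp (f2 α hα)), map_zero, zero_smul],
    add_zero]

end RootVectors

end MassOperator


/-! ### Simultaneous diagonalization and expansion of the exponential -/

section Analysis

/-- It serves to compare two diagonalizations of the same operator: both lists of eigenvalues are
the roots of one polynomial. -/
lemma charpoly_roots_of_diagonal {W ι : Type*} [AddCommGroup W] [Module ℂ W] [Fintype ι]
    [Module.Free ℂ W] [Module.Finite ℂ W] (T : W →ₗ[ℂ] W) (b : Module.Basis ι ℂ W) {a : ι → ℂ}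
    (hb : ∀ i, T (b i) = a i • b i) : T.charpoly.roots = Finset.univ.val.map a := by
  classical
  have h1 : LinearMap.toMatrix b b T = Matrix.diagonal a := by
    ext i j
    rw [LinearMap.toMatrix_apply, hb, map_smul, Finsupp.smul_apply, Module.Basis.repr_self,
      Matrix.diagonal_apply, Finsupp.single_apply, smul_eq_mul]
    by_cases hij : i = j
    · subst hij; simp
    · rw [if_neg (Ne.symm hij), if_neg hij, mul_zero]
  rw [← LinearMap.charpoly_toMatrix T b, h1, Matrix.charpoly_diagonal]
  have h2 := Polynomial.roots_multiset_prod_X_sub_C (Finset.univ.val.map a)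
  rw [Multiset.map_map] at h2
  exact h2

/-- Simultaneous diagonalization of a scalar product and a self-adjoint operator. -/
lemma exists_orthonormal_diagonal {V : Type*} [AddCommGroup V] [Module ℝ V] [FiniteDimensional ℝ V]
    (B : V →ₗ[ℝ] V →ₗ[ℝ] ℝ) (hB : ∀ x y, B x y = B y x) (hpos : ∀ x, x ≠ 0 → 0 < B x x)
    (T : V →ₗ[ℝ] V) (hT : ∀ x y, B (T x) y = B x (T y)) :
    ∃ (s : ℕ) (X : (Fin s → ℝ) ≃ₗ[ℝ] V) (a : Fin s → ℝ), (∀ v, B (X v) (X v) = ∑ i, v i ^ 2) ∧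
      ∀ v, B (X v) (T (X v)) = ∑ i, a i * v i ^ 2 := by
  let core : InnerProductSpace.Core ℝ V :=
    { inner := fun x y => B x y
      conj_inner_symm := fun x y => hB y x
      re_inner_nonneg := fun x => by
        rcases eq_or_ne x 0 with rfl | hx
        · simp
        · exact (hpos x hx).le
      add_left := fun x y z => by simp
      smul_left := fun x y r => by simp
      definite := fun x hx => by
        by_contra h
        exact (hpos x h).ne' hx }
  let _ : NormedAddCommGroup V := core.toNormedAddCommGroup
  let _ : InnerProductSpace ℝ V := InnerProductSpace.ofCore core.toCore
  have hin : ∀ x y : V, inner ℝ x y = B x y := fun _ _ => rfl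
  have hT' : T.IsSymmetric := fun x y => hT x y
  let b := hT'.eigenvectorBasis rfl
  have horth : ∀ i j, B (b i) (b j) = if i = j then 1 else 0 := fun i j => by
    rw [← hin]; exact (orthonormal_iff_ite.mp b.orthonormal) i j
  have hTb : ∀ i, T (b i) = hT'.eigenvalues rfl i • b i := fun i => 
    hT'.apply_eigenvectorBasis rfl i
  have hX : ∀ v, b.toBasis.equivFun.symm v = ∑ i, v i • b i := fun v => by
    rw [Module.Basis.equivFun_symm_apply]
    simp
  refine ⟨_, b.toBasis.equivFun.symm, hT'.eigenvalues rfl, fun v => ?_, fun v => ?_⟩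
  · rw [hX]
    simp only [map_sum, LinearMap.sum_apply, map_smul, LinearMap.smul_apply, horth, smul_eq_mul,
      mul_ite, mul_one, mul_zero, Finset.sum_ite_eq', Finset.mem_univ, if_true, sq]
  · rw [hX]
    simp only [map_sum, LinearMap.sum_apply, map_smul, LinearMap.smul_apply, hTb, horth, smul_eq_mul,
      mul_ite, mul_one, mul_zero, Finset.sum_ite_eq', Finset.mem_univ, if_true]
    exact Finset.sum_congr rfl fun i _ => by ring

/-- A quadratic polynomial without linear term that is of third order vanishes. -/
lemma eq_zero_of_isBigO {a b : ℂ} {F : Type*} [NormedAddCommGroup F] [NormedSpace ℝ F] (w : F)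
    (h : (fun t : ℝ => (t : ℂ) ^ 2 * a + b) =O[𝓝 0] fun t : ℝ => ‖t • w‖ ^ 3) :
    a = 0 ∧ b = 0 := by
  obtain ⟨C, hC⟩ := h.bound
  have hb : b = 0 := by
    have := hC.self_of_nhds
    simpa using this
  refine ⟨?_, hb⟩
  subst hb
  -- The cubic bound is divided by t².
  have h1 : ∀ᶠ t : ℝ in 𝓝[>] 0, ‖a‖ ≤ C * ‖w‖ ^ 3 * t := by
    filter_upwards [nhdsWithin_le_nhds hC, self_mem_nhdsWithin] with t ht (ht0 : 0 < t)
    simp only [add_zero, norm_mul, norm_pow, Complex.norm_real, norm_smul, Real.norm_eq_abs,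
      abs_of_pos ht0, abs_of_nonneg (norm_nonneg _)] at ht
    refine le_of_mul_le_mul_left ?_ (pow_pos ht0 2)
    calc t ^ 2 * ‖a‖ ≤ _ := ht
      _ = _ := by ring
  have h2 : Tendsto (fun t : ℝ => C * ‖w‖ ^ 3 * t) (𝓝[>] 0) (𝓝 0) := by
    have : Tendsto (fun t : ℝ => C * ‖w‖ ^ 3 * t) (𝓝 0) (𝓝 (C * ‖w‖ ^ 3 * 0)) :=
      (continuous_const.mul continuous_id).tendsto 0
    rw [mul_zero] at this
    exact this.mono_left nhdsWithin_le_nhds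
  have h3 : ‖a‖ ≤ 0 := ge_of_tendsto h2 h1
  exact norm_le_zero_iff.mp h3

open scoped Matrix.Norms.Operator in
lemma isBigO_exp_sub {n : Type*} [Fintype n] [DecidableEq n] :
    (fun M : Matrix n n ℂ => NormedSpace.exp M - (1 + M + (1 / 2 : ℂ) • (M * M)))
      =O[𝓝 0] fun M => ‖M‖ ^ 3 := by
  have h := (NormedSpace.exp_hasFPowerSeriesAt_zero (𝕂 := ℂ)
    (𝔸 := Matrix n n ℂ)).isBigO_sub_partialSum_pow 3
  refine h.congr_left fun M => ?_
  rw [FormalMultilinearSeries.partialSum, zero_add]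
  simp only [Finset.sum_range_succ, Finset.sum_range_zero, NormedSpace.expSeries_apply_eq]
  simp [sq, Nat.factorial]
  rfl

/-- The expansion of the matrix coefficients of `exp` up to second order. -/
lemma isBigO_expEnd {F : Type*} [NormedAddCommGroup F] [NormedSpace ℝ F] [FiniteDimensional ℝ F]
    (f : F →ₗ[ℝ] Module.End ℂ L) (g : L →ₗ[ℂ] ℂ) (x : L) :
    (fun v : F => g (expEnd (f v) x) - (g x + g (f v x) + 1 / 2 * g (f v (f v x))))
      =O[𝓝 0] fun v => ‖v‖ ^ 3 := by
  open scoped Matrix.Norms.Operator in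
  let b := Module.finBasis ℂ L
  let m : F →ₗ[ℝ] Matrix _ _ ℂ := ((LinearMap.toMatrix b b).restrictScalars ℝ).toLinearMap ∘ₗ f
  let G : Matrix _ _ ℂ →ₗ[ℂ] ℂ := g ∘ₗ LinearMap.applyₗ x ∘ₗ (Matrix.toLin b b).toLinearMap
  have hG : ∀ M, G M = g (Matrix.toLin b b M x) := fun _ => rfl
  have hm : ∀ v, m v = LinearMap.toMatrix b b (f v) := fun _ => rfl
  have hmO : (fun v => m v) =O[𝓝 0] fun v => v := by
    exact (LinearMap.toContinuousLinearMap m).isBigO_id _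
  have hm0 : Tendsto m (𝓝 0) (𝓝 0) := by
    have := (LinearMap.continuous_of_finiteDimensional m).tendsto 0
    rwa [map_zero] at this
  have h1 := (isBigO_exp_sub.comp_tendsto hm0).trans ((hmO.norm_norm).pow 3)
  have h2 := (((LinearMap.toContinuousLinearMap G).isBigO_comp _ _).trans h1)
  refine h2.congr_left fun v => ?_
  change G (NormedSpace.exp (m v) - (1 + m v + (1 / 2 : ℂ) • (m v * m v))) = _
  rw [map_sub, map_add, map_add, map_smul, hG, hG, hG, hG, Matrix.toLin_one, Matrix.toLin_mul b b b,
    hm, Matrix.toLin_toMatrix]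
  rfl

end Analysis


/-! ### The mass spectrum of the Toda–Weyl Lagrangian -/

section MassSpectrum

variable (E : RootVectors H) (Λ : H)

/-- Invariance moves the brackets to the other argument: the linear term becomes the pairing with
the bracket of Λ and *Λ, which is zero, and the quadratic one becomes the form of `massOp`. -/
lemma isBigO_todaWeyl {s : ℕ} {V : Submodule ℝ L} (X : (Fin s → ℝ) ≃ₗ[ℝ] V) :
    (fun j : (Fin s → ℝ) × (Fin 2 → Fin s → ℝ) =>
      todaWeyl V (Λ : L) (E.conjStar (Λ : L)) (X j.1) (fun ν => X (j.2 ν)) -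
        (1 / 2 * (killingForm ℂ L (X (j.2 0) : L) (X (j.2 0) : L) -
            killingForm ℂ L (X (j.2 1) : L) (X (j.2 1) : L)) -
          killingForm ℂ L (Λ : L) (E.conjStar (Λ : L)) -
          1 / 2 * killingForm ℂ L (X j.1 : L) (E.massOp Λ (X j.1 : L))))
      =O[𝓝 0] fun j => ‖j‖ ^ 3 := by
  let f : (Fin s → ℝ) →ₗ[ℝ] Module.End ℂ L :=
    ((ad ℂ L : L →ₗ[ℂ] Module.End ℂ L).restrictScalars ℝ) ∘ₗ V.subtype ∘ₗ X.toLinearMap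
  have hf : ∀ v y, f v y = ⁅(X v : L), y⁆ := fun _ _ => rfl
  have h1 := isBigO_expEnd f ((killingForm ℂ L).flip (E.conjStar (Λ : L))) (Λ : L)
  have h2 : Tendsto (fun j : (Fin s → ℝ) × (Fin 2 → Fin s → ℝ) => j.1) (𝓝 0) (𝓝 0) :=
    continuous_fst.tendsto 0
  have h3 : (fun j : (Fin s → ℝ) × (Fin 2 → Fin s → ℝ) => ‖j.1‖ ^ 3) =O[𝓝 0] fun j => ‖j‖ ^ 3 :=
    ((Asymptotics.isBigO_fst_prod').norm_norm).pow 3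
  refine ((h1.comp_tendsto h2).trans h3).neg_left.congr_left fun j => ?_
  have e1 : killingForm ℂ L ⁅(X j.1 : L), (Λ : L)⁆ (E.conjStar (Λ : L)) = 0 := by
    rw [killingForm_lie, RootVectors.lie_coe_coe Λ ⟨_, E.conjStar_coe Λ⟩, map_zero]
  have e2 : killingForm ℂ L ⁅(X j.1 : L), ⁅(X j.1 : L), (Λ : L)⁆⁆ (E.conjStar (Λ : L)) =
      killingForm ℂ L (X j.1 : L) (E.massOp Λ (X j.1 : L)) := by
    rw [killingForm_lie, E.massOp_apply, ← lie_skew (E.conjStar (Λ : L)), ← lie_skew (Λ : L),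
      neg_lie, neg_neg]
  have e3 : ∀ y, (killingForm ℂ L).flip (E.conjStar (Λ : L)) y =
      killingForm ℂ L y (E.conjStar (Λ : L)) := fun _ => rfl
  simp only [Function.comp_apply, hf, e1, e2, e3]
  change _ = 1 / 2 * (_ - _) - killingForm ℂ L (expEnd (f j.1) (Λ : L)) (E.conjStar (Λ : L)) - _
  ring

lemma killingForm_smul_smul (t : ℝ) (x y : L) :
    killingForm ℂ L (t • x) (t • y) = (t : ℂ) ^ 2 * killingForm ℂ L x y := by
  rw [← Complex.coe_smul t x, ← Complex.coe_smul t y, map_smul, map_smul, LinearMap.smul_apply,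
    smul_eq_mul, smul_eq_mul]
  ring

/-- The mass spectrum of the Toda–Weyl Lagrangian in terms of quadratic forms. -/
lemma isMassSpectrum_todaWeyl_iff {V : Submodule ℝ L} {M : Multiset ℝ} :
    IsMassSpectrum (todaWeyl V (Λ : L) (E.conjStar (Λ : L))) M ↔
      ∃ (s : ℕ) (X : (Fin s → ℝ) ≃ₗ[ℝ] V) (m : Fin s → ℝ), (∀ i, 0 ≤ m i) ∧
        M = Finset.univ.val.map m ∧
        (∀ v, killingForm ℂ L (X v : L) (X v : L) = ((∑ i, v i ^ 2 : ℝ) : ℂ)) ∧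
        ∀ v, killingForm ℂ L (X v : L) (E.massOp Λ (X v : L)) =
          ((∑ i, m i ^ 2 * v i ^ 2 : ℝ) : ℂ) := by
  constructor
  · rintro ⟨s, X, m, c, hm, hM, hO⟩
    have h1 := hO.sub (isBigO_todaWeyl E Λ X)
    -- Two expansions of the same density differ by a constant plus a quadratic form. Along each ray
    -- this is of third order, so the form vanishes.
    have key : ∀ (v : Fin s → ℝ) (p : Fin 2 → Fin s → ℝ),
        1 / 2 * (killingForm ℂ L (X (p 0) : L) (X (p 0) : L) -
            killingForm ℂ L (X (p 1) : L) (X (p 1) : L)) -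
          1 / 2 * killingForm ℂ L (X v : L) (E.massOp Λ (X v : L)) -
          (((1 / 2 * ∑ i, (p 0 i ^ 2 - p 1 i ^ 2) : ℝ) : ℂ) -
            ((1 / 2 * ∑ i, m i ^ 2 * v i ^ 2 : ℝ) : ℂ)) = 0 := by
      intro v p
      have h2 : Tendsto (fun t : ℝ => t • (v, p)) (𝓝 0) (𝓝 0) := by
        have : Continuous fun t : ℝ => t • (v, p) := by fun_prop
        simpa using this.tendsto 0
      have h3 := h1.comp_tendsto h2
      refine (eq_zero_of_isBigO (b := - killingForm ℂ L (Λ : L) (E.conjStar (Λ : L)) - c)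
        (v, p) (h3.congr_left fun t => ?_)).1
      have e1 : ∀ w : Fin s → ℝ, ((X (t • w) : V) : L) = t • (X w : L) := fun w => by
        rw [map_smul]; rfl
      have e2 : E.massOp Λ (t • (X v : L)) = t • E.massOp Λ (X v : L) := by
        rw [← Complex.coe_smul t, ← Complex.coe_smul t, map_smul]
      have e3 : (∑ i, ((t • p 0) i ^ 2 - (t • p 1) i ^ 2) : ℝ) =
          t ^ 2 * ∑ i, (p 0 i ^ 2 - p 1 i ^ 2) := by
        rw [Finset.mul_sum]
        refine Finset.sum_congr rfl fun i _ => ?_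
        simp only [Pi.smul_apply, smul_eq_mul]; ring
      have e4 : (∑ i, m i ^ 2 * (t • v) i ^ 2 : ℝ) = t ^ 2 * ∑ i, m i ^ 2 * v i ^ 2 := by
        rw [Finset.mul_sum]
        refine Finset.sum_congr rfl fun i _ => ?_
        simp only [Pi.smul_apply, smul_eq_mul]; ring
      simp only [Function.comp_apply, Prod.smul_fst, Prod.smul_snd]
      rw [show (t • p) 0 = t • p 0 from rfl, show (t • p) 1 = t • p 1 from rfl, e3, e4, e1, e1, e1,
        e2, killingForm_smul_smul, killingForm_smul_smul, killingForm_smul_smul]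
      push_cast
      ring
    refine ⟨s, X, m, hm, hM, fun v => ?_, fun v => ?_⟩
    · have h2 := key 0 ![v, 0]
      simp at h2
      push_cast
      linear_combination 2 * h2
    · have h2 := key v 0
      simp at h2
      push_cast
      linear_combination (-2) * h2
  · rintro ⟨s, X, m, hm, hM, h1, h2⟩
    refine ⟨s, X, m, -killingForm ℂ L (Λ : L) (E.conjStar (Λ : L)), hm, hM,
      (isBigO_todaWeyl E Λ X).congr_left fun j => ?_⟩
    rw [h1, h1, h2, Finset.sum_sub_distrib]
    push_cast
    ring

variable {τ : L ≃ₗ⁅ℂ⁆ L}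

lemma massOp_mem_fieldSpace {μ : ℂ} (hμ : ‖μ‖ = 1) (hΛ : τ (Λ : L) = μ • (Λ : L))
    (hcomm : ∀ x, τ (E.conjStar x) = E.conjStar (τ x)) {x : L}
    (hx : x ∈ fieldSpace τ E.conjStar) : E.massOp Λ x ∈ fieldSpace τ E.conjStar := by
  rw [mem_fieldSpace] at *
  rw [E.massOp_map Λ hμ hΛ hcomm, ← E.massOp_conjStar, hx.1, hx.2]
  exact ⟨rfl, rfl⟩

/-- The fixed space is stable under the commuting involution and is therefore the complexification
of the field space. -/
lemma exists_add_I_smul {x : L} (hcomm : ∀ x, τ (E.conjStar x) = E.conjStar (τ x))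
    (hx : τ x = x) : ∃ y ∈ fieldSpace τ E.conjStar, ∃ z ∈ fieldSpace τ E.conjStar,
      x = y + Complex.I • z := by
  refine ⟨(1 / 2 : ℂ) • (x + E.conjStar x), ⟨?_, ?_⟩,
    (-Complex.I / 2 : ℂ) • (x - E.conjStar x), ⟨?_, ?_⟩, ?_⟩
  · rw [map_smul, map_add, hcomm, hx]
  · rw [LinearMap.map_smulₛₗ, map_add, E.conjStar_conjStar, add_comm (E.conjStar x)]
    simp [Complex.conj_ofNat]
  · rw [map_smul, map_sub, hcomm, hx]
  · rw [LinearMap.map_smulₛₗ, map_sub, E.conjStar_conjStar, ← neg_sub x, smul_neg, ← neg_smul]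
    congr 1
    simp only [map_div₀, map_neg, Complex.conj_I, Complex.conj_ofNat]
    ring
  · rw [smul_smul, show Complex.I * (-Complex.I / 2) = 1 / 2 by
      rw [mul_div_assoc', mul_neg, Complex.I_mul_I, neg_neg], ← smul_add]
    rw [add_add_sub_cancel, ← two_smul ℂ x, smul_smul]
    norm_num

/-- The eigenvalues of the mass operator, computed from a diagonalization on the real field
space. -/
lemma IsLift.map_ofReal_eq {π : Equiv.Perm H.root} (h : IsLift τ π)
    (hell : ∀ z : H, h.restrict z = z → z = 0) {n : ℕ} (hn : 0 < n)
    (hτ : ∀ x, lieIter τ n x = x) (hmin : ∀ k, 0 < k → k < n → ∃ β, (π ^ k) β ≠ β)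
    {E : RootVectors H} {Λ : H} {s : ℕ} {γ : Fin s → H.root}
    (hγ : ∀ α : H.root, ∃! i : Fin s, ∃ k : ℕ, (π ^ k) (γ i) = α)
    {μ : ℂ} (hμ : ‖μ‖ = 1) (hΛ : τ (Λ : L) = μ • (Λ : L))
    (hcomm : ∀ x, τ (E.conjStar x) = E.conjStar (τ x)) {s' : ℕ}
    (X : (Fin s' → ℝ) ≃ₗ[ℝ] fieldSpace τ E.conjStar) {a : Fin s' → ℝ}
    (h1 : ∀ v, killingForm ℂ L (X v : L) (X v : L) = ((∑ i, v i ^ 2 : ℝ) : ℂ))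
    (h2 : ∀ v, killingForm ℂ L (X v : L) (E.massOp Λ (X v : L)) =
      ((∑ i, a i * v i ^ 2 : ℝ) : ℂ)) :
    Finset.univ.val.map a =
      Finset.univ.val.map fun i => ‖(rootSystem H).root (γ i) Λ‖ ^ 2 := by
  obtain ⟨b, hb⟩ := h.exists_basis_fixedSpace hell hn hτ hmin E hγ
  let T : fixedSpace τ →ₗ[ℂ] fixedSpace τ := (E.massOp Λ).restrict fun x hx => by
    rw [mem_fixedSpace] at *
    rw [E.massOp_map Λ hμ hΛ hcomm, hx]
  have hTb : ∀ i, T (b i) = ((‖(rootSystem H).root (γ i) Λ‖ ^ 2 : ℝ) : ℂ) • b i := by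
    intro i
    apply Subtype.ext
    change E.massOp Λ (b i : L) = _ • (b i : L)
    rw [hb, orbitSum_apply, map_sum, Finset.smul_sum]
    refine Finset.sum_congr rfl fun k _ => ?_
    have hk : ∀ k, ‖μ ^ k‖ = 1 ∧ lieIter τ k (Λ : L) = μ ^ k • (Λ : L) ∧
        ∀ x, lieIter τ k (E.conjStar x) = E.conjStar (lieIter τ k x) := by
      intro k
      induction k with
      | zero => exact ⟨by simp, by rw [pow_zero, one_smul]; rfl, fun x => rfl⟩
      | succ k ih =>
        refine ⟨by rw [norm_pow, hμ, one_pow], ?_, fun x => ?_⟩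
        · rw [lieIter_succ_apply, hΛ, map_smul, ih.2.1, smul_smul, pow_succ']
        · rw [lieIter_succ_apply, lieIter_succ_apply, hcomm, ih.2.2]
    rw [← E.massOp_map Λ (hk k).1 (hk k).2.1 (hk k).2.2, E.massOp_of_mem Λ (E.e_mem _), map_smul]
  -- Polarization turns the two quadratic identities into bilinear ones, from which `massOp` is read
  -- off in coordinates.
  have p1 : ∀ v w, killingForm ℂ L (X v : L) (X w : L) = ((∑ i, v i * w i : ℝ) : ℂ) := by
    intro v w
    have e1 := h1 (v + w)
    have e2 : (∑ i, (v + w) i ^ 2 : ℝ) = ∑ i, v i ^ 2 + 2 * ∑ i, v i * w i + ∑ i, w i ^ 2 := by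
      rw [Finset.mul_sum, ← Finset.sum_add_distrib, ← Finset.sum_add_distrib]
      exact Finset.sum_congr rfl fun i _ => by rw [Pi.add_apply]; ring
    rw [e2, map_add, Submodule.coe_add, map_add, map_add, LinearMap.add_apply, LinearMap.add_apply,
      h1, h1, killingForm_comm (X w : L)] at e1
    rw [Complex.ofReal_add, Complex.ofReal_add, Complex.ofReal_mul, Complex.ofReal_ofNat] at e1
    linear_combination (1 / 2 : ℂ) * e1
  have p2 : ∀ v w, killingForm ℂ L (X v : L) (E.massOp Λ (X w : L)) =
      ((∑ i, v i * (a i * w i) : ℝ) : ℂ) := by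
    intro v w
    have e1 := h2 (v + w)
    have e2 : (∑ i, a i * (v + w) i ^ 2 : ℝ) =
        ∑ i, a i * v i ^ 2 + 2 * ∑ i, v i * (a i * w i) + ∑ i, a i * w i ^ 2 := by
      rw [Finset.mul_sum, ← Finset.sum_add_distrib, ← Finset.sum_add_distrib]
      exact Finset.sum_congr rfl fun i _ => by rw [Pi.add_apply]; ring
    rw [e2, map_add, Submodule.coe_add, map_add, map_add, map_add, LinearMap.add_apply,
      LinearMap.add_apply, h2, h2, killingForm_comm (X w : L), E.killingForm_massOp] at e1
    rw [Complex.ofReal_add, Complex.ofReal_add, Complex.ofReal_mul, Complex.ofReal_ofNat] at e1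
    linear_combination (1 / 2 : ℂ) * e1
  have hAX : ∀ w, E.massOp Λ (X w : L) = X fun i => a i * w i := by
    intro w
    have hm := massOp_mem_fieldSpace E Λ hμ hΛ hcomm (X w).2
    obtain ⟨u, hu⟩ := X.surjective ⟨_, hm⟩
    have hu' : E.massOp Λ (X w : L) = (X u : L) := by rw [hu]
    rw [hu']
    congr 2
    funext i
    classical
    have e1 := p2 (Pi.single i 1) w
    rw [hu', p1] at e1
    have e2 := Complex.ofReal_injective e1
    simpa [Pi.single_apply] using e2
  -- The real coordinate vectors, orthonormal for the Killing form, become a complex basis of 𝔤₀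
  -- consisting of eigenvectors.
  let c : Fin s' → fixedSpace τ := fun i => ⟨X (Pi.single i 1), (X (Pi.single i 1)).2.1⟩
  have hc : ∀ i, (c i : L) = X (Pi.single i 1) := fun _ => rfl
  have hcc : ∀ i j, killingForm ℂ L (c i : L) (c j : L) = if i = j then 1 else 0 := by
    intro i j
    rw [hc, hc, p1]
    by_cases hij : i = j
    · subst hij; simp [Pi.single_apply]
    · simp [Pi.single_apply, hij, Ne.symm hij]
  have hli : LinearIndependent ℂ c := by
    rw [Fintype.linearIndependent_iff]
    intro g hg j
    have e1 := congrArg (fun x : fixedSpace τ => killingForm ℂ L (x : L) (c j : L)) hg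
    simpa [Submodule.coe_sum, LinearMap.sum_apply, hcc] using e1
  have hV : ∀ y ∈ fieldSpace τ E.conjStar, y ∈ (Submodule.span ℂ (Set.range c)).map
      (fixedSpace τ).subtype := by
    intro y hy
    obtain ⟨v, hv⟩ := X.surjective ⟨y, hy⟩
    have e1 : y = ∑ i, (v i : ℂ) • (c i : L) := by
      have e2 : v = ∑ i, v i • Pi.single i (1 : ℝ) := by
        funext j; simp [Finset.sum_apply, Pi.single_apply]
      have e3 := congrArg (fun z : fieldSpace τ E.conjStar => (z : L)) hv
      change (X v : L) = y at e3
      rw [← e3]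
      conv_lhs => rw [e2]
      rw [map_sum, Submodule.coe_sum]
      refine Finset.sum_congr rfl fun i _ => ?_
      rw [map_smul, hc]; rfl
    rw [e1]
    exact Submodule.sum_mem _ fun i _ => Submodule.smul_mem _ _
      ⟨c i, Submodule.subset_span ⟨i, rfl⟩, rfl⟩
  have hspan : ⊤ ≤ Submodule.span ℂ (Set.range c) := by
    intro x _
    obtain ⟨y, hy, z, hz, hxyz⟩ := exists_add_I_smul E hcomm x.2
    have e1 : (x : L) ∈ (Submodule.span ℂ (Set.range c)).map (fixedSpace τ).subtype := by
      rw [hxyz]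
      exact Submodule.add_mem _ (hV y hy) (Submodule.smul_mem _ _ (hV z hz))
    obtain ⟨x', hx', e2⟩ := e1
    have e3 : x' = x := Subtype.ext e2
    rwa [← e3]
  let b' := Module.Basis.mk hli hspan
  have hTb' : ∀ i, T (b' i) = ((a i : ℝ) : ℂ) • b' i := by
    intro i
    rw [Module.Basis.mk_apply]
    apply Subtype.ext
    change E.massOp Λ (X (Pi.single i 1) : L) = (a i : ℂ) • (X (Pi.single i 1) : L)
    rw [hAX, Complex.coe_smul]
    have : (fun j => a j * (Pi.single i 1 : Fin s' → ℝ) j) = a i • Pi.single i (1 : ℝ) := by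
      funext j
      by_cases hij : j = i
      · subst hij; simp
      · simp [hij]
    rw [this, map_smul]; rfl
  have e1 := (charpoly_roots_of_diagonal T b' hTb').symm.trans (charpoly_roots_of_diagonal T b hTb)
  refine Multiset.map_injective Complex.ofReal_injective ?_
  rw [Multiset.map_map, Multiset.map_map]
  exact e1

/-- Any mass spectrum is forced by the eigenvalues of `massOp` on 𝔤₀. One exists because `massOp` is
self-adjoint for the positive definite Killing form on the field space. -/
theorem IsLift.isMassSpectrum_iff {π : Equiv.Perm H.root} (h : IsLift τ π)
    (hell : ∀ z : H, h.restrict z = z → z = 0) {n : ℕ} (hn : 0 < n)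
    (hτ : ∀ x, lieIter τ n x = x) (hmin : ∀ k, 0 < k → k < n → ∃ β, (π ^ k) β ≠ β)
    {E : RootVectors H} {Λ : H} {s : ℕ} {γ : Fin s → H.root}
    (hγ : ∀ α : H.root, ∃! i : Fin s, ∃ k : ℕ, (π ^ k) (γ i) = α)
    {μ : ℂ} (hμ : ‖μ‖ = 1) (hΛ : τ (Λ : L) = μ • (Λ : L))
    (hcomm : ∀ x, τ (E.conjStar x) = E.conjStar (τ x)) (M : Multiset ℝ) :
    IsMassSpectrum (todaWeyl (fieldSpace τ E.conjStar) (Λ : L) (E.conjStar (Λ : L))) M ↔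
      M = Finset.univ.val.map fun i => ‖(rootSystem H).root (γ i) Λ‖ := by
  rw [isMassSpectrum_todaWeyl_iff]
  have hsqrt : ∀ {s : ℕ} (f : Fin s → ℝ), (∀ i, 0 ≤ f i) →
      ((Finset.univ.val.map fun i => f i ^ 2).map Real.sqrt) = Finset.univ.val.map f := by
    intro s f hf
    rw [Multiset.map_map]
    exact Multiset.map_congr rfl fun i _ => Real.sqrt_sq (hf i)
  constructor
  · rintro ⟨s', X, m, hm, rfl, h1, h2⟩
    have h3 := h.map_ofReal_eq hell hn hτ hmin hγ hμ hΛ hcomm X h1 h2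
    rw [← hsqrt m hm, h3, hsqrt _ fun i => norm_nonneg _]
  · rintro rfl
    let V := fieldSpace τ E.conjStar
    let B : V →ₗ[ℝ] V →ₗ[ℝ] ℝ := LinearMap.mk₂ ℝ (fun x y => (killingForm ℂ L (x : L) (y : L)).re)
      (fun x y z => by simp) (fun r x y => by
        rw [Submodule.coe_smul, ← Complex.coe_smul r (x : L), map_smul, LinearMap.smul_apply]
        simp) (fun x y z => by simp) (fun r x y => by
        rw [Submodule.coe_smul, ← Complex.coe_smul r (y : L), map_smul]
        simp)
    have hB : ∀ x y : V, B x y = (killingForm ℂ L (x : L) (y : L)).re := fun _ _ => rfl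
    let T : V →ₗ[ℝ] V := ((E.massOp Λ).restrictScalars ℝ).restrict fun x hx =>
      massOp_mem_fieldSpace E Λ hμ hΛ hcomm hx
    have hT : ∀ x : V, (T x : L) = E.massOp Λ (x : L) := fun _ => rfl
    obtain ⟨s', X, a, h1, h2⟩ := exists_orthonormal_diagonal B
      (fun x y => by rw [hB, hB, killingForm_comm])
      (fun x hx => E.killingForm_self_pos x.2.2 fun h0 => hx (Subtype.ext h0)) T
      (fun x y => by rw [hB, hB, hT, hT, E.killingForm_massOp])
    have h1' : ∀ v, killingForm ℂ L (X v : L) (X v : L) = ((∑ i, v i ^ 2 : ℝ) : ℂ) := fun v => by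
      rw [← h1, hB, E.ofReal_re_killingForm (X v).2.2 (X v).2.2]
    have h2' : ∀ v, killingForm ℂ L (X v : L) (E.massOp Λ (X v : L)) =
        ((∑ i, a i * v i ^ 2 : ℝ) : ℂ) := fun v => by
      rw [← h2, hB]
      exact (E.ofReal_re_killingForm (X v).2.2 (T (X v)).2.2).symm
    have h3 := h.map_ofReal_eq hell hn hτ hmin hγ hμ hΛ hcomm X h1' h2'
    -- Nonnegativity is not part of the diagonalization; it comes from the identification with the
    -- squares |γ_i(Λ)|².
    have ha : ∀ i, 0 ≤ a i := by
      intro i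
      have h4 : a i ∈ Finset.univ.val.map a := Multiset.mem_map_of_mem a (Finset.mem_univ i)
      rw [h3] at h4
      obtain ⟨j, -, hj⟩ := Multiset.mem_map.mp h4
      rw [← hj]
      exact sq_nonneg _
    refine ⟨s', X, fun i => Real.sqrt (a i), fun i => Real.sqrt_nonneg _, ?_, h1', fun v => ?_⟩
    · rw [← hsqrt _ fun i => norm_nonneg _, ← h3, Multiset.map_map]
      rfl
    · rw [h2']
      simp only [Real.sq_sqrt (ha _)]

end MassSpectrum


/-! ### The orbits and the order of a lifted Weyl group element -/

section Orbits

variable {τ : L ≃ₗ⁅ℂ⁆ L} {π : Equiv.Perm H.root} {σ : H ≃ₗ[ℂ] H}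

lemma toLinearEquiv_pow_apply (τ : L ≃ₗ⁅ℂ⁆ L) (k : ℕ) (x : L) :
    (τ.toLinearEquiv ^ k) x = lieIter τ k x := by
  induction k generalizing x with
  | zero => rfl
  | succ k ih => rw [pow_succ, lieIter_succ_apply, ← ih]; rfl

lemma lieIter_coe (hlift : ∀ x : H, τ (x : L) = (σ x : L)) (k : ℕ) (z : H) :
    lieIter τ k (z : L) = ((σ ^ k) z : H) := by
  induction k generalizing z with
  | zero => rfl
  | succ k ih => rw [lieIter_succ_apply, hlift, ih, pow_succ]; rfl

/-- The t_α span `H`, so σ and π have the same trivial powers; in particular σ has finite order. -/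
lemma IsLift.pow_eq_one_of_forall (h : IsLift τ π) (hlift : ∀ x : H, τ (x : L) = (σ x : L)) {k : ℕ}
    (hk : ∀ β, (π ^ k) β = β) : σ ^ k = 1 := by
  refine LinearEquiv.ext fun z => Subtype.ext ?_
  have h1 : (z : L) = ∑ α : H.root, (rootSystem H).root α z • (rootH α : L) := by
    conv_lhs => rw [eq_sum_rootH z]
    simp
  rw [← lieIter_coe hlift]
  change _ = (z : L)
  conv_rhs => rw [h1]
  rw [h1, map_sum]
  refine Finset.sum_congr rfl fun α _ => ?_
  rw [map_smul, (h.iterate k).map_rootH, hk]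

lemma IsLift.orderOf_pos (h : IsLift τ π) (hlift : ∀ x : H, τ (x : L) = (σ x : L)) :
    0 < orderOf σ := by
  have h1 : σ ^ orderOf π = 1 := h.pow_eq_one_of_forall hlift fun β => by
    rw [pow_orderOf_eq_one, Equiv.Perm.one_apply]
  exact orderOf_pos_iff.mpr (isOfFinOrder_iff_pow_eq_one.mpr ⟨_, _root_.orderOf_pos π, h1⟩)

lemma IsLift.root_pow_apply (h : IsLift τ π) (hlift : ∀ x : H, τ (x : L) = (σ x : L)) (k : ℕ)
    (α : H.root) (z : H) :
    (rootSystem H).root ((π ^ k) α) ((σ ^ k) z) = (rootSystem H).root α z := by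
  rw [← killingForm_rootH, ← killingForm_rootH, ← (h.iterate k).map_rootH, ← lieIter_coe hlift,
    killingForm_of_equiv_apply]

lemma IsLift.sameOrbit_iff (h : IsLift τ π) (hlift : ∀ x : H, τ (x : L) = (σ x : L))
    (α β : H.root) : SameOrbit σ α β ↔ ∃ k : ℕ, (π ^ k) α = β := by
  constructor
  · rintro ⟨k, hk⟩
    have hpos := h.orderOf_pos hlift
    -- Finite order replaces an integral exponent by a natural one.
    refine ⟨(k % (orderOf σ : ℤ)).toNat, root_injective ?_⟩
    have h1 : σ ^ (k % (orderOf σ : ℤ)).toNat = σ ^ k := by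
      rw [← zpow_natCast, Int.toNat_of_nonneg (Int.emod_nonneg _ (by omega)), zpow_mod_orderOf]
    ext z
    obtain ⟨w, rfl⟩ := (σ ^ k).surjective z
    conv_lhs => rw [← h1, h.root_pow_apply hlift]
    exact (hk w).symm
  · rintro ⟨k, rfl⟩
    refine ⟨k, fun z => ?_⟩
    rw [zpow_natCast]
    exact h.root_pow_apply hlift k α z

end Orbits


end Simple

end TodaWeyl

end

/-! ### The main theorem -/

theorem mainTheorem1 {L : Type*} [LieRing L] [LieAlgebra ℂ L] [FiniteDimensional ℂ L]
    [LieAlgebra.IsSimple ℂ L]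
    -- the Cartan subalgebra and the Weyl group element
    (H : LieSubalgebra ℂ L) [H.IsCartanSubalgebra]
    (σ : H ≃ₗ[ℂ] H) (hσ : σ ∈ TodaWeyl.weylGroup H)
    -- condition (i)
    (hone : ¬ Module.End.HasEigenvalue (σ : Module.End ℂ H) 1)
    -- condition (ii)
    (τ : L ≃ₗ⁅ℂ⁆ L) (hinner : τ.toLinearEquiv ∈ TodaWeyl.innerAut L)
    (hlift : ∀ x : H, τ (x : L) = (σ x : L))
    (horder : orderOf τ.toLinearEquiv = orderOf σ)
    -- the eigenvector and the orbit representatives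
    (Λp : H) (μ : ℂ) (hΛ : Module.End.HasEigenvector (σ : Module.End ℂ H) μ Λp)
    (s : ℕ) (γ : Fin s → H.root)
    (hγ : ∀ α : H.root, ∃! i : Fin s, TodaWeyl.SameOrbit σ (γ i) α) :
    -- there is an involution of compact type that commutes with the lift
    (∃ (E : TodaWeyl.RootVectors H) (star : L →ₛₗ[starRingEnd ℂ] L),
      E.IsCompactType ∧ E.IsInvolution star ∧ ∀ x : L, τ (star x) = star (τ x)) ∧
    -- and for every involution that commutes with the lift the masses are as claimed
    (∀ (E : TodaWeyl.RootVectors H) (star : L →ₛₗ[starRingEnd ℂ] L),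
      E.IsInvolution star → (∀ x : L, τ (star x) = star (τ x)) →
      ∀ M : Multiset ℝ,
        TodaWeyl.IsMassSpectrum
          (TodaWeyl.todaWeyl (TodaWeyl.fieldSpace τ star) (Λp : L) (star (Λp : L))) M ↔
        M = Finset.univ.val.map
          (fun i : Fin s => ‖(γ i : LieModule.Weight ℂ H L) Λp‖)) := by
  obtain ⟨π, h⟩ := TodaWeyl.exists_isLift τ σ hlift
  have hrestr : ∀ z : H, h.restrict z = σ z := fun z => Subtype.ext (hlift z)
  have hell : ∀ z : H, h.restrict z = z → z = 0 := by
    intro z hz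
    by_contra hz0
    refine hone (Module.End.hasEigenvalue_of_hasEigenvector (x := z) ⟨?_, hz0⟩)
    rw [Module.End.mem_eigenspace_iff, one_smul]
    exact (hrestr z).symm.trans hz
  have hn : 0 < orderOf σ := h.orderOf_pos hlift
  have hτ : ∀ x, TodaWeyl.lieIter τ (orderOf σ) x = x := by
    intro x
    rw [← TodaWeyl.toLinearEquiv_pow_apply, ← horder, pow_orderOf_eq_one]
    rfl
  -- This is where equality of orders matters: the period of the lift is no larger than that of σ,
  -- so its proper powers below the order still move some root.
  have hmin : ∀ k, 0 < k → k < orderOf σ → ∃ β, (π ^ k) β ≠ β := by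
    intro k hk0 hk
    by_contra! hc
    exact absurd (orderOf_le_of_pow_eq_one hk0 (h.pow_eq_one_of_forall hlift hc)) (not_le.mpr hk)
  have hγ' : ∀ α : H.root, ∃! i : Fin s, ∃ k : ℕ, (π ^ k) (γ i) = α := by
    simpa only [h.sameOrbit_iff hlift] using hγ
  have hΛσ : σ Λp = μ • Λp := hΛ.apply_eq_smul
  -- An eigenvalue of an element of finite order is a root of unity.
  have hμ : ‖μ‖ = 1 := by
    have h1 : ∀ k : ℕ, (σ ^ k) Λp = μ ^ k • Λp := by
      intro k
      induction k with
      | zero => rw [pow_zero, pow_zero, one_smul]; rfl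
      | succ k ih =>
        rw [pow_succ', LinearEquiv.mul_apply, ih, map_smul, hΛσ, smul_smul, pow_succ]
    have h2 := h1 (orderOf σ)
    rw [pow_orderOf_eq_one] at h2
    have h3 : μ ^ orderOf σ = 1 :=
      smul_left_injective ℂ hΛ.2 (h2.symm.trans (one_smul ℂ Λp).symm)
    exact Complex.norm_eq_one_of_pow_eq_one h3 hn.ne'
  have hΛτ : τ (Λp : L) = μ • (Λp : L) := by
    rw [hlift, hΛσ]
    rfl
  refine ⟨h.exists_commute hn hτ, fun E star hstar hcomm M => ?_⟩
  obtain rfl := hstar.eq_conjStar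
  exact h.isMassSpectrum_iff hell hn hτ hmin hγ' hμ hΛτ hcomm M
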